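/- For a finite undirected unweighted graph $G=(V,E)$ and a set $\mathcal P\subseteq V\times V$ of pairs, an $(\alpha,\beta)$ $\mathcal P$-spanner of $G$ is a subgraph $H=(V,E_H)$ of $G$ such that $\delta_H(s,t)\le \alpha\,\delta_G(s,t)+\beta$ for every $(s,t)\in\mathcal P$, where $\delta$ denotes the distance ($\infty$ for disconnected pairs); its size is $|E_H|$. **Theorem.** (1) There are an algorithm and an absolute constant $C$ such that, for every integer $k\ge 1$, every graph $G=(V,E)$ on $n$ vertices and every $\mathcal P\subseteq V\times V$, the algorithm, on input $(G,\mathcal P,k)$, computes a $(1,4k)$ $\mathcal P$-spanner of $G$ of size at most $$C\cdot n^{1+\frac{1}{2k+1}}\left(\sqrt{(4k+5)\,|\mathcal P|}\right)^{\frac{k}{2k+1}}$$ in time polynomial in $n$ (uniformly in $k$). (2) There are an algorithm and an absolute constant $C$ such that, for every graph $G=(V,E)$ on $n$ vertices and every $\mathcal P\subseteq V\times V$, the algorithm, on input $(G,\mathcal P)$, computes a $(1,4\log n)$ $\mathcal P$-spanner of $G$ of size at most $C\, n\,(|\mathcal P|\log n)^{1/4}$ in time polynomial in $n$. Here $\log$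 is the natural logarithm. Time is counted on a random access machine whose registers and array cells hold natural numbers and whose arithmetic operations are addition and truncated subtraction, at unit cost. -/

import Mathlib

namespace PairwiseSpanner

/-! ## Pairwise spanners -/

/-- `H` is an `(α, β)` `P`-spanner of `G`: a subgraph of `G` (on all the vertices) such that
`δ_H(s, t) ≤ α * δ_G(s, t) + β` for every `(s, t) ∈ P`. If `s` and `t` are disconnected in `G`,
then `δ_G(s, t) = ∞` and nothing is required of the pair; otherwise `δ_H(s, t)` has to be finite,
that is, `s` and `t` have to be connected in `H`. -/
def IsPairwiseSpanner {V : Type*} (G : SimpleGraph V) (P : Finset (V × V)) (α β : ℝ)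
    (H : SimpleGraph V) : Prop :=
  H ≤ G ∧ ∀ s t : V, (s, t) ∈ P → G.Reachable s t →
    H.Reachable s t ∧ (H.dist s t : ℝ) ≤ α * (G.dist s t : ℝ) + β

/-! ## The machine model

A random access machine, programmed in a language of while-programs. A program uses finitely many
registers and finitely many two-dimensional arrays, all holding natural numbers. The arithmetic
operations are addition and truncated subtraction, at unit cost; there is no multiplication, so one
operation makes numbers at most one bit longer, and polynomial time on this machine is
polynomial time in the usual sense. -/

/-- A memory content: the registers, and the cells `arr a i j` of the arrays. -/
structure State where
  reg : ℕ → ℕ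
  arr : ℕ → ℕ → ℕ → ℕ

/-- Arithmetic expressions. Register and array names are fixed in the program text,
whereas the indices into an array are computed. -/
inductive Expr where
  | const (c : ℕ)
  | reg (x : ℕ)
  | cell (a : ℕ) (i j : Expr)
  | add (e₁ e₂ : Expr)
  | sub (e₁ e₂ : Expr)

/-- The value of an expression. -/
def Expr.eval (s : State) : Expr → ℕ
  | .const c => c
  | .reg x => s.reg x
  | .cell a i j => s.arr a (i.eval s) (j.eval s)
  | .add e₁ e₂ => e₁.eval s + e₂.eval s
  | .sub e₁ e₂ => e₁.eval s - e₂.eval s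

/-- The number of steps it takes to evaluate an expression: one for each operation in it. -/
def Expr.cost : Expr → ℕ
  | .const _ => 1
  | .reg _ => 1
  | .cell _ i j => i.cost + j.cost + 1
  | .add e₁ e₂ => e₁.cost + e₂.cost + 1
  | .sub e₁ e₂ => e₁.cost + e₂.cost + 1

/-- Programs. A test `e` succeeds when the value of `e` is not zero. -/
inductive Prog where
  | skip
  | assign (x : ℕ) (e : Expr)
  | store (a : ℕ) (i j e : Expr)
  | seq (p q : Prog)
  | ite (e : Expr) (p q : Prog)
  | loop (e : Expr) (p : Prog)

/-- Overwrite one register. -/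
def State.setReg (s : State) (x v : ℕ) : State :=
  { s with reg := fun y => if y = x then v else s.reg y }

/-- Overwrite one array cell. -/
def State.setCell (s : State) (a i j v : ℕ) : State :=
  { s with arr := fun a' i' j' => if a' = a ∧ i' = i ∧ j' = j then v else s.arr a' i' j' }

/-- `Exec p s s' t`: started in the memory content `s`, the program `p` halts after exactly `t`
steps, with memory content `s'`. -/
inductive Exec : Prog → State → State → ℕ → Prop where
  | skip (s : State) : Exec .skip s s 1
  | assign (s : State) (x : ℕ) (e : Expr) :
      Exec (.assign x e) s (s.setReg x (e.eval s)) (e.cost + 1)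
  | store (s : State) (a : ℕ) (i j e : Expr) :
      Exec (.store a i j e) s (s.setCell a (i.eval s) (j.eval s) (e.eval s))
        (i.cost + j.cost + e.cost + 1)
  | seq {p q : Prog} {s s' s'' : State} {t t' : ℕ} :
      Exec p s s' t → Exec q s' s'' t' → Exec (.seq p q) s s'' (t + t')
  | ite_true {e : Expr} {p q : Prog} {s s' : State} {t : ℕ} :
      e.eval s ≠ 0 → Exec p s s' t → Exec (.ite e p q) s s' (e.cost + 1 + t)
  | ite_false {e : Expr} {p q : Prog} {s s' : State} {t : ℕ} :
      e.eval s = 0 → Exec q s s' t → Exec (.ite e p q) s s' (e.cost + 1 + t)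
  | loop_done {e : Expr} {p : Prog} {s : State} :
      e.eval s = 0 → Exec (.loop e p) s s (e.cost + 1)
  | loop_step {e : Expr} {p : Prog} {s s' s'' : State} {t t' : ℕ} :
      e.eval s ≠ 0 → Exec p s s' t → Exec (.loop e p) s' s'' t' →
        Exec (.loop e p) s s'' (e.cost + 1 + t + t')

/-- The indicator `0`/`1` of a proposition. -/
noncomputable def bit (p : Prop) : ℕ :=
  open Classical in if p then 1 else 0

/-- The initial memory content on the input `(G, P, k)`, where `G` is a graph on `n` vertices:
register `0` holds `n`, register `1` holds `k`, array `0` is the adjacency matrix of `G`, array `1`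
is the `0`/`1` matrix of the set `P` of pairs, and all the other registers and cells are `0`. -/
noncomputable def inputState {n : ℕ} (G : SimpleGraph (Fin n)) (P : Finset (Fin n × Fin n))
    (k : ℕ) : State where
  reg x := if x = 0 then n else if x = 1 then k else 0
  arr a i j :=
    if a = 0 then bit (∃ (hi : i < n) (hj : j < n), G.Adj ⟨i, hi⟩ ⟨j, hj⟩)
    else if a = 1 then bit (∃ (hi : i < n) (hj : j < n), (⟨i, hi⟩, ⟨j, hj⟩) ∈ P)
    else 0

/-- Started in the memory content `s`, the program `prog` halts after at most `T` steps, and at that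
time array `2` holds the adjacency matrix of the graph `H`. -/
def OutputsWithin {n : ℕ} (prog : Prog) (s : State) (H : SimpleGraph (Fin n)) (T : ℕ) : Prop :=
  ∃ (s' : State) (t : ℕ), Exec prog s s' t ∧ t ≤ T ∧
    ∀ i j : Fin n, s'.arr 2 i j = bit (H.Adj i j)

end PairwiseSpanner

/-!
Both parts rest on one greedy construction. For a threshold `h`, clusters with at least `h` members
are formed around centres until every vertex has at most `h` neighbours outside the clusters. The
initial graph contains all the edges with an end vertex outside the clusters and the stars of the
clusters (`IsThresholdClustering`, `clusterGraph`); it has `O(n * h)` edges, and there are at most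
`n / h` centres. Then the pairs are treated in turn. If the current graph `H` does not yet serve
`(s, t)`, a prefix and a suffix of a shortest path from `s` to `t` are bought, and among all
purchases that serve the pair one with the best ratio of gain to squared cost is taken
(`IsGreedyStep`). The gain is the drop of the potential, which is the sum of the truncated distances
in `H` between the centres.

The key is `exists_buy`: there is always a purchase whose squared cost is at most `O(R ^ 2)` times
its gain, where `R ^ k` is about the number of centres. All the missing edges of the path run
between clusters, and a shortest path meets a cluster at most three times. Consider the first `R ^ i`
missing edges from the left and from the right, for `i = 0, 1, …`. At each level, either some pair
of their clusters is already connected in `H` with an additive error of `4 * (k - i)`, up to a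
constant, or none is. For `i = 0` none is, as otherwise the pair would be served. At the last level
`i` where none is, the next level supplies a connected pair of clusters (or the levels are exhausted,
and the whole path is bought). Buying up to these clusters costs at most `2 * R ^ (i + 1)` edges,
and it shortens the distance between all the roughly `R ^ (2 * i)` pairs of centres of level `i`.

As the potential drops by at most `(4 * k + 1)` times the squared number of centres altogether, the
Cauchy-Schwarz inequality bounds the number of edges bought for all the pairs
(`GreedyRun.ncard_le`), and the balanced choice of `h` gives the size of the theorem
(`IsOutcome.ncard_le`). The algorithm cannot compute the real number in this choice, so it tries
all the thresholds `h` from `1` to `n`, and it outputs the smallest graph obtained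
(`ncard_le_of_forall_outcome`). For the logarithmic case, the parameter `k` is the integer part of
the logarithm of `n` to base `3`, which is at most `log n` (`mul_threshold_log_le`).

For the running time, the algorithm is written in a language `Cmd` of commands whose loops and sums
range over the numbers below `n`. Every such command translates into a program for the machine that
runs in polynomial time (`Cmd.exec_compile`), so only the effect of the commands has to be
analysed. Multiplications are replaced by bounded sums.

Register `0` holds `n` and register `1` holds `k` throughout. The arrays are used as follows: `0` and
`1` are the input, `2` is the output, `3` is the current graph `H`, `4` and `5` are the distance
matrices of `G` and `H`, `6` and `7` are the graph and the distances after a purchase under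
consideration, row `0` of array `8` is a shortest path, `9` is the graph after the best purchase so
far, row `0` of array `10` encodes the clusters, and `11` is auxiliary.
-/

namespace PairwiseSpanner

/-! ### A structured language of bounded loops -/

/-- Numerical terms with conditionals and bounded sums: `sum x e` is the sum of the values of `e`
as register `x` runs over all the numbers below the content of register `0`. -/
inductive Term where
  | const (c : ℕ)
  | reg (x : ℕ)
  | cell (a : ℕ) (i j : Term)
  | add (e₁ e₂ : Term)
  | sub (e₁ e₂ : Term)
  | ite (c e₁ e₂ : Term)
  | sum (x : ℕ) (e : Term)

namespace Term

/-- The value of a term. -/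
def eval : State → Term → ℕ
  | _, .const c => c
  | s, .reg x => s.reg x
  | s, .cell a i j => s.arr a (i.eval s) (j.eval s)
  | s, .add e₁ e₂ => e₁.eval s + e₂.eval s
  | s, .sub e₁ e₂ => e₁.eval s - e₂.eval s
  | s, .ite c e₁ e₂ => if c.eval s ≠ 0 then e₁.eval s else e₂.eval s
  | s, .sum x e => ∑ i ∈ Finset.range (s.reg 0), e.eval (s.setReg x i)

/-- All the registers of the term are below `d`, and none of its sums runs over register `0`. -/
def ok (d : ℕ) : Term → Bool
  | .const _ => true
  | .reg x => x < d
  | .cell _ i j => i.ok d && j.ok d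
  | .add e₁ e₂ => e₁.ok d && e₂.ok d
  | .sub e₁ e₂ => e₁.ok d && e₂.ok d
  | .ite c e₁ e₂ => c.ok d && e₁.ok d && e₂.ok d
  | .sum x e => decide (x < d) && decide (x ≠ 0) && e.ok d

/-- The term does not mention array `a`. -/
def avoids (a : ℕ) : Term → Bool
  | .const _ => true
  | .reg _ => true
  | .cell b i j => decide (b ≠ a) && i.avoids a && j.avoids a
  | .add e₁ e₂ => e₁.avoids a && e₂.avoids a
  | .sub e₁ e₂ => e₁.avoids a && e₂.avoids a
  | .ite c e₁ e₂ => c.avoids a && e₁.avoids a && e₂.avoids a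
  | .sum _ e => e.avoids a

/-- The program that leaves the value of the term in register `d`, and uses only the registers
from `d` on (apart from the variables of the sums, whose contents it restores). -/
def compile : ℕ → Term → Prog
  | d, .const c => .assign d (.const c)
  | d, .reg x => .assign d (.reg x)
  | d, .cell a i j => .seq (i.compile d) (.seq (j.compile (d + 1))
      (.assign d (.cell a (.reg d) (.reg (d + 1)))))
  | d, .add e₁ e₂ => .seq (e₁.compile d) (.seq (e₂.compile (d + 1))
      (.assign d (.add (.reg d) (.reg (d + 1)))))
  | d, .sub e₁ e₂ => .seq (e₁.compile d) (.seq (e₂.compile (d + 1))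
      (.assign d (.sub (.reg d) (.reg (d + 1)))))
  | d, .ite c e₁ e₂ => .seq (c.compile d) (.ite (.reg d) (e₁.compile d) (e₂.compile d))
  | d, .sum x e => .seq (.assign (d + 1) (.reg x)) (.seq (.assign d (.const 0))
      (.seq (.assign x (.const 0)) (.seq
        (.loop (.sub (.reg 0) (.reg x)) (.seq (e.compile (d + 2))
          (.seq (.assign d (.add (.reg d) (.reg (d + 2))))
            (.assign x (.add (.reg x) (.const 1))))))
        (.assign x (.reg (d + 1))))))

end Term

/-- Agreement of two memory contents on all the arrays and on the registers below `d`. -/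
def State.Agree (d : ℕ) (s s' : State) : Prop :=
  (∀ x < d, s'.reg x = s.reg x) ∧ s'.arr = s.arr

lemma State.Agree.refl (d : ℕ) (s : State) : s.Agree d s := ⟨fun _ _ => rfl, rfl⟩

lemma State.Agree.trans {d : ℕ} {s s' s'' : State} (h : s.Agree d s') (h' : s'.Agree d s'') :
    s.Agree d s'' :=
  ⟨fun x hx => (h'.1 x hx).trans (h.1 x hx), h'.2.trans h.2⟩

lemma State.Agree.mono {d d' : ℕ} {s s' : State} (h : s.Agree d' s') (hd : d ≤ d') :
    s.Agree d s' :=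
  ⟨fun x hx => h.1 x (hx.trans_le hd), h.2⟩

lemma State.Agree.setReg {d : ℕ} {s s' : State} (h : s.Agree d s') (x v : ℕ) :
    (s.setReg x v).Agree d (s'.setReg x v) := by
  refine ⟨fun y hy => ?_, h.2⟩
  simp only [State.setReg]
  split_ifs
  · rfl
  · exact h.1 y hy

lemma State.agree_setReg {d x : ℕ} (s : State) (hx : d ≤ x) (v : ℕ) : s.Agree d (s.setReg x v) := by
  refine ⟨fun y hy => ?_, rfl⟩
  simp only [State.setReg]
  rw [if_neg (by omega)]

@[simp] lemma State.setReg_reg (s : State) (x v y : ℕ) :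
    (s.setReg x v).reg y = if y = x then v else s.reg y := rfl

@[simp] lemma State.setReg_arr (s : State) (x v : ℕ) : (s.setReg x v).arr = s.arr := rfl

@[simp] lemma State.setCell_reg (s : State) (a i j v : ℕ) : (s.setCell a i j v).reg = s.reg := rfl

lemma State.ext' {s s' : State} (h : s.reg = s'.reg) (h' : s.arr = s'.arr) : s = s' := by
  cases s; cases s'; simp_all

namespace Term

lemma ok_mono {d d' : ℕ} (hd : d ≤ d') : ∀ {e : Term}, e.ok d → e.ok d'
  | .const _, _ => rfl
  | .reg x, h => by simp [ok] at h ⊢; omega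
  | .cell _ i j, h => by
      simp only [ok, Bool.and_eq_true] at h ⊢; exact ⟨ok_mono hd h.1, ok_mono hd h.2⟩
  | .add i j, h => by
      simp only [ok, Bool.and_eq_true] at h ⊢; exact ⟨ok_mono hd h.1, ok_mono hd h.2⟩
  | .sub i j, h => by
      simp only [ok, Bool.and_eq_true] at h ⊢; exact ⟨ok_mono hd h.1, ok_mono hd h.2⟩
  | .ite c i j, h => by
      simp only [ok, Bool.and_eq_true] at h ⊢
      exact ⟨⟨ok_mono hd h.1.1, ok_mono hd h.1.2⟩, ok_mono hd h.2⟩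
  | .sum x e, h => by
      simp only [ok, Bool.and_eq_true, decide_eq_true_eq] at h ⊢
      exact ⟨⟨h.1.1.trans_le hd, h.1.2⟩, ok_mono hd h.2⟩

lemma eval_congr {d : ℕ} (hd : 0 < d) : ∀ {e : Term} {s s' : State}, e.ok d → s.Agree d s' →
    e.eval s' = e.eval s
  | .const _, _, _, _, _ => rfl
  | .reg x, s, s', h, hs => by simp [ok] at h; exact hs.1 x h
  | .cell _ i j, s, s', h, hs => by
      simp only [ok, Bool.and_eq_true] at h
      simp only [eval, eval_congr hd h.1 hs, eval_congr hd h.2 hs, hs.2]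
  | .add i j, s, s', h, hs => by
      simp only [ok, Bool.and_eq_true] at h
      simp only [eval, eval_congr hd h.1 hs, eval_congr hd h.2 hs]
  | .sub i j, s, s', h, hs => by
      simp only [ok, Bool.and_eq_true] at h
      simp only [eval, eval_congr hd h.1 hs, eval_congr hd h.2 hs]
  | .ite c i j, s, s', h, hs => by
      simp only [ok, Bool.and_eq_true] at h
      simp only [eval, eval_congr hd h.1.1 hs, eval_congr hd h.1.2 hs, eval_congr hd h.2 hs]
  | .sum x e, s, s', h, hs => by
      simp only [ok, Bool.and_eq_true, decide_eq_true_eq] at h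
      simp only [eval, hs.1 0 hd]
      exact Finset.sum_congr rfl fun i _ => eval_congr hd h.2 (hs.setReg x i)

lemma eval_congr_avoids {a : ℕ} : ∀ {e : Term} {s s' : State}, e.avoids a → s'.reg = s.reg →
    (∀ b ≠ a, s'.arr b = s.arr b) → e.eval s' = e.eval s
  | .const _, _, _, _, _, _ => rfl
  | .reg x, s, s', _, hr, _ => by simp only [eval, hr]
  | .cell b i j, s, s', h, hr, hs => by
      simp only [avoids, Bool.and_eq_true, decide_eq_true_eq] at h
      simp only [eval, eval_congr_avoids h.1.2 hr hs, eval_congr_avoids h.2 hr hs, hs b h.1.1]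
  | .add i j, s, s', h, hr, hs => by
      simp only [avoids, Bool.and_eq_true] at h
      simp only [eval, eval_congr_avoids h.1 hr hs, eval_congr_avoids h.2 hr hs]
  | .sub i j, s, s', h, hr, hs => by
      simp only [avoids, Bool.and_eq_true] at h
      simp only [eval, eval_congr_avoids h.1 hr hs, eval_congr_avoids h.2 hr hs]
  | .ite c i j, s, s', h, hr, hs => by
      simp only [avoids, Bool.and_eq_true] at h
      simp only [eval, eval_congr_avoids h.1.1 hr hs, eval_congr_avoids h.1.2 hr hs,
        eval_congr_avoids h.2 hr hs]
  | .sum x e, s, s', h, hr, hs => by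
      simp only [avoids] at h
      simp only [eval, hr]
      refine Finset.sum_congr rfl fun i _ => eval_congr_avoids h ?_ hs
      funext y
      simp only [State.setReg_reg, hr]

end Term

/-- The rule for a loop in which register `x` counts from `0` up to the content `m` of
register `0`, with the loop invariant `I`; each round takes at most `B` steps. -/
lemma exec_count_loop {x : ℕ} {q : Prog} {B m : ℕ} {I : ℕ → State → Prop}
    (hI : ∀ i st, I i st → st.reg 0 = m ∧ st.reg x = i)
    (hq : ∀ i < m, ∀ st, I i st → ∃ st' t, Exec q st st' t ∧ t ≤ B ∧ I (i + 1) st')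
    {s : State} (hs : I 0 s) :
    ∃ s' t, Exec (.loop (.sub (.reg 0) (.reg x)) q) s s' t ∧ t ≤ m * (B + 4) + 4 ∧ I m s' := by
  have key : ∀ j i, i + j = m → ∀ st, I i st → ∃ s' t,
      Exec (.loop (.sub (.reg 0) (.reg x)) q) st s' t ∧ t ≤ j * (B + 4) + 4 ∧ I m s' := by
    intro j
    induction j with
    | zero =>
      intro i hi st hst
      obtain ⟨h0, hx⟩ := hI i st hst
      refine ⟨st, _, Exec.loop_done ?_, ?_, ?_⟩
      · simp only [Expr.eval, h0, hx]; omega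
      · simp [Expr.cost]
      · rwa [show m = i by omega]
    | succ j ih =>
      intro i hi st hst
      obtain ⟨h0, hx⟩ := hI i st hst
      obtain ⟨st', t, h1, h2, h3⟩ := hq i (by omega) st hst
      obtain ⟨s', t', h4, h5, h6⟩ := ih (i + 1) (by omega) st' h3
      refine ⟨s', _, Exec.loop_step ?_ h1 h4, ?_, h6⟩
      · simp only [Expr.eval, h0, hx]; omega
      · simp only [Expr.cost, add_mul, one_mul]; omega
  simpa using key m 0 (by simp) s hs

open Polynomial in
/-- The compiled term computes the value of the term in polynomial time. -/
lemma Term.exec_compile (e : Term) : ∀ (d : ℕ), 0 < d → e.ok d → ∃ T : ℕ[X], ∀ s : State,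
    ∃ s' t, Exec (e.compile d) s s' t ∧ t ≤ T.eval (s.reg 0) ∧ s'.reg d = e.eval s ∧
      s.Agree d s' := by
  induction e with
  | const c =>
    intro d hd h
    refine ⟨C 2, fun s => ⟨_, _, Exec.assign .., ?_, ?_, s.agree_setReg le_rfl _⟩⟩
    · simp [Expr.cost]
    · simp [Expr.eval, Term.eval]
  | reg x =>
    intro d hd h
    refine ⟨C 2, fun s => ⟨_, _, Exec.assign .., ?_, ?_, s.agree_setReg le_rfl _⟩⟩
    · simp [Expr.cost]
    · simp [Expr.eval, Term.eval]
  | cell a i j hi hj =>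
    intro d hd h
    simp only [ok, Bool.and_eq_true] at h
    obtain ⟨T₁, h₁⟩ := hi d hd h.1
    obtain ⟨T₂, h₂⟩ := hj (d + 1) (by omega) (ok_mono (by omega) h.2)
    refine ⟨T₁ + T₂ + C 4, fun s => ?_⟩
    obtain ⟨s', t, e1, l1, v1, a1⟩ := h₁ s
    obtain ⟨s'', t', e2, l2, v2, a2⟩ := h₂ s'
    refine ⟨_, _, e1.seq (e2.seq (Exec.assign ..)), ?_, ?_, ?_⟩
    · rw [a1.1 0 hd] at l2
      simp [Expr.cost]; omega
    · simp [Expr.eval, Term.eval, v2, a2.1 d (by omega), v1, a2.2, a1.2, eval_congr hd h.2 a1]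
    · exact (a1.trans (a2.mono (by omega))).trans (s''.agree_setReg le_rfl _)
  | add i j hi hj =>
    intro d hd h
    simp only [ok, Bool.and_eq_true] at h
    obtain ⟨T₁, h₁⟩ := hi d hd h.1
    obtain ⟨T₂, h₂⟩ := hj (d + 1) (by omega) (ok_mono (by omega) h.2)
    refine ⟨T₁ + T₂ + C 4, fun s => ?_⟩
    obtain ⟨s', t, e1, l1, v1, a1⟩ := h₁ s
    obtain ⟨s'', t', e2, l2, v2, a2⟩ := h₂ s'
    refine ⟨_, _, e1.seq (e2.seq (Exec.assign ..)), ?_, ?_, ?_⟩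
    · rw [a1.1 0 hd] at l2
      simp [Expr.cost]; omega
    · simp [Expr.eval, Term.eval, v2, a2.1 d (by omega), v1, eval_congr hd h.2 a1]
    · exact (a1.trans (a2.mono (by omega))).trans (s''.agree_setReg le_rfl _)
  | sub i j hi hj =>
    intro d hd h
    simp only [ok, Bool.and_eq_true] at h
    obtain ⟨T₁, h₁⟩ := hi d hd h.1
    obtain ⟨T₂, h₂⟩ := hj (d + 1) (by omega) (ok_mono (by omega) h.2)
    refine ⟨T₁ + T₂ + C 4, fun s => ?_⟩
    obtain ⟨s', t, e1, l1, v1, a1⟩ := h₁ s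
    obtain ⟨s'', t', e2, l2, v2, a2⟩ := h₂ s'
    refine ⟨_, _, e1.seq (e2.seq (Exec.assign ..)), ?_, ?_, ?_⟩
    · rw [a1.1 0 hd] at l2
      simp [Expr.cost]; omega
    · simp [Expr.eval, Term.eval, v2, a2.1 d (by omega), v1, eval_congr hd h.2 a1]
    · exact (a1.trans (a2.mono (by omega))).trans (s''.agree_setReg le_rfl _)
  | ite c i j hc hi hj =>
    intro d hd h
    simp only [ok, Bool.and_eq_true] at h
    obtain ⟨T₀, h₀⟩ := hc d hd h.1.1
    obtain ⟨T₁, h₁⟩ := hi d hd h.1.2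
    obtain ⟨T₂, h₂⟩ := hj d hd h.2
    refine ⟨T₀ + T₁ + T₂ + C 2, fun s => ?_⟩
    obtain ⟨s', t, e1, l1, v1, a1⟩ := h₀ s
    by_cases hv : c.eval s ≠ 0
    · obtain ⟨s'', t', e2, l2, v2, a2⟩ := h₁ s'
      refine ⟨_, _, e1.seq (Exec.ite_true ?_ e2), ?_, ?_, a1.trans a2⟩
      · simpa [Expr.eval, v1] using hv
      · rw [a1.1 0 hd] at l2
        simp [Expr.cost]; omega
      · rw [v2, eval_congr hd h.1.2 a1, Term.eval, if_pos hv]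
    · obtain ⟨s'', t', e2, l2, v2, a2⟩ := h₂ s'
      refine ⟨_, _, e1.seq (Exec.ite_false ?_ e2), ?_, ?_, a1.trans a2⟩
      · simpa [Expr.eval, v1] using hv
      · rw [a1.1 0 hd] at l2
        simp [Expr.cost]; omega
      · rw [v2, eval_congr hd h.2 a1, Term.eval, if_neg hv]
  | sum x e ih =>
    intro d hd h
    simp only [ok, Bool.and_eq_true, decide_eq_true_eq] at h
    obtain ⟨⟨hxd, hx0⟩, he⟩ := h
    obtain ⟨T, hT⟩ := ih (d + 2) (by omega) (ok_mono (by omega) he)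
    refine ⟨X * (T + C 12) + C 12, fun s => ?_⟩
    have hI := exec_count_loop (x := x) (m := s.reg 0) (B := T.eval (s.reg 0) + 8)
      (q := .seq (e.compile (d + 2)) (.seq (.assign d (.add (.reg d) (.reg (d + 2))))
            (.assign x (.add (.reg x) (.const 1)))))
      (I := fun i st => (s.setReg x i).Agree d st ∧ st.reg (d + 1) = s.reg x ∧
        st.reg d = ∑ j ∈ Finset.range i, e.eval (s.setReg x j))
      (fun i st hst => by
        refine ⟨(hst.1.1 0 hd).trans (by simp [hx0.symm]), (hst.1.1 x hxd).trans (by simp)⟩)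
      (fun i hi st hst => by
        obtain ⟨st', t, e1, l1, v1, a1⟩ := hT st
        refine ⟨_, _, e1.seq ((Exec.assign ..).seq (Exec.assign ..)), ?_, ⟨fun y hy => ?_, ?_⟩,
          ?_, ?_⟩
        · rw [hst.1.1 0 hd] at l1
          simp [Expr.cost, hx0.symm] at l1 ⊢; omega
        · have := hst.1.1 y hy
          have hh := a1.1 y (by omega)
          have hx' := hst.1.1 x hxd
          have hx'' := a1.1 x (by omega)
          simp only [State.setReg_reg, Expr.eval] at this hx' ⊢
          rw [if_neg (by omega : ¬ x = d), hx'', hx', if_neg (by omega : ¬ y = d), hh, this]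
          simp
          split_ifs <;> rfl
        · simp [a1.2, hst.1.2]
        · simp only [State.setReg_reg]
          rw [if_neg (by omega), if_neg (by omega), a1.1 (d + 1) (by omega), hst.2.1]
        · simp only [State.setReg_reg, Expr.eval]
          rw [if_neg (by omega), if_pos trivial, a1.1 d (by omega), hst.2.2, v1,
            Finset.sum_range_succ]
          congr 1
          exact eval_congr hd he hst.1)
      (s := ((s.setReg (d + 1) (s.reg x)).setReg d 0).setReg x 0)
      (by
        refine ⟨⟨fun y hy => ?_, rfl⟩, ?_, ?_⟩
        · simp only [State.setReg_reg]
          rw [if_neg (by omega : ¬ y = d + 1), if_neg (by omega : ¬ y = d)]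
        · simp only [State.setReg_reg]
          rw [if_neg (by omega), if_neg (by omega), if_pos trivial]
        · simp only [State.setReg_reg]
          rw [if_neg (by omega), if_pos trivial]; simp)
    obtain ⟨s', t, e1, l1, a1, b1, c1⟩ := hI
    refine ⟨_, _, (Exec.assign ..).seq ((Exec.assign ..).seq ((Exec.assign ..).seq
      (e1.seq (Exec.assign ..)))), ?_, ?_, ?_⟩
    · simp [Expr.cost]
      norm_num [add_assoc] at l1
      omega
    · simp only [State.setReg_reg]
      rw [if_neg (by omega), c1, Term.eval]
    · refine ⟨fun y hy => ?_, a1.2⟩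
      simp only [State.setReg_reg, Expr.eval, b1]
      have := a1.1 y hy
      simp only [State.setReg_reg] at this
      split_ifs with hyx
      · rw [hyx]
      · rw [this, if_neg hyx]

/-- Programs with bounded loops: in `for_ x c`, register `x` runs over all the numbers below the
content of register `0`. -/
inductive Cmd where
  | skip
  | set (x : ℕ) (e : Term)
  | store (a : ℕ) (i j e : Term)
  | seq (c c' : Cmd)
  | ite (e : Term) (c c' : Cmd)
  | for_ (x : ℕ) (c : Cmd)

/-- `f 0`, `f 1`, …, `f (m - 1)` applied in this order. -/
def iter (f : ℕ → State → State) : ℕ → State → State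
  | 0, s => s
  | m + 1, s => f m (iter f m s)

lemma iter_induction {f : ℕ → State → State} {m : ℕ} {s : State} (I : ℕ → State → Prop)
    (h0 : I 0 s) (hs : ∀ i < m, ∀ st, I i st → I (i + 1) (f i st)) : I m (iter f m s) := by
  induction m with
  | zero => exact h0
  | succ m ih => exact hs m m.lt_succ_self _ (ih fun i hi => hs i (hi.trans m.lt_succ_self))

namespace Cmd

/-- The memory content after the execution of a command. A loop restores the content of its
variable. -/
def sem : Cmd → State → State
  | .skip, s => s
  | .set x e, s => s.setReg x (e.eval s)
  | .store a i j e, s => s.setCell a (i.eval s) (j.eval s) (e.eval s)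
  | .seq c c', s => c'.sem (c.sem s)
  | .ite e c c', s => if e.eval s ≠ 0 then c.sem s else c'.sem s
  | .for_ x c, s => (iter (fun i st => c.sem (st.setReg x i)) (s.reg 0) s).setReg x (s.reg x)

/-- The command does not change register `x`. -/
def keepsReg (x : ℕ) : Cmd → Bool
  | .skip => true
  | .set y _ => decide (y ≠ x)
  | .store _ _ _ _ => true
  | .seq c c' => c.keepsReg x && c'.keepsReg x
  | .ite _ c c' => c.keepsReg x && c'.keepsReg x
  | .for_ y c => decide (y ≠ x) && c.keepsReg x

/-- The command does not change array `a`. -/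
def keepsArr (a : ℕ) : Cmd → Bool
  | .skip => true
  | .set _ _ => true
  | .store b _ _ _ => decide (b ≠ a)
  | .seq c c' => c.keepsArr a && c'.keepsArr a
  | .ite _ c c' => c.keepsArr a && c'.keepsArr a
  | .for_ _ c => c.keepsArr a

/-- All the registers are below `d`, register `0` is never written, and no loop body changes the
variable of the loop. -/
def ok (d : ℕ) : Cmd → Bool
  | .skip => true
  | .set x e => decide (x < d) && decide (x ≠ 0) && e.ok d
  | .store _ i j e => i.ok d && j.ok d && e.ok d
  | .seq c c' => c.ok d && c'.ok d
  | .ite e c c' => e.ok d && c.ok d && c'.ok d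
  | .for_ x c => decide (x < d) && decide (x ≠ 0) && c.keepsReg x && c.ok d

/-- The translation into the language of the machine; the registers from `d` on serve as auxiliary
memory. -/
def compile : ℕ → Cmd → Prog
  | _, .skip => .skip
  | d, .set x e => .seq (e.compile d) (.assign x (.reg d))
  | d, .store a i j e => .seq (i.compile d) (.seq (j.compile (d + 1)) (.seq (e.compile (d + 2))
      (.store a (.reg d) (.reg (d + 1)) (.reg (d + 2)))))
  | d, .seq c c' => .seq (c.compile d) (c'.compile d)
  | d, .ite e c c' => .seq (e.compile d) (.ite (.reg d) (c.compile d) (c'.compile d))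
  | d, .for_ x c => .seq (.assign d (.reg x)) (.seq (.assign x (.const 0)) (.seq
      (.loop (.sub (.reg 0) (.reg x)) (.seq (c.compile (d + 1))
        (.assign x (.add (.reg x) (.const 1)))))
      (.assign x (.reg d))))

lemma sem_reg {x : ℕ} : ∀ {c : Cmd} (s : State), c.keepsReg x → (c.sem s).reg x = s.reg x
  | .skip, _, _ => rfl
  | .set y e, s, h => by
      simp only [keepsReg, decide_eq_true_eq] at h
      simp [sem, h.symm]
  | .store _ _ _ _, _, _ => rfl
  | .seq c c', s, h => by
      simp only [keepsReg, Bool.and_eq_true] at h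
      rw [sem, sem_reg _ h.2, sem_reg _ h.1]
  | .ite e c c', s, h => by
      simp only [keepsReg, Bool.and_eq_true] at h
      rw [sem]
      split_ifs
      · exact sem_reg _ h.1
      · exact sem_reg _ h.2
  | .for_ y c, s, h => by
      simp only [keepsReg, Bool.and_eq_true, decide_eq_true_eq] at h
      simp only [sem, State.setReg_reg, h.1.symm, if_false]
      refine iter_induction (fun _ st => st.reg x = s.reg x) rfl fun i _ st hst => ?_
      rw [sem_reg _ h.2]
      simpa [h.1.symm] using hst

lemma sem_arr {a : ℕ} : ∀ {c : Cmd} (s : State), c.keepsArr a → (c.sem s).arr a = s.arr a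
  | .skip, _, _ => rfl
  | .set y e, s, h => rfl
  | .store b _ _ _, s, h => by
      simp only [keepsArr, decide_eq_true_eq] at h
      simp [sem, State.setCell, h.symm]
  | .seq c c', s, h => by
      simp only [keepsArr, Bool.and_eq_true] at h
      rw [sem, sem_arr _ h.2, sem_arr _ h.1]
  | .ite e c c', s, h => by
      simp only [keepsArr, Bool.and_eq_true] at h
      rw [sem]
      split_ifs
      · exact sem_arr _ h.1
      · exact sem_arr _ h.2
  | .for_ y c, s, h => by
      simp only [keepsArr] at h
      simp only [sem, State.setReg_arr]
      refine iter_induction (fun _ st => st.arr a = s.arr a) rfl fun i _ st hst => ?_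
      rw [sem_arr _ h]
      exact hst

lemma sem_reg_zero {d : ℕ} : ∀ {c : Cmd}, c.ok d → c.keepsReg 0
  | .skip, _ => rfl
  | .set y e, h => by
      simp only [ok, Bool.and_eq_true, decide_eq_true_eq] at h
      simp [keepsReg, h.1.2]
  | .store b _ _ _, h => rfl
  | .seq c c', h => by
      simp only [ok, Bool.and_eq_true] at h
      simp [keepsReg, sem_reg_zero h.1, sem_reg_zero h.2]
  | .ite e c c', h => by
      simp only [ok, Bool.and_eq_true] at h
      simp [keepsReg, sem_reg_zero h.1.2, sem_reg_zero h.2]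
  | .for_ y c, h => by
      simp only [ok, Bool.and_eq_true, decide_eq_true_eq] at h
      simp [keepsReg, sem_reg_zero h.2, h.1.1.2]

lemma ok_mono {c : Cmd} {d d' : ℕ} (hd : d ≤ d') (h : c.ok d) : c.ok d' := by
  induction c with
  | skip => rfl
  | set x e =>
    simp only [ok, Bool.and_eq_true, decide_eq_true_eq] at h ⊢
    exact ⟨⟨by omega, h.1.2⟩, Term.ok_mono hd h.2⟩
  | store a i j e =>
    simp only [ok, Bool.and_eq_true] at h ⊢
    exact ⟨⟨Term.ok_mono hd h.1.1, Term.ok_mono hd h.1.2⟩, Term.ok_mono hd h.2⟩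
  | seq c c' i1 i2 =>
    simp only [ok, Bool.and_eq_true] at h ⊢
    exact ⟨i1 h.1, i2 h.2⟩
  | ite e c c' i1 i2 =>
    simp only [ok, Bool.and_eq_true] at h ⊢
    exact ⟨⟨Term.ok_mono hd h.1.1, i1 h.1.2⟩, i2 h.2⟩
  | for_ x c i1 =>
    simp only [ok, Bool.and_eq_true, decide_eq_true_eq] at h ⊢
    exact ⟨⟨⟨by omega, h.1.1.2⟩, h.1.2⟩, i1 h.2⟩

/-- Register `d` lies outside the registers of a command that is `ok d`. -/
lemma keepsReg_of_ok {c : Cmd} {d : ℕ} (h : c.ok d) : c.keepsReg d := by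
  induction c with
  | skip => rfl
  | set x e =>
    simp only [ok, keepsReg, Bool.and_eq_true, decide_eq_true_eq] at h ⊢
    omega
  | store a i j e => rfl
  | seq c c' i1 i2 =>
    simp only [ok, keepsReg, Bool.and_eq_true] at h ⊢
    exact ⟨i1 h.1, i2 h.2⟩
  | ite e c c' i1 i2 =>
    simp only [ok, keepsReg, Bool.and_eq_true] at h ⊢
    exact ⟨i1 h.1.2, i2 h.2⟩
  | for_ x c i1 =>
    simp only [ok, keepsReg, Bool.and_eq_true, decide_eq_true_eq] at h ⊢
    exact ⟨by omega, i1 h.2⟩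

lemma sem_congr {d : ℕ} (hd : 0 < d) : ∀ {c : Cmd} {s s' : State}, c.ok d → s.Agree d s' →
    (c.sem s).Agree d (c.sem s')
  | .skip, _, _, _, hs => hs
  | .set y e, s, s', h, hs => by
      simp only [ok, Bool.and_eq_true] at h
      rw [sem, sem, Term.eval_congr hd h.2 hs]
      exact hs.setReg _ _
  | .store b i j e, s, s', h, hs => by
      simp only [ok, Bool.and_eq_true] at h
      rw [sem, sem, Term.eval_congr hd h.2 hs, Term.eval_congr hd h.1.2 hs,
        Term.eval_congr hd h.1.1 hs]
      exact ⟨hs.1, by simp [State.setCell, hs.2]⟩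
  | .seq c c', s, s', h, hs => by
      simp only [ok, Bool.and_eq_true] at h
      rw [sem, sem]
      exact sem_congr hd h.2 (sem_congr hd h.1 hs)
  | .ite e c c', s, s', h, hs => by
      simp only [ok, Bool.and_eq_true] at h
      rw [sem, sem, Term.eval_congr hd h.1.1 hs]
      split_ifs
      · exact sem_congr hd h.1.2 hs
      · exact sem_congr hd h.2 hs
  | .for_ y c, s, s', h, hs => by
      simp only [ok, Bool.and_eq_true, decide_eq_true_eq] at h
      rw [sem, sem, hs.1 0 hd, hs.1 y h.1.1.1]
      refine State.Agree.setReg ?_ _ _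
      induction s.reg 0 with
      | zero => exact hs
      | succ m ih => exact sem_congr hd h.2 (ih.setReg _ _)

open Polynomial in
/-- The compiled command has the effect of the command, and it runs in polynomial time. -/
lemma exec_compile (c : Cmd) : ∀ (d : ℕ), 0 < d → c.ok d → ∃ T : ℕ[X], ∀ s : State,
    ∃ s' t, Exec (c.compile d) s s' t ∧ t ≤ T.eval (s.reg 0) ∧ (c.sem s).Agree d s' := by
  induction c with
  | skip =>
    intro d hd h
    exact ⟨C 1, fun s => ⟨_, _, Exec.skip s, by simp, State.Agree.refl _ _⟩⟩
  | set x e =>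
    intro d hd h
    simp only [ok, Bool.and_eq_true, decide_eq_true_eq] at h
    obtain ⟨T, hT⟩ := e.exec_compile d hd h.2
    refine ⟨T + C 2, fun s => ?_⟩
    obtain ⟨s', t, e1, l1, v1, a1⟩ := hT s
    refine ⟨_, _, e1.seq (Exec.assign ..), by simpa [Expr.cost] using l1, ?_⟩
    simp only [Expr.eval, sem, v1]
    exact a1.setReg _ _
  | store a i j e =>
    intro d hd h
    simp only [ok, Bool.and_eq_true] at h
    obtain ⟨T₁, h₁⟩ := i.exec_compile d hd h.1.1
    obtain ⟨T₂, h₂⟩ := j.exec_compile (d + 1) (by omega) (Term.ok_mono (by omega) h.1.2)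
    obtain ⟨T₃, h₃⟩ := e.exec_compile (d + 2) (by omega) (Term.ok_mono (by omega) h.2)
    refine ⟨T₁ + T₂ + T₃ + C 4, fun s => ?_⟩
    obtain ⟨s₁, t₁, e1, l1, v1, a1⟩ := h₁ s
    obtain ⟨s₂, t₂, e2, l2, v2, a2⟩ := h₂ s₁
    obtain ⟨s₃, t₃, e3, l3, v3, a3⟩ := h₃ s₂
    have a2' := a1.trans (a2.mono (by omega))
    have a3' := a2'.trans (a3.mono (by omega))
    refine ⟨_, _, e1.seq (e2.seq (e3.seq (Exec.store ..))), ?_, ?_⟩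
    · rw [a1.1 0 hd] at l2
      rw [a2'.1 0 hd] at l3
      simp [Expr.cost]; omega
    · simp only [Expr.eval, sem, v3, a3.1 (d + 1) (by omega), v2, a3.1 d (by omega),
        a2.1 d (by omega), v1, Term.eval_congr hd h.1.2 a1, Term.eval_congr hd h.2 a2']
      exact ⟨a3'.1, by simp [State.setCell, a3'.2]⟩
  | seq c c' ih ih' =>
    intro d hd h
    simp only [ok, Bool.and_eq_true] at h
    obtain ⟨T₁, h₁⟩ := ih d hd h.1
    obtain ⟨T₂, h₂⟩ := ih' d hd h.2
    refine ⟨T₁ + T₂, fun s => ?_⟩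
    obtain ⟨s₁, t₁, e1, l1, a1⟩ := h₁ s
    obtain ⟨s₂, t₂, e2, l2, a2⟩ := h₂ s₁
    refine ⟨_, _, e1.seq e2, ?_, (sem_congr hd h.2 a1).trans a2⟩
    rw [a1.1 0 hd, sem_reg _ (sem_reg_zero h.1)] at l2
    simp; omega
  | ite e c c' ih ih' =>
    intro d hd h
    simp only [ok, Bool.and_eq_true] at h
    obtain ⟨T₀, h₀⟩ := e.exec_compile d hd h.1.1
    obtain ⟨T₁, h₁⟩ := ih d hd h.1.2
    obtain ⟨T₂, h₂⟩ := ih' d hd h.2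
    refine ⟨T₀ + T₁ + T₂ + C 2, fun s => ?_⟩
    obtain ⟨s₀, t₀, e0, l0, v0, a0⟩ := h₀ s
    by_cases hv : e.eval s ≠ 0
    · obtain ⟨s₁, t₁, e1, l1, a1⟩ := h₁ s₀
      refine ⟨_, _, e0.seq (Exec.ite_true ?_ e1), ?_, ?_⟩
      · simpa [Expr.eval, v0] using hv
      · rw [a0.1 0 hd] at l1
        simp [Expr.cost]; omega
      · rw [sem, if_pos hv]
        exact (sem_congr hd h.1.2 a0).trans a1
    · obtain ⟨s₁, t₁, e1, l1, a1⟩ := h₂ s₀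
      refine ⟨_, _, e0.seq (Exec.ite_false ?_ e1), ?_, ?_⟩
      · simpa [Expr.eval, v0] using hv
      · rw [a0.1 0 hd] at l1
        simp [Expr.cost]; omega
      · rw [sem, if_neg hv]
        exact (sem_congr hd h.2 a0).trans a1
  | for_ x c ih =>
    intro d hd h
    simp only [ok, Bool.and_eq_true, decide_eq_true_eq] at h
    obtain ⟨⟨⟨hxd, hx0⟩, hk⟩, hc⟩ := h
    obtain ⟨T, hT⟩ := ih (d + 1) (by omega) (ok_mono (by omega) hc)
    refine ⟨X * (T + C 12) + C 12, fun s => ?_⟩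
    set f : ℕ → State → State := fun i st => c.sem (st.setReg x i) with hf
    have hreg0 : ∀ i, (iter f i s).reg 0 = s.reg 0 := fun i =>
      iter_induction (fun _ st => st.reg 0 = s.reg 0) rfl fun j _ st hst => by
        rw [hf]
        simp only
        rw [sem_reg _ (sem_reg_zero hc), State.setReg_reg, if_neg hx0.symm, hst]
    have hI := exec_count_loop (x := x) (m := s.reg 0) (B := T.eval (s.reg 0) + 8)
      (q := .seq (c.compile (d + 1)) (.assign x (.add (.reg x) (.const 1))))
      (I := fun i st => ((iter f i s).setReg x i).Agree d st ∧ st.reg d = s.reg x)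
      (fun i st hst => by
        refine ⟨(hst.1.1 0 hd).trans ?_, (hst.1.1 x hxd).trans (by simp)⟩
        simp [hx0.symm, hreg0])
      (fun i hi st hst => by
        obtain ⟨st', t, e1, l1, a1⟩ := hT st
        have hst0 : st.reg 0 = s.reg 0 := (hst.1.1 0 hd).trans (by simp [hx0.symm, hreg0])
        have hA : (iter f (i + 1) s).Agree d st' :=
          (sem_congr hd hc hst.1).trans (a1.mono (by omega))
        have hx' : st'.reg x = i := by
          rw [hA.1 x hxd]
          simp only [iter, hf]
          rw [sem_reg _ hk]
          simp
        refine ⟨_, _, e1.seq (Exec.assign ..), ?_, ?_, ?_⟩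
        · rw [hst0] at l1
          simp [Expr.cost]; omega
        · simp only [Expr.eval, hx']
          exact hA.setReg _ _
        · simp only [State.setReg_reg]
          rw [if_neg (by omega), a1.1 d (by omega)]
          rw [← hst.2]
          exact sem_reg _ (keepsReg_of_ok hc))
      (s := (s.setReg d (s.reg x)).setReg x 0)
      (by
        refine ⟨(s.agree_setReg le_rfl _).setReg _ _, ?_⟩
        simp only [State.setReg_reg]
        rw [if_neg (by omega), if_pos trivial])
    obtain ⟨s', t, e1, l1, a1, b1⟩ := hI
    refine ⟨_, _, (Exec.assign ..).seq ((Exec.assign ..).seq (Exec.seq e1 (Exec.assign ..))),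
      ?_, ?_⟩
    · simp [Expr.cost]
      norm_num [add_assoc] at l1
      omega
    · simp only [Expr.eval, b1, sem]
      refine ⟨fun y hy => ?_, a1.2⟩
      have := a1.1 y hy
      simp only [State.setReg_reg] at this ⊢
      split_ifs with hyx
      · rfl
      · rw [this, if_neg hyx]

end Cmd

/-! ### Paths, and buying a prefix and a suffix of a path -/

section Buy

variable {V : Type*} {G H : SimpleGraph V}

/-- `p 0, …, p L` is a shortest path of `G` from `s` to `t`. -/
structure IsShortestPath (G : SimpleGraph V) (p : ℕ → V) (L : ℕ) (s t : V) : Prop where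
  start : p 0 = s
  finish : p L = t
  adj : ∀ l < L, G.Adj (p l) (p (l + 1))
  length : L = G.dist s t

lemma IsShortestPath.reachable {p : ℕ → V} {L : ℕ} {s t : V}
    (h : IsShortestPath G p L s t) : G.Reachable s t := by
  have : ∀ l ≤ L, G.Reachable s (p l) := by
    intro l
    induction l with
    | zero => intro _; rw [h.start]
    | succ l ih => exact fun hl => (ih (by omega)).trans (h.adj l (by omega)).reachable
  simpa only [h.finish] using this L le_rfl

/-- `H` together with the edges of the path `p 0, …, p L` before position `a` and after
position `b`. -/
def buy (H : SimpleGraph V) (p : ℕ → V) (L a b : ℕ) : SimpleGraph V :=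
  H ⊔ SimpleGraph.fromEdgeSet {e | ∃ l < L, (l < a ∨ b ≤ l) ∧ e = s(p l, p (l + 1))}

/-- The number of new edges in `buy H p L a b`, counted along the path. -/
noncomputable def cost (H : SimpleGraph V) (p : ℕ → V) (L a b : ℕ) : ℕ :=
  open Classical in
  ((Finset.range L).filter fun l => (l < a ∨ b ≤ l) ∧ ¬ H.Adj (p l) (p (l + 1))).card

lemma le_buy (H : SimpleGraph V) (p : ℕ → V) (L a b : ℕ) : H ≤ buy H p L a b := le_sup_left

lemma buy_le {p : ℕ → V} {L : ℕ} (hH : H ≤ G) (hp : ∀ l < L, G.Adj (p l) (p (l + 1))) (a b : ℕ) :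
    buy H p L a b ≤ G := by
  refine sup_le hH ?_
  intro u v huv
  rw [SimpleGraph.fromEdgeSet_adj] at huv
  obtain ⟨⟨l, hl, -, he⟩, -⟩ := huv
  rw [← SimpleGraph.mem_edgeSet, he]
  exact hp l hl

lemma buy_adj {p : ℕ → V} {L a b l : ℕ} (hp : G.Adj (p l) (p (l + 1))) (hl : l < L)
    (h : l < a ∨ b ≤ l) : (buy H p L a b).Adj (p l) (p (l + 1)) := by
  refine Or.inr ?_
  rw [SimpleGraph.fromEdgeSet_adj]
  exact ⟨⟨l, hl, h, rfl⟩, hp.ne⟩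

lemma ncard_buy_le [Finite V] (H : SimpleGraph V) (p : ℕ → V) (L a b : ℕ) :
    (buy H p L a b).edgeSet.ncard ≤ H.edgeSet.ncard + cost H p L a b := by
  classical
  have h : (buy H p L a b).edgeSet ⊆ H.edgeSet ∪ ((((Finset.range L).filter fun l =>
      (l < a ∨ b ≤ l) ∧ ¬ H.Adj (p l) (p (l + 1))).image fun l => s(p l, p (l + 1)) :
      Finset (Sym2 V)) : Set (Sym2 V)) := by
    intro e he
    by_cases heH : e ∈ H.edgeSet
    · exact Or.inl heH
    · rw [buy, SimpleGraph.edgeSet_sup] at he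
      rcases he with he | he
      · exact Or.inl he
      · rw [SimpleGraph.edgeSet_fromEdgeSet] at he
        obtain ⟨⟨l, hl, hab, rfl⟩, -⟩ := he
        right
        simp only [Finset.coe_image, Set.mem_image, Finset.coe_filter, Set.mem_ofPred_eq,
          Finset.mem_range]
        exact ⟨l, ⟨hl, hab, heH⟩, rfl⟩
  refine (Set.ncard_le_ncard h (Set.toFinite _)).trans ((Set.ncard_union_le _ _).trans ?_)
  rw [Set.ncard_coe_finset]
  gcongr
  refine Finset.card_image_le.trans_eq ?_
  rw [cost]

lemma buy_eq_of_cost_eq_zero {p : ℕ → V} {L a b : ℕ} (h : cost H p L a b = 0) :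
    buy H p L a b = H := by
  classical
  refine le_antisymm (sup_le le_rfl ?_) (le_buy ..)
  intro u v huv
  rw [SimpleGraph.fromEdgeSet_adj] at huv
  obtain ⟨⟨l, hl, hab, he⟩, -⟩ := huv
  rw [cost, Finset.card_eq_zero, Finset.filter_eq_empty_iff] at h
  have := h (Finset.mem_range.2 hl)
  rw [← SimpleGraph.mem_edgeSet, he]
  by_contra hc
  exact this ⟨hab, hc⟩

/-- The number of new edges of `buy H p L a b` is at most the number of missing edges before `a`
plus the number of missing edges from `b` on. -/
lemma cost_le (H : SimpleGraph V) (p : ℕ → V) (L a b : ℕ) [DecidablePred fun l => l < L ∧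
    ¬ H.Adj (p l) (p (l + 1))] (hb : b ≤ L) :
    cost H p L a b + Nat.count (fun l => l < L ∧ ¬ H.Adj (p l) (p (l + 1))) b ≤
      Nat.count (fun l => l < L ∧ ¬ H.Adj (p l) (p (l + 1))) a +
      Nat.count (fun l => l < L ∧ ¬ H.Adj (p l) (p (l + 1))) L := by
  classical
  rw [cost]
  simp only [Nat.count_eq_card_filter_range]
  have h₁ : ((Finset.range L).filter fun l => l < L ∧ ¬ H.Adj (p l) (p (l + 1))).card =
      ((Finset.range b).filter fun l => l < L ∧ ¬ H.Adj (p l) (p (l + 1))).card +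
      ((Finset.range L).filter fun l => b ≤ l ∧ ¬ H.Adj (p l) (p (l + 1))).card := by
    rw [← Finset.card_union_of_disjoint]
    · congr 1
      ext l
      simp only [Finset.mem_filter, Finset.mem_range, Finset.mem_union]
      grind
    · rw [Finset.disjoint_left]
      intro l
      simp only [Finset.mem_filter, Finset.mem_range]
      grind
  have h₂ : ((Finset.range L).filter fun l => (l < a ∨ b ≤ l) ∧ ¬ H.Adj (p l) (p (l + 1))).card ≤
      ((Finset.range a).filter fun l => l < L ∧ ¬ H.Adj (p l) (p (l + 1))).card +
      ((Finset.range L).filter fun l => b ≤ l ∧ ¬ H.Adj (p l) (p (l + 1))).card := by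
    refine (Finset.card_le_card ?_).trans (Finset.card_union_le _ _)
    intro l
    simp only [Finset.mem_filter, Finset.mem_range, Finset.mem_union]
    grind
  have h₃ : ∀ (i : DecidablePred fun l => (l < a ∨ b ≤ l) ∧ ¬ H.Adj (p l) (p (l + 1))),
    (@Finset.filter _ (fun l => (l < a ∨ b ≤ l) ∧ ¬ H.Adj (p l) (p (l + 1))) i
      (Finset.range L)).card ≤ _ := fun i => (by convert h₂)
  have := h₃ (fun _ => Classical.propDecidable _)
  omega

/-- The missing edges of a path with `M` missing edges, listed from both ends: `α j` is the
position where the `j`-th missing edge starts, and `β j` is the position where the `j`-th missing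
edge from the end of the path ends. -/
lemma exists_missing_positions (H : SimpleGraph V) (p : ℕ → V) (L : ℕ) :
    ∃ (M : ℕ) (α β : ℕ → ℕ), M = cost H p L L L ∧
      (∀ j < M, α j < L ∧ ¬ H.Adj (p (α j)) (p (α j + 1))) ∧
      (∀ j < M, 0 < β j ∧ β j ≤ L ∧ ¬ H.Adj (p (β j - 1)) (p (β j))) ∧
      (∀ i j, i < j → j < M → α i < α j) ∧ (∀ i j, i < j → j < M → β j < β i) ∧
      (∀ i j, i + j < M → α i < β j) ∧
      (∀ i j, i < M → j < M → cost H p L (α i) (β j) ≤ i + j) := by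
  classical
  set miss : ℕ → Prop := fun l => l < L ∧ ¬ H.Adj (p l) (p (l + 1)) with hmiss
  have hfin : (Set.ofPred miss).Finite := (Set.finite_Iio L).subset fun l hl => hl.1
  set M := Nat.count miss L with hM
  have hcard : hfin.toFinset.card = M := by
    rw [hM, Nat.count_eq_card_filter_range]
    congr 1
    ext l
    simp [hmiss]
  have hmem : ∀ j < M, miss (Nat.nth miss j) := fun j hj =>
    Nat.nth_mem_of_lt_card hfin (hcard ▸ hj)
  have hmono : ∀ i j, i < j → j < M → Nat.nth miss i < Nat.nth miss j := fun i j hij hj =>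
    Nat.nth_lt_nth_of_lt_card hfin hij (hcard ▸ hj)
  have hmono' : ∀ i j, i ≤ j → j < M → Nat.nth miss i ≤ Nat.nth miss j := fun i j hij hj =>
    Nat.nth_le_nth_of_lt_card hfin hij (hcard ▸ hj)
  have hcount : ∀ j < M, Nat.count miss (Nat.nth miss j) = j := fun j hj =>
    Nat.count_nth_of_lt_card_finite hfin (hcard ▸ hj)
  have hcost : M = cost H p L L L := by
    rw [hM, Nat.count_eq_card_filter_range, cost]
    congr 1
    ext l
    simp only [hmiss, Finset.mem_filter, Finset.mem_range]
    grind
  refine ⟨M, fun j => Nat.nth miss j, fun j => Nat.nth miss (M - 1 - j) + 1, hcost, hmem,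
    fun j hj => ⟨Nat.succ_pos _, (hmem (M - 1 - j) (by omega)).1, ?_⟩, hmono, fun i j hij hj => ?_,
    fun i j hij => ?_, fun i j hi hj => ?_⟩
  · simpa using (hmem (M - 1 - j) (by omega)).2
  · have := hmono (M - 1 - j) (M - 1 - i) (by omega) (by omega)
    simpa using this
  · exact Nat.lt_succ_of_le (hmono' i (M - 1 - j) (by omega) (by omega))
  · have h₁ := hcount (M - 1 - j) (by omega)
    have h₂ : cost H p L (Nat.nth miss i) (Nat.nth miss (M - 1 - j) + 1) +
        Nat.count miss (Nat.nth miss (M - 1 - j) + 1) ≤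
        Nat.count miss (Nat.nth miss i) + Nat.count miss L :=
      cost_le H p L (Nat.nth miss i) (Nat.nth miss (M - 1 - j) + 1)
        (hmem (M - 1 - j) (by omega)).1
    have h₃ : Nat.count miss (Nat.nth miss (M - 1 - j) + 1) = M - 1 - j + 1 := by
      rw [Nat.count_succ, h₁, if_pos (hmem (M - 1 - j) (by omega))]
    have h₄ := hcount i hi
    rw [h₃, h₄, ← hM] at h₂
    change cost H p L (Nat.nth miss i) (Nat.nth miss (M - 1 - j) + 1) ≤ i + j
    omega

end Buy

/-! ### Capped distances -/

section Distance

variable {V : Type*} [Fintype V] (k : ℕ)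

/-- The distance in `H`, with a natural number in place of `∞`. That number is so large that
no pair of vertices at distance `∞` in `H` appears to be served with additive stretch `4 * k`. -/
noncomputable def capDist (H : SimpleGraph V) (u v : V) : ℕ :=
  open Classical in if H.Reachable u v then H.dist u v else Fintype.card V + 4 * k

lemma dist_lt_card {H : SimpleGraph V} {u v : V} (h : H.Reachable u v) :
    H.dist u v < Fintype.card V := by
  obtain ⟨w, hw, hl⟩ := h.exists_path_of_dist
  rw [← hl]
  exact hw.length_lt

lemma capDist_of_reachable {k : ℕ} {H : SimpleGraph V} {u v : V} (h : H.Reachable u v) :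
    capDist k H u v = H.dist u v := by
  rw [capDist, if_pos h]

lemma capDist_le_card k (H : SimpleGraph V) (u v : V) :
    capDist k H u v ≤ Fintype.card V + 4 * k := by
  rw [capDist]
  split_ifs with h
  · exact (dist_lt_card h).le.trans (Nat.le_add_right _ _)
  · exact le_rfl

/-- An unconnected pair is never served. -/
lemma reachable_of_capDist_le {H : SimpleGraph V} {u v : V} {L : ℕ} (hL : L < Fintype.card V)
    (h : capDist k H u v ≤ L + 4 * k) : H.Reachable u v := by
  by_contra hc
  rw [capDist, if_neg hc] at h
  omega

lemma capDist_le_length {H : SimpleGraph V} {u v : V} (w : H.Walk u v) :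
    capDist k H u v ≤ w.length := by
  rw [capDist_of_reachable ⟨w⟩]
  exact H.dist_le w

lemma capDist_triangle k (H : SimpleGraph V) (u v w : V) :
    capDist k H u w ≤ capDist k H u v + capDist k H v w := by
  by_cases h₁ : H.Reachable u v
  · by_cases h₂ : H.Reachable v w
    · obtain ⟨p, hp⟩ := h₁.exists_walk_length_eq_dist
      obtain ⟨q, hq⟩ := h₂.exists_walk_length_eq_dist
      rw [capDist_of_reachable h₁, capDist_of_reachable h₂, ← hp, ← hq,
        ← SimpleGraph.Walk.length_append]
      exact capDist_le_length k _
    · have := capDist_le_card k H u w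
      have h3 : capDist k H v w = Fintype.card V + 4 * k := by rw [capDist, if_neg h₂]
      omega
  · have := capDist_le_card k H u w
    have h3 : capDist k H u v = Fintype.card V + 4 * k := by rw [capDist, if_neg h₁]
    omega

lemma capDist_anti {H H' : SimpleGraph V} (h : H ≤ H') (u v : V) :
    capDist k H' u v ≤ capDist k H u v := by
  by_cases h₁ : H.Reachable u v
  · obtain ⟨p, hp⟩ := h₁.exists_walk_length_eq_dist
    rw [capDist_of_reachable h₁, ← hp, ← SimpleGraph.Walk.length_mapLe h]
    exact capDist_le_length k _
  · have h3 : capDist k H u v = Fintype.card V + 4 * k := by rw [capDist, if_neg h₁]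
    exact h3 ▸ capDist_le_card k H' u v

lemma capDist_le_one {H : SimpleGraph V} {u v : V} (h : H.Adj u v) : capDist k H u v ≤ 1 :=
  capDist_le_length k h.toWalk

lemma capDist_self k (H : SimpleGraph V) (u : V) : capDist k H u u = 0 := by
  simpa using capDist_le_length k (SimpleGraph.Walk.nil : H.Walk u u)

lemma capDist_segment {H : SimpleGraph V} {p : ℕ → V} {a b : ℕ} (hab : a ≤ b)
    (h : ∀ l, a ≤ l → l < b → H.Adj (p l) (p (l + 1))) : capDist k H (p a) (p b) ≤ b - a := by
  induction b, hab using Nat.le_induction with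
  | base => simp [capDist_self]
  | succ b hab ih =>
    have h₁ := ih fun l hl hb => h l hl (by omega)
    have h₂ := capDist_le_one k (h b hab (by omega))
    have h₃ := capDist_triangle k H (p a) (p b) (p (b + 1))
    omega

lemma IsShortestPath.capDist_eq {G : SimpleGraph V} {p : ℕ → V} {L : ℕ} {s t : V}
    (h : IsShortestPath G p L s t) : capDist k G s t = L := by
  rw [capDist_of_reachable h.reachable, h.length]

lemma IsShortestPath.sub_le {G : SimpleGraph V} {p : ℕ → V} {L : ℕ} {s t : V}
    (h : IsShortestPath G p L s t) {a b : ℕ} (hab : a ≤ b) (hb : b ≤ L) :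
    b - a ≤ capDist k G (p a) (p b) := by
  have h₁ := capDist_segment k (H := G) (p := p) a.zero_le fun l _ hl => h.adj l (by omega)
  have h₂ := capDist_segment k (H := G) (p := p) hb fun l _ hl => h.adj l (by omega)
  have h₃ := capDist_triangle k G (p 0) (p a) (p L)
  have h₄ := capDist_triangle k G (p a) (p b) (p L)
  have h₅ := h.capDist_eq k
  rw [← h.start, ← h.finish] at h₅
  omega

end Distance

/-! ### Clusterings and the potential -/

section Greedy

variable {V : Type*} {G H H' : SimpleGraph V} {cl : V → Option V}

/-- A clustering of some of the vertices of `G`: `cl u` is the centre of the cluster of `u`. The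
subgraph `H` contains the edges between the centres and the members of their clusters, and all the
edges of `G` with an end vertex outside all the clusters. -/
structure IsClustering (G H : SimpleGraph V) (cl : V → Option V) : Prop where
  le : H ≤ G
  star : ∀ u c, cl u = some c → H.Adj c u
  full : ∀ u v, G.Adj u v → cl u = none → H.Adj u v

lemma IsClustering.mono (h : IsClustering G H cl) (hH : H ≤ H') (hG : H' ≤ G) :
    IsClustering G H' cl :=
  ⟨hG, fun u c hu => hH (h.star u c hu), fun u v huv hu => hH (h.full u v huv hu)⟩

variable [Fintype V]

/-- The centres of the clusters. -/
noncomputable def centres (cl : V → Option V) : Finset V :=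
  open Classical in Finset.univ.filter fun c => ∃ u, cl u = some c

lemma mem_centres {u c : V} (h : cl u = some c) : c ∈ centres cl := by
  simp only [centres, Finset.mem_filter, Finset.mem_univ, true_and]
  exact ⟨u, h⟩

/-- The sum of the distances in `H` between the centres, where the excess over the distance in `G`
is truncated at `4 * k + 1`. -/
noncomputable def potential (G : SimpleGraph V) (Z : Finset V) (k : ℕ) (H : SimpleGraph V) : ℕ :=
  ∑ c ∈ Z, ∑ c' ∈ Z, min (capDist k H c c') (capDist k G c c' + 4 * k + 1)

lemma potential_anti (G : SimpleGraph V) (Z : Finset V) (k : ℕ) (h : H ≤ H') :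
    potential G Z k H' ≤ potential G Z k H :=
  Finset.sum_le_sum fun c _ => Finset.sum_le_sum fun c' _ =>
    min_le_min (capDist_anti k h c c') le_rfl

lemma potential_sub_le (Z : Finset V) (k : ℕ) (h' : H' ≤ G) :
    potential G Z k H - potential G Z k H' ≤ Z.card ^ 2 * (4 * k + 1) := by
  rw [Nat.sub_le_iff_le_add]
  have h₁ : potential G Z k H ≤ ∑ c ∈ Z, ∑ c' ∈ Z, ((4 * k + 1) +
      min (capDist k H' c c') (capDist k G c c' + 4 * k + 1)) := by
    refine Finset.sum_le_sum fun c _ => Finset.sum_le_sum fun c' _ => ?_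
    have := capDist_anti k h' c c'
    omega
  refine h₁.trans_eq ?_
  simp only [Finset.sum_add_distrib, potential, Finset.sum_const, smul_eq_mul]
  ring

/-- Every pair of centres that comes closer lets the potential drop by at least one. -/
lemma card_mul_card_le_potential_sub {Z X Y : Finset V} {k : ℕ} (hH : H ≤ H') (hX : X ⊆ Z)
    (hY : Y ⊆ Z) (h : ∀ x ∈ X, ∀ y ∈ Y, capDist k H' x y < capDist k H x y ∧
      capDist k H' x y < capDist k G x y + 4 * k + 1) :
    X.card * Y.card ≤ potential G Z k H - potential G Z k H' := by
  classical
  rw [Nat.le_sub_iff_add_le (potential_anti G Z k hH)]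
  have h₁ : X.card * Y.card = ∑ c ∈ Z, ∑ c' ∈ Z, if c ∈ X ∧ c' ∈ Y then 1 else 0 := by
    rw [← Finset.sum_product', ← Finset.card_filter, ← Finset.card_product]
    congr 1
    ext ⟨c, c'⟩
    simp only [Finset.mem_product, Finset.mem_filter]
    exact ⟨fun h => ⟨⟨hX h.1, hY h.2⟩, h⟩, fun h => h.2⟩
  rw [h₁, potential, ← Finset.sum_add_distrib]
  refine Finset.sum_le_sum fun c _ => ?_
  rw [← Finset.sum_add_distrib]
  refine Finset.sum_le_sum fun c' _ => ?_
  split_ifs with hc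
  · have := h c hc.1 c' hc.2
    omega
  · have := capDist_anti k hH c c'
    omega

/-- A shortest path meets a cluster in at most three vertices. -/
lemma card_le_three_mul_card_image {p : ℕ → V} {L : ℕ} {s t : V} (hp : IsShortestPath G p L s t)
    (hH : H ≤ G) [DecidableEq V] {ι : Type*} {J : Finset ι} {f : ι → ℕ} {c : ι → V}
    (hf : Set.InjOn f J) (hL : ∀ j ∈ J, f j ≤ L) (hc : ∀ j ∈ J, H.Adj (c j) (p (f j))) :
    J.card ≤ 3 * (J.image c).card := by
  refine Finset.card_le_mul_card_image J 3 fun x hx => ?_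
  obtain ⟨j₀, hj₀, rfl⟩ := Finset.mem_image.1 hx
  obtain ⟨m, hm, hmin⟩ := Finset.exists_min_image (J.filter fun j => c j = c j₀) f
    ⟨j₀, by simp [hj₀]⟩
  rw [Finset.mem_filter] at hm
  refine (Finset.card_le_card_of_injOn f (t := Finset.Icc (f m) (f m + 2)) ?_ ?_).trans ?_
  · intro j hj
    have hle := hmin j hj
    rw [Finset.mem_coe, Finset.mem_filter] at hj
    have h₁ := hp.sub_le 0 hle (hL j hj.1)
    have h₂ := capDist_le_one 0 (hH (hc m hm.1)).symm
    have h₃ := capDist_le_one 0 (hH (hc j hj.1))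
    rw [hm.2] at h₂
    rw [hj.2] at h₃
    have h₄ := capDist_triangle 0 G (p (f m)) (c j₀) (p (f j))
    simp only [Finset.coe_Icc, Set.mem_Icc]
    omega
  · exact hf.mono fun j hj => (Finset.mem_filter.1 hj).1
  · rw [Nat.card_Icc]
    omega

end Greedy

/-! ### The existence of a cheap purchase -/

section Greedy

variable {V : Type*} [Fintype V] {G H H' : SimpleGraph V} {cl : V → Option V}

/-- The heart of the size bound. If the pair `(s, t)` is not yet served by `H`, then some prefix and
some suffix of the shortest path serve it, at a cost whose square is at most `144 * R ^ 2` times the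
drop of the potential. -/
lemma exists_buy (hcl : IsClustering G H cl) {p : ℕ → V} {L : ℕ} {s t : V}
    (hp : IsShortestPath G p L s t) {k R : ℕ} (hk : 1 ≤ k) (hR : 2 ≤ R)
    (hZ : 3 * (centres cl).card ≤ 2 * R ^ k) (hst : L + 4 * k < capDist k H s t) :
    ∃ a b, a ≤ L ∧ b ≤ L ∧ capDist k (buy H p L a b) s t ≤ L + 4 * k ∧
      cost H p L a b ^ 2 ≤ 144 * R ^ 2 *
        (potential G (centres cl) k H - potential G (centres cl) k (buy H p L a b)) := by
  classical
  obtain ⟨M, α, β, hM, hα, hβ, hαm, hβm, hαβ, hcost⟩ := exists_missing_positions H p L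
  -- the centres of the clusters of the left and of the right end vertices of the missing edges
  have hx : ∀ j, ∃ c, j < M → cl (p (α j)) = some c := by
    intro j
    by_cases hj : j < M
    · obtain ⟨c, hc⟩ := Option.ne_none_iff_exists'.1 fun h =>
        (hα j hj).2 (hcl.full _ _ (hp.adj _ (hα j hj).1) h)
      exact ⟨c, fun _ => hc⟩
    · exact ⟨s, fun h => absurd h hj⟩
  have hy : ∀ j, ∃ c, j < M → cl (p (β j)) = some c := by
    intro j
    by_cases hj : j < M
    · obtain ⟨h0, hL, hadj⟩ := hβ j hj
      have hG : G.Adj (p (β j - 1)) (p (β j)) := by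
        have := hp.adj (β j - 1) (by omega)
        rwa [Nat.sub_add_cancel h0] at this
      obtain ⟨c, hc⟩ := Option.ne_none_iff_exists'.1 fun h =>
        hadj (hcl.full _ _ hG.symm h).symm
      exact ⟨c, fun _ => hc⟩
    · exact ⟨s, fun h => absurd h hj⟩
  choose x hx using hx
  choose y hy using hy
  have hxadj : ∀ j < M, H.Adj (x j) (p (α j)) := fun j hj => hcl.star _ _ (hx j hj)
  have hyadj : ∀ j < M, H.Adj (y j) (p (β j)) := fun j hj => hcl.star _ _ (hy j hj)
  have hαL : ∀ j < M, α j ≤ L := fun j hj => (hα j hj).1.le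
  have hβL : ∀ j < M, β j ≤ L := fun j hj => (hβ j hj).2.1
  have hαinj : ∀ J : Finset ℕ, (∀ j ∈ J, j < M) → Set.InjOn α J := by
    intro J hJ i hi j hj hij
    by_contra hne
    rcases Nat.lt_or_gt_of_ne hne with h | h
    · exact (hαm i j h (hJ j hj)).ne hij
    · exact (hαm j i h (hJ i hi)).ne hij.symm
  have hβinj : ∀ J : Finset ℕ, (∀ j ∈ J, j < M) → Set.InjOn β J := by
    intro J hJ i hi j hj hij
    by_contra hne
    rcases Nat.lt_or_gt_of_ne hne with h | h
    · exact (hβm i j h (hJ j hj)).ne hij.symm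
    · exact (hβm j i h (hJ i hi)).ne hij
  have hMZ : M ≤ 3 * (centres cl).card := by
    have h₁ := card_le_three_mul_card_image hp hcl.le (J := Finset.range M) (f := α) (c := x)
      (hαinj _ fun j hj => Finset.mem_range.1 hj) (fun j hj => hαL j (Finset.mem_range.1 hj))
      (fun j hj => hxadj j (Finset.mem_range.1 hj))
    have h₂ : (Finset.range M).image x ⊆ centres cl := by
      intro c hc
      obtain ⟨j, hj, rfl⟩ := Finset.mem_image.1 hc
      exact mem_centres (hx j (Finset.mem_range.1 hj))
    have h₃ := Finset.card_le_card h₂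
    rw [Finset.card_range] at h₁
    omega
  have hall : ∀ H' : SimpleGraph V, ∀ a b, a ≤ b → (∀ l, a ≤ l → l < b → H'.Adj (p l) (p (l + 1))) →
      capDist k H' (p a) (p b) ≤ b - a := fun H' a b hab h => capDist_segment k hab h
  have hM0 : 0 < M := by
    rcases Nat.eq_zero_or_pos M with h0 | h0
    · have h₁ := buy_eq_of_cost_eq_zero (hM.symm.trans h0)
      have h₂ := hall (buy H p L L L) 0 L (by omega)
        fun l _ hl => buy_adj (hp.adj l hl) hl (Or.inl hl)
      rw [h₁, hp.start, hp.finish] at h₂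
      omega
    · exact h0
  -- Level `i` consists of the numbers `j` from `lo i` to `R ^ i`. A pair `j`, `j'` is good if `H`
  -- connects the clusters of the missing edges `j` and `j'` almost as well as the path does, with
  -- an error that leaves room for the detours through the clusters; level `i` is bad if it has no
  -- good pair, and low if its missing edges from the two sides do not overlap.
  set lo : ℕ → ℕ := fun i => if i = 0 then 0 else R ^ (i - 1) with hlo
  set good : ℕ → ℕ → ℕ → Prop := fun i j j' =>
    capDist k H (x j) (y j') + α j + 2 ≤ β j' + 4 * (k - i) with hgood
  set bad : ℕ → Prop := fun i => ∀ j j', lo i ≤ j → j < R ^ i → lo i ≤ j' → j' < R ^ i →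
    ¬ good i j j' with hbad
  set low : ℕ → Prop := fun i => i < k ∧ 2 * R ^ i ≤ M + 1 with hlow
  have hbad0 : bad 0 := by
    intro j j' _ hj _ hj' hg
    rw [pow_zero, Nat.lt_one_iff] at hj hj'
    subst hj; subst hj'
    have hseg : ∀ l < L, l < α 0 ∨ β 0 ≤ l → H.Adj (p l) (p (l + 1)) := by
      have h₁ := buy_eq_of_cost_eq_zero (Nat.le_zero.1 (hcost 0 0 hM0 hM0))
      intro l hl hl'
      rw [← h₁]
      exact buy_adj (hp.adj l hl) hl hl'
    have h₁ := hall H 0 (α 0) (by omega) fun l _ hl =>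
      hseg l (by have := hαL 0 hM0; omega) (.inl hl)
    have h₂ := hall H (β 0) L (hβL 0 hM0) fun l hl hl' => hseg l hl' (.inr hl)
    have h₃ := capDist_le_one k (hxadj 0 hM0).symm
    have h₄ := capDist_le_one k (hyadj 0 hM0)
    have h₅ := capDist_triangle k H s (p (α 0)) t
    have h₆ := capDist_triangle k H (p (α 0)) (x 0) t
    have h₇ := capDist_triangle k H (x 0) (y 0) t
    have h₈ := capDist_triangle k H (y 0) (p (β 0)) t
    have h₉ := hβL 0 hM0
    have h₁₀ : capDist k H (x 0) (y 0) + α 0 + 2 ≤ β 0 + 4 * k := hg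
    rw [hp.start] at h₁
    rw [hp.finish] at h₂
    omega
  -- the last level of the initial run of bad levels; it exists since low levels are below `k`
  obtain ⟨i, hilow, hibad, hnext⟩ : ∃ i, low i ∧ bad i ∧ ¬ (low (i + 1) ∧ bad (i + 1)) := by
    by_contra! hcon
    have : ∀ i, low i ∧ bad i := by
      intro i
      induction i with
      | zero => exact ⟨⟨by omega, by simp; omega⟩, hbad0⟩
      | succ i ih => exact hcon i ih.1 ih.2
    exact absurd (this k).1.1 (lt_irrefl k)
  have hRi : 0 < R ^ i := by positivity
  have hRi' : ∀ j, j < R ^ i → j < M := fun j hj => by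
    have := hilow.2
    omega
  have hRsucc : R ^ (i + 1) = R * R ^ i := by rw [pow_succ, mul_comm]
  have hRle : 2 * R ^ i ≤ R ^ (i + 1) := by rw [hRsucc]; gcongr
  -- a purchase that connects all the pairs of level `i`
  obtain ⟨a, b, ha, hb, hvalid, hc, hconn⟩ : ∃ a b, a ≤ L ∧ b ≤ L ∧
      capDist k (buy H p L a b) s t ≤ L + 4 * k ∧ cost H p L a b ≤ 2 * R ^ (i + 1) ∧
      ∀ j j', j < R ^ i → j' < R ^ i →
        capDist k (buy H p L a b) (x j) (y j') + α j + 2 ≤ β j' + 4 * (k - i) := by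
    by_cases hl : low (i + 1)
    · have hnb : ¬ bad (i + 1) := fun h => hnext ⟨hl, h⟩
      simp only [hbad, not_forall, not_not] at hnb
      obtain ⟨u, v, hu, hu', hv, hv', hg⟩ := hnb
      have hlo' : lo (i + 1) = R ^ i := by simp [hlo]
      rw [hlo'] at hu hv
      have huM : u < M := by have := hl.2; omega
      have hvM : v < M := by have := hl.2; omega
      have huv : α u < β v := hαβ u v (by have := hl.2; omega)
      have hL := hβL v hvM
      set B := buy H p L (α u) (β v) with hB
      have hBadj : ∀ l < L, l < α u ∨ β v ≤ l → B.Adj (p l) (p (l + 1)) := fun l hl hl' =>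
        buy_adj (hp.adj l hl) hl hl'
      have hHB : H ≤ B := le_buy ..
      have hg' : capDist k H (x u) (y v) + α u + 2 ≤ β v + 4 * (k - (i + 1)) := hg
      have h₀ := capDist_anti k hHB (x u) (y v)
      have h₁ := capDist_le_one k (hHB (hxadj u huM)).symm
      have h₂ := capDist_le_one k (hHB (hyadj v hvM))
      -- the detour through the two clusters
      have hdet : ∀ w w', capDist k B w w' + α u ≤
          capDist k B w (p (α u)) + capDist k B (p (β v)) w' + β v + 4 * (k - (i + 1)) := by
        intro w w'
        have h₅ := capDist_triangle k B w (p (α u)) w'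
        have h₆ := capDist_triangle k B (p (α u)) (x u) w'
        have h₇ := capDist_triangle k B (x u) (y v) w'
        have h₈ := capDist_triangle k B (y v) (p (β v)) w'
        omega
      refine ⟨α u, β v, by omega, hL, ?_, ?_, ?_⟩
      · have h₃ := hall B 0 (α u) (by omega) fun l _ hl => hBadj l (by omega) (.inl hl)
        have h₄ := hall B (β v) L hL fun l hl hl' => hBadj l hl' (.inr hl)
        have := hdet s t
        rw [hp.start] at h₃
        rw [hp.finish] at h₄
        rw [← hB]
        omega
      · have := hcost u v huM hvM
        omega
      · intro j j' hj hj'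
        have hjα := hαm j u (by omega) huM
        have hjβ := hβm j' v (by omega) hvM
        have hj'L := hβL j' (hRi' j' hj')
        have h₃ := hall B (α j) (α u) (by omega) fun l _ hl => hBadj l (by omega) (.inl hl)
        have h₄ := hall B (β v) (β j') (by omega)
          fun l hl hl' => hBadj l (by omega) (.inr hl)
        have h₅ := capDist_le_one k (hHB (hxadj j (hRi' j hj)))
        have h₆ := capDist_le_one k (hHB (hyadj j' (hRi' j' hj'))).symm
        have h₇ := capDist_triangle k B (x j) (p (α j)) (p (α u))
        have h₈ := capDist_triangle k B (p (β v)) (p (β j')) (y j')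
        have h₉ := hdet (x j) (y j')
        have := hl.1
        rw [← hB]
        omega
    · -- there are so few missing edges that the whole path can be bought
      have hcM : M ≤ 2 * R ^ (i + 1) := by
        by_cases hik : i + 1 < k
        · have : ¬ 2 * R ^ (i + 1) ≤ M + 1 := fun h => hl ⟨hik, h⟩
          omega
        · have : i + 1 = k := by have := hilow.1; omega
          rw [this]
          exact hMZ.trans hZ
      set B := buy H p L L L with hB
      have hBadj : ∀ l < L, B.Adj (p l) (p (l + 1)) := fun l hl =>
        buy_adj (hp.adj l hl) hl (.inl hl)
      have hHB : H ≤ B := le_buy ..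
      refine ⟨L, L, le_rfl, le_rfl, ?_, hM ▸ hcM, ?_⟩
      · have := hall B 0 L (by omega) fun l _ hl => hBadj l hl
        rw [hp.start, hp.finish] at this
        rw [← hB]
        omega
      · intro j j' hj hj'
        have hjj := hαβ j j' (by have := hilow.2; omega)
        have hj'L := hβL j' (hRi' j' hj')
        have h₃ := hall B (α j) (β j') (by omega) fun l _ hl => hBadj l (by omega)
        have h₅ := capDist_le_one k (hHB (hxadj j (hRi' j hj)))
        have h₆ := capDist_le_one k (hHB (hyadj j' (hRi' j' hj'))).symm
        have h₇ := capDist_triangle k B (x j) (p (α j)) (y j')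
        have h₈ := capDist_triangle k B (p (α j)) (p (β j')) (y j')
        have := hilow.1
        rw [← hB]
        omega
  refine ⟨a, b, ha, hb, hvalid, ?_⟩
  have hHB : H ≤ buy H p L a b := le_buy ..
  set I := Finset.Ico (lo i) (R ^ i) with hI
  have hIM : ∀ j ∈ I, j < M := fun j hj => hRi' j (Finset.mem_Ico.1 hj).2
  -- the pairs of level `i` were not good before the purchase, but they are afterwards
  have hgain := card_mul_card_le_potential_sub (G := G) (Z := centres cl) (X := I.image x)
    (Y := I.image y) (k := k) hHB
    (by
      intro c hc
      obtain ⟨j, hj, rfl⟩ := Finset.mem_image.1 hc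
      exact mem_centres (hx j (hIM j hj)))
    (by
      intro c hc
      obtain ⟨j, hj, rfl⟩ := Finset.mem_image.1 hc
      exact mem_centres (hy j (hIM j hj)))
    (by
      intro c hc c' hc'
      obtain ⟨j, hj, rfl⟩ := Finset.mem_image.1 hc
      obtain ⟨j', hj', rfl⟩ := Finset.mem_image.1 hc'
      have hjM := hIM j hj
      have hjM' := hIM j' hj'
      rw [Finset.mem_Ico] at hj hj'
      have h₁ := hconn j j' hj.2 hj'.2
      have h₂ : ¬ (capDist k H (x j) (y j') + α j + 2 ≤ β j' + 4 * (k - i)) :=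
        hibad j j' hj.1 hj.2 hj'.1 hj'.2
      have h₃ := hp.sub_le k (hαβ j j' (by have := hilow.2; omega)).le (hβL j' hjM')
      have h₄ := capDist_le_one k (hcl.le (hxadj j hjM)).symm
      have h₅ := capDist_le_one k (hcl.le (hyadj j' hjM'))
      have h₆ := capDist_triangle k G (p (α j)) (x j) (p (β j'))
      have h₇ := capDist_triangle k G (x j) (y j') (p (β j'))
      omega)
  have hX := card_le_three_mul_card_image hp hcl.le (J := I) (f := α) (c := x)
    (hαinj _ hIM) (fun j hj => hαL j (hIM j hj)) (fun j hj => hxadj j (hIM j hj))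
  have hY := card_le_three_mul_card_image hp hcl.le (J := I) (f := β) (c := y)
    (hβinj _ hIM) (fun j hj => hβL j (hIM j hj)) (fun j hj => hyadj j (hIM j hj))
  have hIcard : R ^ i ≤ 2 * I.card := by
    rw [hI, Nat.card_Ico]
    rcases Nat.eq_zero_or_pos i with h0 | h0
    · simp [hlo, h0]
    · have h₁ : lo i = R ^ (i - 1) := by simp [hlo, h0.ne']
      have h₂ : R ^ i = R * R ^ (i - 1) := by
        rw [← pow_succ', Nat.sub_add_cancel h0]
      have h₃ : 2 * R ^ (i - 1) ≤ R * R ^ (i - 1) := by gcongr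
      rw [h₁]
      omega
  set D := potential G (centres cl) k H - potential G (centres cl) k (buy H p L a b) with hD
  have h₁ : R ^ i * R ^ i ≤ 36 * D := by
    calc R ^ i * R ^ i ≤ (6 * (I.image x).card) * (6 * (I.image y).card) := by
          gcongr <;> omega
      _ = 36 * ((I.image x).card * (I.image y).card) := by ring
      _ ≤ 36 * D := by gcongr
  calc cost H p L a b ^ 2 ≤ (2 * (R * R ^ i)) ^ 2 := by
        rw [← hRsucc]
        gcongr
    _ = 4 * R ^ 2 * (R ^ i * R ^ i) := by ring
    _ ≤ 4 * R ^ 2 * (36 * D) := by gcongr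
    _ = 144 * R ^ 2 * D := by ring

/-! ### The greedy construction -/

/-- `H'` arises from `H` by buying a prefix and a suffix of a shortest path from `s` to `t` that
serve the pair `(s, t)`, where the ratio of the drop of the potential to the square of the cost is
as large as possible. -/
def IsGreedyStep (G : SimpleGraph V) (Z : Finset V) (k : ℕ) (s t : V) (H H' : SimpleGraph V) :
    Prop :=
  ∃ (p : ℕ → V) (L a b : ℕ), IsShortestPath G p L s t ∧ H' = buy H p L a b ∧
    capDist k H' s t ≤ L + 4 * k ∧
    ∀ a' b', a' ≤ L → b' ≤ L → capDist k (buy H p L a' b') s t ≤ L + 4 * k →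
      (potential G Z k H - potential G Z k (buy H p L a' b')) * cost H p L a b ^ 2 ≤
        (potential G Z k H - potential G Z k H') * cost H p L a' b' ^ 2

/-- `GreedyRun G k Z H₀ Q H`: started with `H₀`, the greedy construction arrives at `H` when it has
treated the pairs in `Q`. -/
inductive GreedyRun (G : SimpleGraph V) (k : ℕ) (Z : Finset V) (H₀ : SimpleGraph V) :
    Set (V × V) → SimpleGraph V → Prop
  | init : GreedyRun G k Z H₀ ∅ H₀
  | skip {Q : Set (V × V)} {H : SimpleGraph V} {s t : V} : GreedyRun G k Z H₀ Q H →
      (G.Reachable s t → capDist k H s t ≤ capDist k G s t + 4 * k) →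
      GreedyRun G k Z H₀ (insert (s, t) Q) H
  | step {Q : Set (V × V)} {H H' : SimpleGraph V} {s t : V} : GreedyRun G k Z H₀ Q H →
      (s, t) ∉ Q → G.Reachable s t → capDist k G s t + 4 * k < capDist k H s t →
      IsGreedyStep G Z k s t H H' → GreedyRun G k Z H₀ (insert (s, t) Q) H'

lemma GreedyRun.le {k : ℕ} {Z : Finset V} {H₀ : SimpleGraph V} {Q : Set (V × V)}
    (h : GreedyRun G k Z H₀ Q H) (h₀ : H₀ ≤ G) : H₀ ≤ H ∧ H ≤ G := by
  induction h with
  | init => exact ⟨le_rfl, h₀⟩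
  | skip _ _ ih => exact ih
  | step _ _ _ _ hs ih =>
    obtain ⟨p, L, a, b, hp, rfl, -⟩ := hs
    exact ⟨ih.1.trans (le_buy ..), buy_le ih.2 hp.adj a b⟩

lemma GreedyRun.capDist_le {k : ℕ} {Z : Finset V} {H₀ : SimpleGraph V} {Q : Set (V × V)}
    (h : GreedyRun G k Z H₀ Q H) {s t : V} (hst : (s, t) ∈ Q) (hG : G.Reachable s t) :
    capDist k H s t ≤ capDist k G s t + 4 * k := by
  induction h with
  | init => exact absurd hst (Set.notMem_empty _)
  | skip _ h ih =>
    rcases hst with hst | hst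
    · obtain ⟨rfl, rfl⟩ := Prod.ext_iff.1 hst
      exact h hG
    · exact ih hst
  | step _ _ _ _ hs ih =>
    obtain ⟨p, L, a, b, hp, rfl, hle, -⟩ := hs
    rcases hst with hst | hst
    · obtain ⟨rfl, rfl⟩ := Prod.ext_iff.1 hst
      rwa [hp.capDist_eq]
    · exact (capDist_anti k (le_buy ..) s t).trans (ih hst)

/-- The purchase of a greedy step is at least as good as the one of `exists_buy`. -/
lemma IsGreedyStep.cost_sq_le {k R : ℕ} {s t : V} (hcl : IsClustering G H cl) (hk : 1 ≤ k)
    (hR : 2 ≤ R) (hZ : 3 * (centres cl).card ≤ 2 * R ^ k)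
    (hst : capDist k G s t + 4 * k < capDist k H s t)
    (h : IsGreedyStep G (centres cl) k s t H H') :
    H ≤ H' ∧ H' ≤ G ∧ ∃ c, H'.edgeSet.ncard ≤ H.edgeSet.ncard + c ∧
      c ^ 2 ≤ 144 * R ^ 2 * (potential G (centres cl) k H - potential G (centres cl) k H') := by
  obtain ⟨p, L, a, b, hp, rfl, -, hmax⟩ := h
  refine ⟨le_buy .., buy_le hcl.le hp.adj a b, cost H p L a b, ncard_buy_le .., ?_⟩
  rw [hp.capDist_eq] at hst
  obtain ⟨a', b', ha', hb', hv, hc⟩ := exists_buy hcl hp hk hR hZ hst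
  have hpos : 0 < cost H p L a' b' := by
    refine Nat.pos_of_ne_zero fun h0 => ?_
    rw [buy_eq_of_cost_eq_zero h0] at hv
    omega
  have h := hmax a' b' ha' hb' hv
  set g' := potential G (centres cl) k H - potential G (centres cl) k (buy H p L a' b')
  set g := potential G (centres cl) k H - potential G (centres cl) k (buy H p L a b)
  have hg' : 0 < g' := by
    refine Nat.pos_of_ne_zero fun h0 => ?_
    rw [h0, mul_zero, Nat.le_zero] at hc
    exact (pow_pos hpos 2).ne' hc
  refine Nat.le_of_mul_le_mul_left ?_ hg'
  calc g' * cost H p L a b ^ 2 ≤ g * cost H p L a' b' ^ 2 := h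
    _ ≤ g * (144 * R ^ 2 * g') := by gcongr
    _ = g' * (144 * R ^ 2 * g) := by ring

/-- The inductive form of the Cauchy-Schwarz inequality. -/
lemma add_sq_le_succ_mul {C c m A g ρ : ℕ} (h₁ : C ^ 2 ≤ m * (ρ * A)) (h₂ : c ^ 2 ≤ ρ * g) :
    (C + c) ^ 2 ≤ (m + 1) * (ρ * (A + g)) := by
  have h₃ : 2 * (C * c) ≤ ρ * A + m * (ρ * g) := by
    have h₄ : (C * c) ^ 2 ≤ (ρ * A) * (m * (ρ * g)) := by
      calc (C * c) ^ 2 = C ^ 2 * c ^ 2 := by ring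
        _ ≤ (m * (ρ * A)) * (ρ * g) := by gcongr
        _ = _ := by ring
    have h₅ := four_mul_le_sq_add (ρ * A) (m * (ρ * g))
    refine (sq_le_sq₀ (Nat.zero_le _) (Nat.zero_le _)).1 ?_
    calc (2 * (C * c)) ^ 2 = 4 * (C * c) ^ 2 := by ring
      _ ≤ 4 * ((ρ * A) * (m * (ρ * g))) := by gcongr
      _ = 4 * (ρ * A) * (m * (ρ * g)) := by ring
      _ ≤ _ := h₅
  nlinarith

/-- The greedy construction buys few edges. -/
lemma GreedyRun.exists_ncard_le {k R : ℕ} {H₀ : SimpleGraph V} {Q : Set (V × V)}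
    (hcl : IsClustering G H₀ cl) (hk : 1 ≤ k) (hR : 2 ≤ R)
    (hZ : 3 * (centres cl).card ≤ 2 * R ^ k) (h : GreedyRun G k (centres cl) H₀ Q H) :
    ∃ C, H.edgeSet.ncard ≤ H₀.edgeSet.ncard + C ∧
      C ^ 2 ≤ Q.ncard * (144 * R ^ 2 *
        (potential G (centres cl) k H₀ - potential G (centres cl) k H)) := by
  induction h with
  | init => exact ⟨0, by simp, by simp⟩
  | @skip Q H s t _ _ ih =>
    obtain ⟨C, h₁, h₂⟩ := ih
    refine ⟨C, h₁, h₂.trans ?_⟩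
    gcongr
    · exact Set.toFinite _
    · exact Set.subset_insert _ _
  | @step Q H H' s t hrun hQ _ hst hs ih =>
    obtain ⟨C, h₁, h₂⟩ := ih
    have hle := hrun.le hcl.le
    obtain ⟨hHH', hH', c, h₃, h₄⟩ := hs.cost_sq_le (hcl.mono hle.1 hle.2) hk hR hZ hst
    refine ⟨C + c, by omega, ?_⟩
    have h₅ := add_sq_le_succ_mul h₂ h₄
    rw [Set.ncard_insert_of_notMem hQ (Set.toFinite _)]
    have h₆ := potential_anti G (centres cl) k hHH'
    have h₇ := potential_anti G (centres cl) k hle.1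
    rwa [tsub_add_tsub_cancel h₇ h₆] at h₅

lemma GreedyRun.ncard_le {k R : ℕ} {H₀ : SimpleGraph V} {Q : Set (V × V)}
    (hcl : IsClustering G H₀ cl) (hk : 1 ≤ k) (hR : 2 ≤ R)
    (hZ : 3 * (centres cl).card ≤ 2 * R ^ k) (h : GreedyRun G k (centres cl) H₀ Q H) :
    (H.edgeSet.ncard : ℝ) ≤ H₀.edgeSet.ncard +
      12 * R * (centres cl).card * √((4 * k + 1) * Q.ncard) := by
  obtain ⟨C, h₁, h₂⟩ := h.exists_ncard_le hcl hk hR hZ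
  have h₃ := potential_sub_le (H := H₀) (centres cl) k (h.le hcl.le).2
  have h₄ : C ^ 2 ≤ Q.ncard * (144 * R ^ 2 * ((centres cl).card ^ 2 * (4 * k + 1))) := by
    refine h₂.trans ?_
    gcongr
  have h₅ : (C : ℝ) ≤ 12 * R * (centres cl).card * √((4 * k + 1) * Q.ncard) := by
    refine (sq_le_sq₀ (by positivity) (by positivity)).1 ?_
    rw [mul_pow, Real.sq_sqrt (by positivity)]
    have : (C : ℝ) ^ 2 ≤ Q.ncard * (144 * R ^ 2 * ((centres cl).card ^ 2 * (4 * k + 1))) := by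
      exact_mod_cast h₄
    linarith
  have h₆ : (H.edgeSet.ncard : ℝ) ≤ H₀.edgeSet.ncard + C := by exact_mod_cast h₁
  linarith

end Greedy

/-! ### Clusters with a threshold -/

section Threshold

variable {V : Type*} {G H : SimpleGraph V} {cl : V → Option V} {h : ℕ}

/-- The edges of `G` with an end vertex outside all the clusters, and the edges between the centres
and the members of their clusters. -/
def clusterGraph (G : SimpleGraph V) (cl : V → Option V) : SimpleGraph V where
  Adj u v := G.Adj u v ∧ (cl u = none ∨ cl v = none ∨ cl u = some v ∨ cl v = some u)
  symm := ⟨fun u v h => ⟨h.1.symm, by tauto⟩⟩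
  loopless := ⟨fun u h => G.loopless.irrefl u h.1⟩

/-- A clustering in which the members of a cluster are neighbours of its centre, every cluster has
at least `h` members, and every vertex has at most `h` neighbours outside all the clusters. -/
structure IsThresholdClustering (G : SimpleGraph V) (h : ℕ) (cl : V → Option V) : Prop where
  adj : ∀ u c, cl u = some c → G.Adj c u
  le_card : ∀ u c, cl u = some c → h ≤ {u | cl u = some c}.ncard
  card_le : ∀ v, {u | G.Adj v u ∧ cl u = none}.ncard ≤ h

lemma IsThresholdClustering.isClustering (hcl : IsThresholdClustering G h cl) :
    IsClustering G (clusterGraph G cl) cl :=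
  ⟨fun _ _ h => h.1, fun u c hu => ⟨hcl.adj u c hu, by tauto⟩, fun _ _ huv hu => ⟨huv, by tauto⟩⟩

variable [Fintype V]

lemma IsThresholdClustering.mul_card_centres_le (hcl : IsThresholdClustering G h cl) :
    h * (centres cl).card ≤ Fintype.card V := by
  classical
  have h₁ : ∀ c ∈ centres cl, h ≤ (Finset.univ.filter fun u => cl u = some c).card := by
    intro c hc
    simp only [centres, Finset.mem_filter, Finset.mem_univ, true_and] at hc
    obtain ⟨u, hu⟩ := hc
    have := hcl.le_card u c hu
    rwa [← Set.ncard_coe_finset, Finset.coe_filter_univ]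
  calc h * (centres cl).card = ∑ c ∈ centres cl, h := by simp [mul_comm]
    _ ≤ ∑ c ∈ centres cl, (Finset.univ.filter fun u => cl u = some c).card :=
        Finset.sum_le_sum h₁
    _ = ((centres cl).biUnion fun c => Finset.univ.filter fun u => cl u = some c).card := by
        rw [Finset.card_biUnion]
        intro c _ c' _ hne
        rw [Function.onFun, Finset.disjoint_left]
        intro u hu hu'
        simp only [Finset.mem_filter, Finset.mem_univ, true_and] at hu hu'
        exact hne (Option.some_injective _ (hu.symm.trans hu'))
    _ ≤ Fintype.card V := Finset.card_le_univ _

lemma IsThresholdClustering.ncard_clusterGraph_le (hcl : IsThresholdClustering G h cl) :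
    (clusterGraph G cl).edgeSet.ncard ≤ Fintype.card V * h + Fintype.card V := by
  classical
  set A : Finset (Sym2 V) := Finset.univ.biUnion fun v =>
    (Finset.univ.filter fun u => G.Adj v u ∧ cl u = none).image fun u => s(v, u) with hA
  set B : Finset (Sym2 V) := Finset.univ.image fun u => s(u, (cl u).getD u) with hB
  have hsub : (clusterGraph G cl).edgeSet ⊆ (A ∪ B : Finset (Sym2 V)) := by
    intro e
    induction e using Sym2.ind with
    | _ u v =>
      rintro ⟨hadj, h⟩
      simp only [hA, hB, Finset.coe_union, Set.mem_union, Finset.mem_coe, Finset.mem_biUnion,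
        Finset.mem_image, Finset.mem_filter, Finset.mem_univ, true_and]
      rcases h with h | h | h | h
      · exact .inl ⟨v, u, ⟨hadj.symm, h⟩, Sym2.eq_swap⟩
      · exact .inl ⟨u, v, ⟨hadj, h⟩, rfl⟩
      · exact .inr ⟨u, by simp [h]⟩
      · exact .inr ⟨v, by simp [h]⟩
  have hAcard : A.card ≤ Fintype.card V * h := by
    refine Finset.card_biUnion_le_card_mul _ _ _ fun v _ => Finset.card_image_le.trans ?_
    have := hcl.card_le v
    rwa [← Set.ncard_coe_finset, Finset.coe_filter_univ]
  have hBcard : B.card ≤ Fintype.card V := Finset.card_image_le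
  calc (clusterGraph G cl).edgeSet.ncard ≤ (A ∪ B).card := by
        rw [← Set.ncard_coe_finset]
        exact Set.ncard_le_ncard hsub (Set.toFinite _)
    _ ≤ A.card + B.card := Finset.card_union_le _ _
    _ ≤ _ := Nat.add_le_add hAcard hBcard

/-- `H` is a possible outcome of the greedy construction for the pairs in `P`, started with
clusters for the threshold `h`. -/
def IsOutcome (G : SimpleGraph V) (P : Set (V × V)) (k h : ℕ) (H : SimpleGraph V) : Prop :=
  ∃ cl, IsThresholdClustering G h cl ∧
    GreedyRun G k (centres cl) (clusterGraph G cl) P H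

lemma IsOutcome.isPairwiseSpanner {P : Finset (V × V)} {k : ℕ} (hH : IsOutcome G P k h H) :
    IsPairwiseSpanner G P 1 (4 * (k : ℝ)) H := by
  obtain ⟨cl, hcl, hrun⟩ := hH
  refine ⟨(hrun.le hcl.isClustering.le).2, fun s t hst hG => ?_⟩
  have h₁ := hrun.capDist_le (Finset.mem_coe.2 hst) hG
  rw [capDist_of_reachable hG] at h₁
  have h₂ := reachable_of_capDist_le k (dist_lt_card hG) h₁
  rw [capDist_of_reachable h₂] at h₁
  exact ⟨h₂, by rw [one_mul]; exact_mod_cast h₁⟩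

end Threshold

/-! ### The choice of the parameters -/

section Parameters

variable {n k q : ℕ}

/-- The threshold that balances the two parts of the size: the edges that belong to the clusters
and the edges that are bought. -/
noncomputable def threshold (n k q : ℕ) : ℝ :=
  (n : ℝ) ^ (1 / (2 * (k : ℝ) + 1)) *
    (√((4 * (k : ℝ) + 5) * q)) ^ ((k : ℝ) / (2 * (k : ℝ) + 1))

lemma one_le_sqrt (k : ℕ) (hq : 1 ≤ q) : 1 ≤ √((4 * (k : ℝ) + 5) * q) := by
  rw [Real.one_le_sqrt]
  have h₁ : (1 : ℝ) ≤ q := by exact_mod_cast hq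
  have h₂ : (1 : ℝ) ≤ 4 * (k : ℝ) + 5 := by
    have : (0 : ℝ) ≤ k := k.cast_nonneg
    linarith
  exact one_le_mul_of_one_le_of_one_le h₂ h₁

lemma one_le_threshold (hn : 1 ≤ n) (hq : 1 ≤ q) : 1 ≤ threshold n k q := by
  have h₁ : (1 : ℝ) ≤ n := by exact_mod_cast hn
  exact one_le_mul_of_one_le_of_one_le (Real.one_le_rpow h₁ (by positivity))
    (Real.one_le_rpow (one_le_sqrt k hq) (by positivity))

lemma threshold_pow (n k q : ℕ) :
    threshold n k q ^ (2 * k + 1) = n * √((4 * (k : ℝ) + 5) * q) ^ k := by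
  have h₁ : ((2 * k + 1 : ℕ) : ℝ) = 2 * (k : ℝ) + 1 := by push_cast; ring
  have h₂ : (2 * (k : ℝ) + 1) ≠ 0 := by positivity
  rw [threshold, mul_pow, ← Real.rpow_mul_natCast (by positivity),
    ← Real.rpow_mul_natCast (by positivity), h₁, div_mul_cancel₀ _ h₂, div_mul_cancel₀ _ h₂,
    Real.rpow_one, Real.rpow_natCast]

lemma sqrt_le_two_pow (hk : 1 ≤ k) : √(4 * (k : ℝ) + 5) ≤ 2 ^ (2 * k + 1) := by
  have h₀ : ((2 : ℝ) ^ (2 * k + 1)) ^ 2 = 4 ^ (2 * k + 1) := by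
    rw [← pow_mul, mul_comm, pow_mul]
    norm_num
  rw [Real.sqrt_le_left (by positivity), h₀]
  have h₁ := one_add_mul_le_pow (a := (3 : ℝ)) (by norm_num) (2 * k + 1)
  have h₂ : (1 : ℝ) ≤ k := by exact_mod_cast hk
  push_cast at h₁
  norm_num at h₁ ⊢
  linarith

/-- The growth ratio of the levels: its `k`-th power is the number of clusters that the threshold
leaves room for, and it is bounded away from zero since there are at most `n ^ 2` pairs. -/
lemma exists_ratio (hk : 1 ≤ k) (hn : 1 ≤ n) (hq : 1 ≤ q) (hqn : q ≤ n ^ 2) :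
    ∃ r : ℝ, 1 / 2 ≤ r ∧ r ^ k * threshold n k q = n ∧
      r * √((4 * (k : ℝ) + 5) * q) = threshold n k q ^ 2 := by
  set D := √((4 * (k : ℝ) + 5) * q) with hD
  set h := threshold n k q with hh
  have hD1 : 1 ≤ D := one_le_sqrt k hq
  have hD0 : 0 < D := by linarith
  have hh1 : 1 ≤ h := one_le_threshold hn hq
  have hn1 : (1 : ℝ) ≤ n := by exact_mod_cast hn
  have hpow : h ^ (2 * k + 1) = n * D ^ k := threshold_pow n k q
  refine ⟨h ^ 2 / D, ?_, ?_, div_mul_cancel₀ _ hD0.ne'⟩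
  · have h₁ : D ≤ 2 ^ (2 * k + 1) * n ^ 2 := by
      have h₂ : (q : ℝ) ≤ n ^ 2 := by exact_mod_cast hqn
      calc D ≤ √((4 * (k : ℝ) + 5) * n ^ 2) := Real.sqrt_le_sqrt (by gcongr)
        _ = √(4 * (k : ℝ) + 5) * n := by
            rw [Real.sqrt_mul (by positivity), Real.sqrt_sq (by positivity)]
        _ ≤ 2 ^ (2 * k + 1) * n ^ 2 := by
            gcongr
            · exact sqrt_le_two_pow hk
            · nlinarith
    have h₂ : (h ^ 2 / D) ^ (2 * k + 1) = n ^ 2 / D := by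
      rw [div_pow, ← pow_mul, mul_comm, pow_mul, hpow, mul_pow, ← pow_mul, pow_succ D,
        mul_comm k 2]
      field_simp
    have h₃ : (1 / 2 : ℝ) ^ (2 * k + 1) ≤ (h ^ 2 / D) ^ (2 * k + 1) := by
      rw [h₂, div_pow, one_pow, div_le_div_iff₀ (by positivity) hD0]
      linarith
    exact (pow_le_pow_iff_left₀ (by norm_num) (by positivity) (by omega)).1 h₃
  · rw [div_pow, ← pow_mul, div_mul_eq_mul_div, ← pow_succ, hpow, mul_div_cancel_right₀]
    positivity

end Parameters

section Size

variable {V : Type*} [Fintype V] {G H : SimpleGraph V}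

/-- The size of an outcome, for the balanced threshold. -/
lemma IsOutcome.ncard_le {P : Finset (V × V)} {k h : ℕ} (hk : 1 ≤ k) (hP : P.Nonempty)
    (hh : threshold (Fintype.card V) k P.card ≤ h)
    (hh' : h ≤ threshold (Fintype.card V) k P.card + 1)
    (hH : IsOutcome G P k h H) :
    (H.edgeSet.ncard : ℝ) ≤ 87 * (Fintype.card V * threshold (Fintype.card V) k P.card) := by
  obtain ⟨cl, hcl, hrun⟩ := hH
  obtain ⟨x, hx⟩ := hP
  have hq : 1 ≤ P.card := Finset.card_pos.2 ⟨x, hx⟩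
  have hn : 1 ≤ Fintype.card V := Fintype.card_pos_iff.2 ⟨x.1⟩
  have hqn : P.card ≤ Fintype.card V ^ 2 := by
    simpa [sq] using Finset.card_le_univ P
  obtain ⟨r, hr, hrk, hrD⟩ := exists_ratio hk hn hq hqn
  have hθ := one_le_threshold (k := k) hn hq
  set n := Fintype.card V
  set q := P.card
  set θ := threshold n k q
  set D := √((4 * (k : ℝ) + 5) * q) with hD
  set R := ⌈3 * r⌉₊ + 1 with hR
  have hR3 : 3 * r ≤ R := (Nat.le_ceil _).trans (by simp [hR])
  have hR7 : (R : ℝ) ≤ 7 * r := by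
    have := (Nat.ceil_lt_add_one (a := 3 * r) (by linarith)).le
    rw [hR]
    push_cast
    linarith
  have hR2 : 2 ≤ R := by
    have : 0 < ⌈3 * r⌉₊ := Nat.ceil_pos.2 (by linarith)
    omega
  have hZ : ((centres cl).card : ℝ) * θ ≤ n := by
    have h₁ : (h : ℝ) * (centres cl).card ≤ n := by exact_mod_cast hcl.mul_card_centres_le
    have h₂ : (0 : ℝ) ≤ (centres cl).card := Nat.cast_nonneg _
    nlinarith
  have hZr : ((centres cl).card : ℝ) ≤ r ^ k := by
    rw [← hrk] at hZ
    exact le_of_mul_le_mul_right hZ (by linarith)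
  have hZR : 3 * (centres cl).card ≤ 2 * R ^ k := by
    have h₁ : 3 * ((centres cl).card : ℝ) ≤ 2 * (R : ℝ) ^ k := by
      calc 3 * ((centres cl).card : ℝ) ≤ 3 * r ^ k := by gcongr
        _ ≤ 3 ^ k * r ^ k := by
            gcongr
            exact le_self_pow₀ (by norm_num) (by omega)
        _ = (3 * r) ^ k := (mul_pow _ _ _).symm
        _ ≤ (R : ℝ) ^ k := by gcongr
        _ ≤ 2 * (R : ℝ) ^ k := by linarith [pow_nonneg (Nat.cast_nonneg (α := ℝ) R) k]
    exact_mod_cast h₁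
  have h₁ := hrun.ncard_le hcl.isClustering hk hR2 hZR
  have h₂ : ((clusterGraph G cl).edgeSet.ncard : ℝ) ≤ n * h + n := by
    exact_mod_cast hcl.ncard_clusterGraph_le
  rw [Set.ncard_coe_finset] at h₁
  have h₃ : √((4 * (k : ℝ) + 1) * q) ≤ D := by
    refine Real.sqrt_le_sqrt ?_
    gcongr
    norm_num
  have h₄ : 12 * (R : ℝ) * (centres cl).card * √((4 * (k : ℝ) + 1) * q) ≤ 84 * (n * θ) := by
    calc 12 * (R : ℝ) * (centres cl).card * √((4 * (k : ℝ) + 1) * q)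
        ≤ 12 * (7 * r) * (centres cl).card * D := by gcongr
      _ = 84 * (centres cl).card * (r * D) := by ring
      _ = 84 * ((centres cl).card * θ * θ) := by rw [hrD]; ring
      _ ≤ 84 * (n * θ) := by gcongr
  have hn0 : (1 : ℝ) ≤ n := by exact_mod_cast hn
  nlinarith

lemma ncard_edgeSet_le (H : SimpleGraph V) : H.edgeSet.ncard ≤ Fintype.card V ^ 2 := by
  classical
  rw [← SimpleGraph.coe_edgeFinset, Set.ncard_coe_finset]
  exact H.card_edgeFinset_le_card_choose_two.trans (Nat.choose_le_pow _ _)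

/-- A graph that is at most as large as an outcome for every threshold `h ≤ n` has the size that the
balanced threshold promises. -/
lemma ncard_le_of_forall_outcome {P : Finset (V × V)} {k : ℕ} (hk : 1 ≤ k) (hP : P.Nonempty)
    (hH : ∀ h, 1 ≤ h → h ≤ Fintype.card V →
      ∃ H', IsOutcome G P k h H' ∧ H.edgeSet.ncard ≤ H'.edgeSet.ncard) :
    (H.edgeSet.ncard : ℝ) ≤ 87 * (Fintype.card V * threshold (Fintype.card V) k P.card) := by
  obtain ⟨x, hx⟩ := id hP
  have hq : 1 ≤ P.card := Finset.card_pos.2 ⟨x, hx⟩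
  have hn : 1 ≤ Fintype.card V := Fintype.card_pos_iff.2 ⟨x.1⟩
  have hθ := one_le_threshold (k := k) hn hq
  by_cases hle : ⌈threshold (Fintype.card V) k P.card⌉₊ ≤ Fintype.card V
  · obtain ⟨H', h₁, h₂⟩ := hH _ (Nat.one_le_ceil_iff.2 (by linarith)) hle
    have h₃ : (H.edgeSet.ncard : ℝ) ≤ H'.edgeSet.ncard := by exact_mod_cast h₂
    exact h₃.trans (h₁.ncard_le hk hP (Nat.le_ceil _) (Nat.ceil_lt_add_one (by linarith)).le)
  · rw [not_le, Nat.lt_ceil] at hle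
    have h₁ : (H.edgeSet.ncard : ℝ) ≤ (Fintype.card V : ℝ) ^ 2 := by
      exact_mod_cast ncard_edgeSet_le H
    nlinarith

end Size

lemma natLog_three_le_log (n : ℕ) : (Nat.log 3 n : ℝ) ≤ Real.log n := by
  rcases Nat.eq_zero_or_pos n with rfl | hn
  · simp
  have h₁ : (3 : ℝ) ^ Nat.log 3 n ≤ n := by exact_mod_cast Nat.pow_log_le_self 3 hn.ne'
  have h₂ := Real.log_le_log (by positivity) h₁
  rw [Real.log_pow] at h₂
  have h₃ : (1 : ℝ) ≤ Real.log 3 := by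
    rw [Real.le_log_iff_exp_le (by norm_num)]
    exact Real.exp_one_lt_d9.le.trans (by norm_num)
  have h₄ : (0 : ℝ) ≤ Nat.log 3 n := Nat.cast_nonneg _
  nlinarith

/-- For `k` about `log n`, the size is `n` times the fourth root of `q * log n`. -/
lemma mul_threshold_log_le {n q : ℕ} (hn : 3 ≤ n) (hq : 1 ≤ q) :
    (n : ℝ) * threshold n (Nat.log 3 n) q ≤
      27 * (n * ((q : ℝ) * Real.log n) ^ ((1 : ℝ) / 4)) := by
  set k := Nat.log 3 n with hk
  have hk1 : 1 ≤ k := Nat.log_pos (by norm_num) hn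
  have hklog : (k : ℝ) ≤ Real.log n := natLog_three_le_log n
  have hk1' : (1 : ℝ) ≤ k := by exact_mod_cast hk1
  have hq1 : (1 : ℝ) ≤ q := by exact_mod_cast hq
  have h₁ : (n : ℝ) ^ (1 / (2 * (k : ℝ) + 1)) ≤ 3 := by
    have h₂ : (n : ℝ) ≤ 3 ^ (2 * (k : ℝ) + 1) := by
      have h₃ : n ≤ 3 ^ (2 * k + 1) :=
        (Nat.lt_pow_succ_log_self (by norm_num) n).le.trans
          (Nat.pow_le_pow_right (by norm_num) (by omega))
      have h₄ : (n : ℝ) ≤ (3 : ℝ) ^ (2 * k + 1) := by exact_mod_cast h₃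
      rw [← Real.rpow_natCast] at h₄
      push_cast at h₄
      exact h₄
    calc (n : ℝ) ^ (1 / (2 * (k : ℝ) + 1)) ≤ (3 ^ (2 * (k : ℝ) + 1)) ^ (1 / (2 * (k : ℝ) + 1)) := by
          gcongr
      _ = 3 := by
          rw [← Real.rpow_mul (by norm_num), mul_one_div_cancel (by positivity), Real.rpow_one]
  have h₂ : (√((4 * (k : ℝ) + 5) * q)) ^ ((k : ℝ) / (2 * (k : ℝ) + 1)) ≤
      9 * ((q : ℝ) * Real.log n) ^ ((1 : ℝ) / 4) := by
    calc (√((4 * (k : ℝ) + 5) * q)) ^ ((k : ℝ) / (2 * (k : ℝ) + 1))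
        ≤ (√((4 * (k : ℝ) + 5) * q)) ^ ((1 : ℝ) / 2) := by
          refine Real.rpow_le_rpow_of_exponent_le (one_le_sqrt k hq) ?_
          rw [div_le_div_iff₀ (by positivity) (by norm_num)]
          linarith
      _ = ((4 * (k : ℝ) + 5) * q) ^ ((1 : ℝ) / 4) := by
          rw [Real.sqrt_eq_rpow, ← Real.rpow_mul (by positivity)]
          norm_num
      _ ≤ (9 * (q * Real.log n)) ^ ((1 : ℝ) / 4) := by
          refine Real.rpow_le_rpow (by positivity) ?_ (by norm_num)
          nlinarith
      _ = 9 ^ ((1 : ℝ) / 4) * (q * Real.log n) ^ ((1 : ℝ) / 4) :=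
          Real.mul_rpow (by norm_num) (mul_nonneg (by linarith) (by linarith))
      _ ≤ 9 * (q * Real.log n) ^ ((1 : ℝ) / 4) := by
          gcongr
          exact Real.rpow_le_self_of_one_le (by norm_num) (by norm_num)
  have h₃ : threshold n k q ≤ 3 * (9 * ((q : ℝ) * Real.log n) ^ ((1 : ℝ) / 4)) := by
    rw [threshold]
    gcongr
  calc (n : ℝ) * threshold n k q ≤ n * (3 * (9 * ((q : ℝ) * Real.log n) ^ ((1 : ℝ) / 4))) := by
        gcongr
    _ = _ := by ring

/-! ### Building blocks of programs -/

lemma bit_eq_zero {p : Prop} : bit p = 0 ↔ ¬ p := by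
  rw [bit]
  split_ifs <;> simp [*]

lemma bit_ne_zero {p : Prop} : bit p ≠ 0 ↔ p := by rw [Ne, bit_eq_zero, not_not]

namespace Term

/-- A term, read as a condition, holds when its value is not zero. -/
def Holds (s : State) (c : Term) : Prop := c.eval s ≠ 0

instance (s : State) (c : Term) : Decidable (c.Holds s) := inferInstanceAs (Decidable (_ ≠ _))

/-- `e₁ < e₂` -/
def lt (e₁ e₂ : Term) : Term := .sub e₂ e₁

/-- `e₁ ≤ e₂` -/
def le (e₁ e₂ : Term) : Term := .sub (.add e₂ (.const 1)) e₁

/-- The value is `1` if the condition fails, and `0` if it holds. -/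
def not (c : Term) : Term := .ite c (.const 0) (.const 1)

/-- The value is `1` if both conditions hold, and `0` otherwise. -/
def and (c c' : Term) : Term := .ite c (.ite c' (.const 1) (.const 0)) (.const 0)

/-- The value is `1` if one of the conditions holds, and `0` otherwise. -/
def or (c c' : Term) : Term := .ite c (.const 1) (.ite c' (.const 1) (.const 0))

/-- `e₁ = e₂` -/
def eq (e₁ e₂ : Term) : Term := and (le e₁ e₂) (le e₂ e₁)

/-- The smaller one of two values. -/
def min (e₁ e₂ : Term) : Term := .sub e₁ (.sub e₁ e₂)

variable {s : State}

@[simp] lemma holds_lt {e₁ e₂ : Term} : (lt e₁ e₂).Holds s ↔ e₁.eval s < e₂.eval s := by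
  simp only [Holds, lt, eval]; omega

@[simp] lemma holds_le {e₁ e₂ : Term} : (le e₁ e₂).Holds s ↔ e₁.eval s ≤ e₂.eval s := by
  simp only [Holds, le, eval]; omega

@[simp] lemma eval_const {c : ℕ} : (const c).eval s = c := rfl

@[simp] lemma eval_reg {x : ℕ} : (reg x).eval s = s.reg x := rfl

@[simp] lemma eval_cell {a : ℕ} {i j : Term} :
    (cell a i j).eval s = s.arr a (i.eval s) (j.eval s) := rfl

@[simp] lemma eval_add {e₁ e₂ : Term} : (add e₁ e₂).eval s = e₁.eval s + e₂.eval s := rfl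

lemma eval_sum {x : ℕ} {e : Term} :
    (sum x e).eval s = ∑ i ∈ Finset.range (s.reg 0), e.eval (s.setReg x i) := rfl

lemma eval_ite {c e₁ e₂ : Term} :
    (ite c e₁ e₂).eval s = if c.Holds s then e₁.eval s else e₂.eval s := rfl

lemma eval_not {c : Term} : (not c).eval s = bit (¬ c.Holds s) := by
  simp only [not, eval_ite, bit, eval]; split_ifs <;> rfl

lemma eval_and {c c' : Term} : (and c c').eval s = bit (c.Holds s ∧ c'.Holds s) := by
  by_cases h : c.Holds s <;> by_cases h' : c'.Holds s <;>
    simp only [and, eval_ite, bit, h, h'] <;> simp [eval]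

lemma eval_or {c c' : Term} : (or c c').eval s = bit (c.Holds s ∨ c'.Holds s) := by
  by_cases h : c.Holds s <;> by_cases h' : c'.Holds s <;>
    simp only [or, eval_ite, bit, h, h'] <;> simp [eval]

@[simp] lemma holds_not {c : Term} : (not c).Holds s ↔ ¬ c.Holds s := by
  rw [Holds, eval_not, bit_ne_zero]

@[simp] lemma holds_and {c c' : Term} : (and c c').Holds s ↔ c.Holds s ∧ c'.Holds s := by
  rw [Holds, eval_and, bit_ne_zero]

@[simp] lemma holds_or {c c' : Term} : (or c c').Holds s ↔ c.Holds s ∨ c'.Holds s := by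
  rw [Holds, eval_or, bit_ne_zero]

@[simp] lemma holds_eq {e₁ e₂ : Term} : (eq e₁ e₂).Holds s ↔ e₁.eval s = e₂.eval s := by
  rw [eq, holds_and, holds_le, holds_le]; omega

@[simp] lemma holds_sum {x : ℕ} {e : Term} :
    (sum x e).Holds s ↔ ∃ i < s.reg 0, e.Holds (s.setReg x i) := by
  simp only [Holds, eval, Ne, Finset.sum_eq_zero_iff, Finset.mem_range, not_forall, exists_prop]

lemma eval_min {e₁ e₂ : Term} : (min e₁ e₂).eval s = Min.min (e₁.eval s) (e₂.eval s) := by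
  simp only [min, eval]; omega

lemma holds_cell {a : ℕ} {i j : Term} :
    (cell a i j).Holds s ↔ s.arr a (i.eval s) (j.eval s) ≠ 0 := Iff.rfl

/-- The least `i` below the content of register `0` for which the condition `c` holds for the
value `i` of register `x`; the register `y` is auxiliary. -/
def find (y x : ℕ) (c : Term) : Term :=
  .sum y (not (.sum x (and (le (.reg x) (.reg y)) c)))

lemma eval_find {y x : ℕ} {c : Term} {φ : ℕ → Prop} (hyx : y ≠ x) (hy : y ≠ 0)
    (hφ : ∀ i j, c.Holds ((s.setReg y j).setReg x i) ↔ φ i) (h : ∃ i < s.reg 0, φ i) :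
    (find y x c).eval s < s.reg 0 ∧ φ ((find y x c).eval s) := by
  classical
  have hval : (find y x c).eval s =
      ∑ j ∈ Finset.range (s.reg 0), bit (¬ ∃ i ≤ j, φ i) := by
    rw [find, eval]
    refine Finset.sum_congr rfl fun j hj => ?_
    rw [Finset.mem_range] at hj
    rw [eval_not, holds_sum]
    congr 2
    simp only [State.setReg_reg, hy.symm, if_false, holds_and, holds_le, eval, if_true, hyx, hφ,
      eq_iff_iff]
    exact ⟨fun ⟨i, _, h₁, h₂⟩ => ⟨i, h₁, h₂⟩, fun ⟨i, h₁, h₂⟩ => ⟨i, by omega, h₁, h₂⟩⟩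
  have hex : ∃ i, φ i := by obtain ⟨i, -, hi⟩ := h; exact ⟨i, hi⟩
  have hlt : Nat.find hex < s.reg 0 := by
    obtain ⟨i, hi, hi'⟩ := h
    exact (Nat.find_min' hex hi').trans_lt hi
  have hfind : (find y x c).eval s = Nat.find hex := by
    have h₁ : ∀ j, (¬ ∃ i ≤ j, φ i) ↔ j < Nat.find hex := by
      intro j
      rw [Nat.lt_find_iff]
      push Not
      rfl
    simp only [hval, h₁, bit]
    rw [← Finset.card_filter]
    refine Eq.trans ?_ (Finset.card_range (Nat.find hex))
    congr 1
    ext j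
    simp only [Finset.mem_filter, Finset.mem_range]
    omega
  rw [hfind]
  exact ⟨hlt, Nat.find_spec hex⟩

end Term

/-- Overwrite a whole array. -/
def State.setArr (s : State) (a : ℕ) (f : ℕ → ℕ → ℕ) : State :=
  { s with arr := fun b => if b = a then f else s.arr b }

@[simp] lemma State.setArr_reg (s : State) (a : ℕ) (f : ℕ → ℕ → ℕ) :
    (s.setArr a f).reg = s.reg := rfl

@[simp] lemma State.setArr_arr (s : State) (a b : ℕ) (f : ℕ → ℕ → ℕ) :
    (s.setArr a f).arr b = if b = a then f else s.arr b := rfl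

namespace Cmd

/-- The rule for a loop with the loop invariant `I`. -/
lemma sem_for_induction {x : ℕ} {c : Cmd} {s : State} (I : ℕ → State → Prop) (h0 : I 0 s)
    (hs : ∀ i < s.reg 0, ∀ st, I i st → I (i + 1) (c.sem (st.setReg x i)))
    (hx : ∀ st, I (s.reg 0) st → I (s.reg 0) (st.setReg x (s.reg x))) :
    I (s.reg 0) ((Cmd.for_ x c).sem s) :=
  hx _ (iter_induction I h0 hs)

/-- `a[i, j] := e` for all `i` and `j`, which are held by the registers `7` and `8`. -/
def fill (a : ℕ) (e : Term) : Cmd :=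
  .for_ 7 (.for_ 8 (.store a (.reg 7) (.reg 8) e))

/-- If `e` does not mention the array `a`, then the cells of the array are filled independently of
each other. -/
lemma sem_fill {a : ℕ} {e : Term} (he : e.avoids a) (s : State) :
    (fill a e).sem s = s.setArr a fun i j =>
      if i < s.reg 0 ∧ j < s.reg 0 then e.eval ((s.setReg 7 i).setReg 8 j) else s.arr a i j := by
  set f : ℕ → ℕ → ℕ := fun i j => e.eval ((s.setReg 7 i).setReg 8 j) with hf
  have inner : ∀ i < s.reg 0, ∀ st : State, (∀ y, y ≠ 7 → st.reg y = s.reg y) →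
      (∀ b, b ≠ a → st.arr b = s.arr b) →
      ((Cmd.for_ 8 (.store a (.reg 7) (.reg 8) e)).sem (st.setReg 7 i)) =
        (st.setReg 7 i).setArr a fun i' j' =>
          if i' = i ∧ j' < s.reg 0 then f i' j' else st.arr a i' j' := by
    intro i hi st hr ha
    have hr0 : (st.setReg 7 i).reg 0 = s.reg 0 := by simp [hr]
    have key := sem_for_induction (x := 8) (c := .store a (.reg 7) (.reg 8) e)
      (s := st.setReg 7 i)
      (fun m st' => (∀ y, y ≠ 8 → st'.reg y = (st.setReg 7 i).reg y) ∧
        st'.arr = ((st.setReg 7 i).setArr a fun i' j' =>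
          if i' = i ∧ j' < m then f i' j' else st.arr a i' j').arr)
      ⟨fun _ _ => rfl, by
        funext b
        simp only [State.setArr_arr, Nat.not_lt_zero, and_false, if_false, State.setReg_arr]
        split_ifs with h
        · rw [h]
        · rfl⟩
      (by
        rintro m hm st' ⟨h₁, h₂⟩
        have hval : e.eval (st'.setReg 8 m) = f i m := by
          refine Term.eval_congr_avoids he ?_ ?_
          · funext y
            simp only [State.setReg_reg]
            split_ifs with h8 h7
            · rfl
            · rw [h₁ y h8, State.setReg_reg, if_pos h7]
            · rw [h₁ y h8, State.setReg_reg, if_neg h7, hr y h7]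
          · intro b hb
            simp only [State.setReg_arr, h₂, State.setArr_arr, if_neg hb, ha b hb]
        refine ⟨fun y hy => ?_, ?_⟩
        · simp only [sem, State.setCell_reg, State.setReg_reg, if_neg hy]
          rw [h₁ y hy, State.setReg_reg]
        · have h7 : st'.reg 7 = i := by rw [h₁ 7 (by norm_num)]; simp
          funext b i' j'
          simp only [sem, hval, State.setCell, Term.eval, State.setReg_reg, State.setReg_arr, h₂,
            State.setArr_arr, h7]
          norm_num [h7]
          by_cases hb : b = a
          · subst hb
            simp only [true_and, if_true]
            by_cases hij : i' = i ∧ j' = m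
            · rw [if_pos hij, if_pos ⟨hij.1, by omega⟩, hij.1, hij.2]
            · rw [if_neg hij]
              congr 1
              simp only [eq_iff_iff]
              omega
          · simp [hb])
      (by
        rintro st' ⟨h₁, h₂⟩
        exact ⟨fun y hy => by rw [State.setReg_reg, if_neg hy, h₁ y hy], h₂⟩)
    rw [hr0] at key
    refine State.ext' ?_ key.2
    funext y
    by_cases hy : y = 8
    · rw [hy]
      simp [sem]
    · rw [key.1 y hy]
      rfl
  have key := sem_for_induction (x := 7) (c := .for_ 8 (.store a (.reg 7) (.reg 8) e)) (s := s)
    (fun m st => (∀ y, y ≠ 7 → st.reg y = s.reg y) ∧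
      st.arr = (s.setArr a fun i' j' =>
        if i' < m ∧ j' < s.reg 0 then f i' j' else s.arr a i' j').arr)
    ⟨fun _ _ => rfl, by
      funext b
      simp only [State.setArr_arr, Nat.not_lt_zero, false_and, if_false]
      split_ifs with h
      · rw [h]
      · rfl⟩
    (by
      rintro m hm st ⟨h₁, h₂⟩
      rw [inner m hm st h₁ fun b hb => by rw [h₂, State.setArr_arr, if_neg hb]]
      refine ⟨fun y hy => by simp [hy, h₁ y hy], ?_⟩
      funext b i' j'
      by_cases hb : b = a
      · subst hb
        simp only [State.setArr_arr, if_true, h₂]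
        by_cases h : i' = m ∧ j' < s.reg 0
        · rw [if_pos h, if_pos ⟨by omega, h.2⟩]
        · rw [if_neg h]
          congr 1
          simp only [eq_iff_iff]
          omega
      · simp [hb, h₂])
    (by
      rintro st ⟨h₁, h₂⟩
      exact ⟨fun y hy => by rw [State.setReg_reg, if_neg hy, h₁ y hy], h₂⟩)
  refine State.ext' ?_ key.2
  funext y
  by_cases hy : y = 7
  · rw [hy]
    simp [fill, sem]
  · rw [State.setArr_reg, ← key.1 y hy]
    rfl

lemma sem_fill_reg {a : ℕ} {e : Term} (he : e.avoids a) (s : State) (x : ℕ) :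
    ((fill a e).sem s).reg x = s.reg x := by
  rw [sem_fill he]; rfl

lemma sem_fill_arr {a b : ℕ} {e : Term} (hb : b ≠ a) (s : State) :
    ((fill a e).sem s).arr b = s.arr b :=
  sem_arr s (by simp [fill, keepsArr, hb.symm])

lemma sem_fill_apply {a n : ℕ} {e : Term} (he : e.avoids a) {s : State} (hn : s.reg 0 = n)
    (i j : Fin n) : ((fill a e).sem s).arr a i j = e.eval ((s.setReg 7 i).setReg 8 j) := by
  rw [sem_fill he, State.setArr_arr, if_pos rfl, if_pos ⟨by omega, by omega⟩]

end Cmd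

variable {n : ℕ}

/-- Array `a` holds the adjacency matrix of `F`. -/
def State.HasAdj (s : State) (a : ℕ) (F : SimpleGraph (Fin n)) : Prop :=
  ∀ i j : Fin n, s.arr a i j = bit (F.Adj i j)

/-- Array `a` holds the matrix of the capped distances in `F`. -/
def State.HasDist (s : State) (k a : ℕ) (F : SimpleGraph (Fin n)) : Prop :=
  ∀ i j : Fin n, s.arr a i j = capDist k F i j

lemma State.HasAdj.of_arr {s s' : State} {a a' : ℕ} {F : SimpleGraph (Fin n)} (h : s.HasAdj a F)
    (hs : s'.arr a' = s.arr a) : s'.HasAdj a' F := fun i j => by rw [hs, h]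

lemma State.HasDist.of_arr {s s' : State} {k a a' : ℕ} {F : SimpleGraph (Fin n)}
    (h : s.HasDist k a F) (hs : s'.arr a' = s.arr a) : s'.HasDist k a' F :=
  fun i j => by rw [hs, h]

lemma exists_lt_iff_exists_fin {p : ℕ → Prop} : (∃ i < n, p i) ↔ ∃ i : Fin n, p i :=
  ⟨fun ⟨i, hi, h⟩ => ⟨⟨i, hi⟩, h⟩, fun ⟨i, h⟩ => ⟨i, i.2, h⟩⟩

/-- Array `a` becomes a copy of array `b`. -/
def copyCmd (a b : ℕ) : Cmd := .fill a (.cell b (.reg 7) (.reg 8))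

lemma copyCmd_apply {a b : ℕ} (hab : b ≠ a) {s : State} (hn : s.reg 0 = n) (i j : Fin n) :
    ((copyCmd a b).sem s).arr a i j = s.arr b i j := by
  rw [copyCmd, Cmd.sem_fill_apply (by simp [Term.avoids, hab]) hn]
  simp [Term.eval]

/-! ### Computing distances -/

/-- The term `4 * k`. -/
def fourK : Term := .add (.add (.reg 1) (.reg 1)) (.add (.reg 1) (.reg 1))

/-- The number in place of `∞`. -/
def infinity : Term := .add (.reg 0) fourK

lemma eval_fourK (s : State) : fourK.eval s = 4 * s.reg 1 := by
  simp only [fourK, Term.eval]; omega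

lemma eval_infinity (s : State) : infinity.eval s = s.reg 0 + 4 * s.reg 1 := by
  simp only [infinity, Term.eval, eval_fourK]

/-- One round of the breadth-first search: the vertices at distance `m + 1` are the new neighbours
of vertices at distance at most `m`, where register `13` holds `m`. -/
def distRound (src dst : ℕ) : Term :=
  .ite (.lt (.cell dst (.reg 7) (.reg 8)) infinity) (.cell dst (.reg 7) (.reg 8))
    (.ite (.sum 9 (.and (.lt (.cell dst (.reg 7) (.reg 9)) infinity)
        (.cell src (.reg 9) (.reg 8))))
      (.add (.reg 13) (.const 1)) infinity)

/-- The distance matrix of the graph in array `src` is written into array `dst`, by breadth-first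
searches from all the vertices in parallel. -/
def distCmd (src dst : ℕ) : Cmd :=
  .seq (.fill dst (.ite (.eq (.reg 7) (.reg 8)) (.const 0) infinity))
    (.for_ 13 (.seq (.fill 11 (distRound src dst)) (copyCmd dst 11)))

lemma reachable_and_dist_le_succ_iff {V : Type*} {F : SimpleGraph V} {u v : V} {m : ℕ} :
    (F.Reachable u v ∧ F.dist u v ≤ m + 1) ↔
      (F.Reachable u v ∧ F.dist u v ≤ m) ∨ ∃ w, (F.Reachable u w ∧ F.dist u w ≤ m) ∧ F.Adj w v := by
  constructor
  · rintro ⟨hr, hd⟩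
    rcases Nat.lt_or_ge m (F.dist u v) with hm | hm
    · right
      obtain ⟨p, hp⟩ := hr.symm.exists_walk_length_eq_dist
      rw [SimpleGraph.dist_comm] at hp
      cases p with
      | nil => simp at hm
      | cons h q =>
        rename_i w
        refine ⟨w, ⟨⟨q.reverse⟩, (F.dist_le q.reverse).trans ?_⟩, h.symm⟩
        rw [SimpleGraph.Walk.length_cons] at hp
        rw [SimpleGraph.Walk.length_reverse]
        omega
    · exact .inl ⟨hr, hm⟩
  · rintro (⟨hr, hd⟩ | ⟨w, ⟨hr, hd⟩, hw⟩)
    · exact ⟨hr, by omega⟩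
    · obtain ⟨p, hp⟩ := hr.exists_walk_length_eq_dist
      refine ⟨hr.trans hw.reachable, (F.dist_le (p.concat hw)).trans ?_⟩
      rw [SimpleGraph.Walk.length_concat]
      omega

lemma distCmd_spec {k src dst : ℕ} (h₁ : src ≠ dst) (h₂ : src ≠ 11) (h₃ : dst ≠ 11) {s : State}
    (hn : s.reg 0 = n) (hk : s.reg 1 = k) {F : SimpleGraph (Fin n)} (hF : s.HasAdj src F) :
    ((distCmd src dst).sem s).HasDist k dst F := by
  classical
  set s₁ := (Cmd.fill dst (.ite (.eq (.reg 7) (.reg 8)) (.const 0) infinity)).sem s with hs₁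
  have hav₁ : (Term.ite (.eq (.reg 7) (.reg 8)) (.const 0) infinity).avoids dst := rfl
  have hav₂ : (distRound src dst).avoids 11 := by
    simp [distRound, Term.avoids, Term.lt, Term.and, infinity, fourK, h₂, h₃]
  have hn₁ : s₁.reg 0 = n := (Cmd.sem_fill_reg hav₁ _ _).trans hn
  have key := Cmd.sem_for_induction (x := 13)
    (c := .seq (.fill 11 (distRound src dst)) (copyCmd dst 11)) (s := s₁)
    (fun m st => st.reg 0 = n ∧ st.reg 1 = k ∧ st.HasAdj src F ∧ ∀ i j : Fin n,
      st.arr dst i j = if F.Reachable i j ∧ F.dist i j ≤ m then F.dist i j else n + 4 * k)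
    (by
      refine ⟨hn₁, (Cmd.sem_fill_reg hav₁ _ _).trans hk,
        hF.of_arr (Cmd.sem_fill_arr h₁ _), fun i j => ?_⟩
      rw [hs₁, Cmd.sem_fill_apply hav₁ hn, Term.eval_ite]
      simp only [Term.holds_eq, Term.eval_const, Term.eval_reg, State.setReg_reg, eval_infinity]
      norm_num [hn, hk, Fin.val_inj]
      by_cases hij : i = j
      · simp [hij]
      · rw [if_neg hij, if_neg]
        rintro ⟨h, h'⟩
        exact hij (h'.resolve_right (not_not.2 h)))
    (by
      rintro m - st ⟨hn', hk', hF', hD⟩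
      set st₁ := (Cmd.fill 11 (distRound src dst)).sem (st.setReg 13 m) with hst₁
      have hn₂ : st₁.reg 0 = n := (Cmd.sem_fill_reg hav₂ _ _).trans (by simp [hn'])
      have hk₂ : st₁.reg 1 = k := (Cmd.sem_fill_reg hav₂ _ _).trans (by simp [hk'])
      refine ⟨(Cmd.sem_fill_reg (by simp [Term.avoids, h₃.symm]) _ _).trans hn₂,
        (Cmd.sem_fill_reg (by simp [Term.avoids, h₃.symm]) _ _).trans hk₂,
        hF'.of_arr ((Cmd.sem_fill_arr h₁ _).trans (Cmd.sem_fill_arr h₂ _)), fun i j => ?_⟩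
      rw [Cmd.sem, copyCmd_apply h₃.symm hn₂, hst₁, Cmd.sem_fill_apply hav₂ (by simp [hn'])]
      have hfin : ∀ u v : Fin n, st.arr dst u v < n + 4 * k ↔
          F.Reachable u v ∧ F.dist u v ≤ m := by
        intro u v
        rw [hD]
        split_ifs with h
        · have := dist_lt_card h.1
          rw [Fintype.card_fin] at this
          simp only [h, and_self, iff_true]
          omega
        · simp [h]
      simp only [distRound, Term.eval_ite, Term.holds_lt, Term.eval_const,
        Term.eval_reg, Term.eval_cell, Term.eval_add, State.setReg_reg,
        eval_infinity, Term.holds_sum, Term.holds_and, Term.holds_cell, State.setReg_arr]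
      norm_num [hn', hk']
      simp only [exists_lt_iff_exists_fin (n := n), hfin, hF' _ j, bit_eq_zero, not_not,
        reachable_and_dist_le_succ_iff (m := m)]
      by_cases hle : F.Reachable i j ∧ F.dist i j ≤ m
      · rw [if_pos hle, if_pos (.inl hle), hD, if_pos hle]
      · rw [if_neg hle]
        by_cases hex : ∃ w, (F.Reachable i w ∧ F.dist i w ≤ m) ∧ F.Adj w j
        · rw [if_pos hex, if_pos (.inr hex)]
          have := reachable_and_dist_le_succ_iff.2 (.inr hex)
          have : ¬ F.dist i j ≤ m := fun h => hle ⟨this.1, h⟩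
          omega
        · rw [if_neg hex, if_neg (fun h => h.elim hle hex)])
    (by
      rintro st ⟨hn', hk', hF', hD⟩
      exact ⟨by simp [hn'], by simp [hk'], hF', hD⟩)
  intro i j
  rw [distCmd, Cmd.sem, key.2.2.2 i j, hn₁, capDist, Fintype.card_fin]
  by_cases h : F.Reachable i j
  · have := dist_lt_card h
    rw [Fintype.card_fin] at this
    rw [if_pos ⟨h, this.le⟩, if_pos h]
  · rw [if_neg (by tauto), if_neg h]

/-! ### Computing clusters -/

/-- The code of the cluster of a vertex. -/
def clusterCode (o : Option (Fin n)) : ℕ := o.elim 0 fun c => c + 1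

lemma clusterCode_eq_zero {o : Option (Fin n)} : clusterCode o = 0 ↔ o = none := by
  cases o <;> simp [clusterCode]

lemma clusterCode_eq_succ {o : Option (Fin n)} {c : Fin n} :
    clusterCode o = c + 1 ↔ o = some c := by
  cases o <;> simp [clusterCode, Fin.val_inj]

/-- Row `0` of array `10` holds the clustering `cl`. -/
def State.HasClusters (s : State) (cl : Fin n → Option (Fin n)) : Prop :=
  ∀ u : Fin n, s.arr 10 0 u = clusterCode (cl u)

/-- The clusters after the vertex in register `5` has been considered: if more of its neighbours
than register `2` says are outside all the clusters, then they form a new cluster. -/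
def clusterRound : Term :=
  .ite (.cell 10 (.const 0) (.reg 8)) (.cell 10 (.const 0) (.reg 8))
    (.ite (.and (.lt (.reg 2) (.sum 9 (.and (.cell 0 (.reg 5) (.reg 9))
        (.not (.cell 10 (.const 0) (.reg 9)))))) (.cell 0 (.reg 5) (.reg 8)))
      (.add (.reg 5) (.const 1)) (.const 0))

/-- The edges of the cluster graph. -/
def clusterEdge : Term :=
  .and (.cell 0 (.reg 7) (.reg 8))
    (.or (.or (.not (.cell 10 (.const 0) (.reg 7))) (.not (.cell 10 (.const 0) (.reg 8))))
      (.or (.eq (.cell 10 (.const 0) (.reg 7)) (.add (.reg 8) (.const 1)))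
        (.eq (.cell 10 (.const 0) (.reg 8)) (.add (.reg 7) (.const 1)))))

/-- Clusters for the threshold `h + 1`, where register `2` holds `h`, and their graph. -/
def clusterCmd : Cmd :=
  .seq (.fill 10 (.const 0)) (.seq (.for_ 5 (.seq (.fill 11 clusterRound) (copyCmd 10 11)))
    (.fill 3 clusterEdge))

lemma sum_range_bit_eq_ncard {p : ℕ → Prop} :
    ∑ i ∈ Finset.range n, bit (p i) = {i : Fin n | p i}.ncard := by
  classical
  rw [Finset.sum_range, ← Finset.coe_filter_univ, Set.ncard_coe_finset, Finset.card_filter]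
  exact Finset.sum_congr rfl fun i _ => by rw [bit]

/-- The greedy formation of clusters: `v` collects its neighbours outside all the clusters,
provided that there are more than `h` of them. -/
noncomputable def collect (G : SimpleGraph (Fin n)) (h : ℕ) (cl : Fin n → Option (Fin n))
    (v : Fin n) (u : Fin n) : Option (Fin n) :=
  open Classical in
  if cl u = none ∧ h < {w | G.Adj v w ∧ cl w = none}.ncard ∧ G.Adj v u then some v else cl u

lemma clusterCmd_spec {h : ℕ} {s : State} (hn : s.reg 0 = n) (hh : s.reg 2 = h)
    {G : SimpleGraph (Fin n)} (hG : s.HasAdj 0 G) :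
    ∃ cl : Fin n → Option (Fin n), IsThresholdClustering G (h + 1) cl ∧
      (clusterCmd.sem s).HasClusters cl ∧ (clusterCmd.sem s).HasAdj 3 (clusterGraph G cl) := by
  classical
  set s₁ := (Cmd.fill 10 (.const 0)).sem s with hs₁
  have hn₁ : s₁.reg 0 = n := (Cmd.sem_fill_reg rfl _ _).trans hn
  obtain ⟨hn₂, hh₂, hG₂, cl, hcode, hadj, hlarge, hsmall⟩ := Cmd.sem_for_induction (x := 5)
    (c := .seq (.fill 11 clusterRound) (copyCmd 10 11)) (s := s₁)
    (fun m st => st.reg 0 = n ∧ st.reg 2 = h ∧ st.HasAdj 0 G ∧ ∃ cl : Fin n → Option (Fin n),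
      st.HasClusters cl ∧ (∀ u c, cl u = some c → G.Adj c u) ∧
      (∀ u c, cl u = some c → c.val < m ∧ h + 1 ≤ {u | cl u = some c}.ncard) ∧
      ∀ v : Fin n, v.val < m → {u | G.Adj v u ∧ cl u = none}.ncard ≤ h + 1)
    (by
      refine ⟨hn₁, (Cmd.sem_fill_reg rfl _ _).trans hh,
        hG.of_arr (Cmd.sem_fill_arr (by norm_num) _), fun _ => none, fun u => ?_, ?_, ?_, ?_⟩
      · have h0 : 0 < n := u.pos
        exact Cmd.sem_fill_apply (e := .const 0) rfl hn ⟨0, h0⟩ u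
      · simp
      · simp
      · simp)
    (by
      rintro m hm st ⟨hn', hh', hG', cl, hcode, hadj, hlarge, hsmall⟩
      rw [hn₁] at hm
      set v : Fin n := ⟨m, hm⟩ with hv
      have hav : clusterRound.avoids 11 := rfl
      have hn₂ : ((Cmd.fill 11 clusterRound).sem (st.setReg 5 m)).reg 0 = n :=
        (Cmd.sem_fill_reg hav _ _).trans (by simp [hn'])
      refine ⟨(Cmd.sem_fill_reg rfl _ _).trans hn₂,
        (Cmd.sem_fill_reg rfl _ _).trans ((Cmd.sem_fill_reg hav _ _).trans (by simp [hh'])),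
        hG'.of_arr ((Cmd.sem_fill_arr (by norm_num) _).trans (Cmd.sem_fill_arr (by norm_num) _)),
        collect G h cl v, fun u => ?_, ?_, ?_, ?_⟩
      · have h0 : 0 < n := u.pos
        have h1 := copyCmd_apply (a := 10) (b := 11) (by norm_num) hn₂ ⟨0, h0⟩ u
        rw [Cmd.sem_fill_apply hav (by simp [hn'])] at h1
        refine h1.trans ?_
        have hcount : ∀ x y : ℕ, (Term.sum 9 (.and (.cell 0 (.reg 5) (.reg 9))
            (.not (.cell 10 (.const 0) (.reg 9))))).eval
              (((st.setReg 5 m).setReg 7 x).setReg 8 y) =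
              {w | G.Adj v w ∧ cl w = none}.ncard := by
          intro x y
          rw [Term.eval_sum]
          simp only [Term.eval_and, Term.holds_cell, Term.holds_not, Term.eval_const,
            Term.eval_reg, State.setReg_reg,
            State.setReg_arr]
          norm_num [hn']
          rw [sum_range_bit_eq_ncard (p := fun i => ¬ st.arr 0 m i = 0 ∧ st.arr 10 0 i = 0)]
          congr 1
          ext w
          have h2 := hG' v w
          have h3 := hcode w
          simp only [hv] at h2
          simp only [Set.mem_ofPred_eq, h2, h3, bit_eq_zero, not_not, clusterCode_eq_zero, hv]
        simp only [clusterRound, Term.eval_ite, Term.holds_and, Term.holds_lt, hcount,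
          Term.holds_cell, Term.eval_const,
        Term.eval_reg, Term.eval_cell, Term.eval_add, State.setReg_reg, State.setReg_arr]
        have h2 := hG' v u
        have h3 := hcode u
        simp only [hv] at h2
        norm_num [hh', h2, h3, bit_eq_zero, clusterCode_eq_zero]
        rw [collect]
        by_cases hu : cl u = none
        · simp only [hu, if_true, true_and]
          split_ifs
          · simp [clusterCode, hv]
          · simp [clusterCode]
        · simp [hu]
      · intro u c hu
        rw [collect] at hu
        split_ifs at hu with hc
        · rw [← Option.some_injective _ hu]
          exact hc.2.2
        · exact hadj u c hu
      · intro u c hu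
        by_cases hc : cl u = none ∧ h < {w | G.Adj v w ∧ cl w = none}.ncard ∧ G.Adj v u
        · rw [collect, if_pos hc] at hu
          rw [← Option.some_injective _ hu]
          refine ⟨by simp [hv], (Nat.succ_le_of_lt hc.2.1).trans
            (Set.ncard_le_ncard ?_ (Set.toFinite _))⟩
          rintro w ⟨hw, hw'⟩
          exact if_pos ⟨hw', hc.2.1, hw⟩
        · rw [collect, if_neg hc] at hu
          have h4 := hlarge u c hu
          refine ⟨by omega, h4.2.trans (Set.ncard_le_ncard ?_ (Set.toFinite _))⟩
          intro w hw
          rw [Set.mem_ofPred_eq] at hw ⊢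
          rw [collect, if_neg (by simp [hw]), hw]
      · intro w hw
        have hsub : ∀ x, {u | G.Adj x u ∧ collect G h cl v u = none} ⊆
            {u | G.Adj x u ∧ cl u = none} := by
          rintro x u ⟨hu, hu'⟩
          refine ⟨hu, ?_⟩
          rw [collect] at hu'
          split_ifs at hu' with hc
          exact hu'
        by_cases hwv : w = v
        · subst hwv
          by_cases hc : h < {u | G.Adj v u ∧ cl u = none}.ncard
          · have : {u | G.Adj v u ∧ collect G h cl v u = none} = ∅ := by
              rw [Set.eq_empty_iff_forall_notMem]
              rintro u hu
              have hu' := hsub v hu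
              have h5 : collect G h cl v u = some v := if_pos ⟨hu'.2, hc, hu.1⟩
              exact absurd hu.2 (by simp [h5])
            rw [this]
            simp
          · exact ((Set.ncard_le_ncard (hsub v) (Set.toFinite _)).trans (not_lt.1 hc)).trans
              (Nat.le_succ h)
        · have : w.val ≠ m := fun h => hwv (Fin.ext h)
          exact (Set.ncard_le_ncard (hsub w) (Set.toFinite _)).trans (hsmall w (by omega)))
    (by
      rintro st ⟨hn', hh', hG', cl, hcode, hrest⟩
      exact ⟨by simp [hn'], by simp [hh'], hG', cl, hcode, hrest⟩)
  have hsem : clusterCmd.sem s = (Cmd.fill 3 clusterEdge).sem ((Cmd.for_ 5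
    (.seq (.fill 11 clusterRound) (copyCmd 10 11))).sem s₁) := rfl
  refine ⟨cl, ⟨hadj, fun u c hu => (hlarge u c hu).2, fun v => hsmall v (by omega)⟩, ?_, ?_⟩
  · intro u
    rw [hsem, Cmd.sem_fill_arr (by norm_num), hcode]
  · intro i j
    rw [hsem, Cmd.sem_fill_apply rfl hn₂, clusterEdge, Term.eval_and]
    congr 1
    have h2 := hG₂ i j
    simp only [Term.holds_or, Term.holds_not, Term.holds_eq, Term.holds_cell, Term.eval_const,
      Term.eval_reg, Term.eval_cell, Term.eval_add,
      State.setReg_reg, State.setReg_arr]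
    norm_num [h2, hcode i, hcode j, bit_eq_zero, clusterCode_eq_zero, clusterCode_eq_succ]
    simp only [clusterGraph, or_assoc]

/-! ### Computing shortest paths -/

/-- A neighbour of the last vertex of the path that is closer to the vertex in register `4`. -/
def nextVertex : Term :=
  .find 9 10 (.and (.cell 0 (.cell 8 (.const 0) (.reg 13)) (.reg 10))
    (.eq (.add (.cell 4 (.reg 10) (.reg 4)) (.const 1))
      (.cell 4 (.cell 8 (.const 0) (.reg 13)) (.reg 4))))

/-- The vertices of a shortest path from the vertex in register `3` to the vertex in register `4`
are written into row `0` of array `8`. -/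
def pathCmd : Cmd :=
  .seq (.store 8 (.const 0) (.const 0) (.reg 3))
    (.for_ 13 (.store 8 (.const 0) (.add (.reg 13) (.const 1)) nextVertex))

lemma exists_adj_dist_succ {V : Type*} {G : SimpleGraph V} {u t : V} {d : ℕ}
    (h : G.Reachable u t) (hd : G.dist u t = d + 1) :
    ∃ w, G.Adj u w ∧ G.Reachable w t ∧ G.dist w t = d := by
  obtain ⟨p, hp⟩ := h.exists_walk_length_eq_dist
  cases p with
  | nil => simp at hd
  | cons hadj q =>
    rename_i w
    rw [SimpleGraph.Walk.length_cons] at hp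
    refine ⟨w, hadj, ⟨q⟩, le_antisymm ((G.dist_le q).trans (by omega)) ?_⟩
    obtain ⟨q', hq'⟩ := SimpleGraph.Reachable.exists_walk_length_eq_dist ⟨q⟩
    have := G.dist_le (q'.cons hadj)
    rw [SimpleGraph.Walk.length_cons] at this
    omega

@[simp] lemma State.setCell_arr (s : State) (a i j v b i' j' : ℕ) :
    (s.setCell a i j v).arr b i' j' = if b = a ∧ i' = i ∧ j' = j then v else s.arr b i' j' := rfl

lemma pathCmd_spec {k : ℕ} {st₀ : State} {G : SimpleGraph (Fin n)} {s t : Fin n}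
    (hn : st₀.reg 0 = n) (hs : st₀.reg 3 = s) (ht : st₀.reg 4 = t)
    (hG : st₀.HasAdj 0 G) (hD : st₀.HasDist k 4 G) (hst : G.Reachable s t) :
    ∃ p : ℕ → Fin n, IsShortestPath G p (G.dist s t) s t ∧
      ∀ l ≤ G.dist s t, (pathCmd.sem st₀).arr 8 0 l = p l := by
  set L := G.dist s t with hL
  set st₁ := (Cmd.store 8 (.const 0) (.const 0) (.reg 3)).sem st₀ with hst₁
  have hn₁ : st₁.reg 0 = n := hn
  obtain ⟨-, -, -, -, p, hp0, hp, hadj⟩ := Cmd.sem_for_induction (x := 13)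
    (c := .store 8 (.const 0) (.add (.reg 13) (.const 1)) nextVertex) (s := st₁)
    (fun m st => st.reg 0 = n ∧ st.reg 4 = t ∧ st.HasAdj 0 G ∧ st.HasDist k 4 G ∧
      ∃ p : ℕ → Fin n, p 0 = s ∧
        (∀ l ≤ m, l ≤ L → st.arr 8 0 l = p l ∧ G.Reachable (p l) t ∧ G.dist (p l) t + l = L) ∧
        ∀ l < m, l < L → G.Adj (p l) (p (l + 1)))
    (by
      refine ⟨hn, ht, hG.of_arr (Cmd.sem_arr _ rfl), hD.of_arr (Cmd.sem_arr _ rfl),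
        fun _ => s, rfl, ?_, ?_⟩
      · intro l hl _
        rw [Nat.le_zero] at hl
        subst hl
        refine ⟨?_, hst, rfl⟩
        simp [hst₁, Cmd.sem, hs]
      · intro l hl
        omega)
    (by
      rintro m - st ⟨hn', ht', hG', hD', p, hp0, hp, hadj⟩
      refine ⟨by simp [Cmd.sem, hn'], by simp [Cmd.sem, ht'],
        hG'.of_arr (Cmd.sem_arr _ rfl), hD'.of_arr (Cmd.sem_arr _ rfl), ?_⟩
      set v := nextVertex.eval (st.setReg 13 m) with hv
      have hstore : ∀ l, ((Cmd.store 8 (.const 0) (.add (.reg 13) (.const 1)) nextVertex).sem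
          (st.setReg 13 m)).arr 8 0 l = if l = m + 1 then v else st.arr 8 0 l := by
        intro l
        simp [Cmd.sem, hv]
      rcases Nat.lt_or_ge m L with hm | hm
      · obtain ⟨hpm, hreach, hdist⟩ := hp m le_rfl hm.le
        have hval := Term.eval_find (s := st.setReg 13 m) (y := 9) (x := 10)
          (c := .and (.cell 0 (.cell 8 (.const 0) (.reg 13)) (.reg 10))
            (.eq (.add (.cell 4 (.reg 10) (.reg 4)) (.const 1))
              (.cell 4 (.cell 8 (.const 0) (.reg 13)) (.reg 4))))
          (φ := fun i => st.arr 0 (p m) i ≠ 0 ∧ st.arr 4 i t + 1 = st.arr 4 (p m) t)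
          (by norm_num) (by norm_num)
          (fun i j => by
            simp only [Term.holds_and, Term.holds_cell, Term.holds_eq, Term.eval_add,
              Term.eval_cell, Term.eval_reg, Term.eval_const, State.setReg_reg, State.setReg_arr]
            norm_num [hpm, ht'])
          (by
            obtain ⟨w, hw, hwr, hwd⟩ := exists_adj_dist_succ (d := L - m - 1) hreach (by omega)
            refine ⟨w, by simp [hn'], ?_, ?_⟩
            · rw [hG', bit_ne_zero]
              exact hw
            · rw [hD', hD', capDist_of_reachable hwr, capDist_of_reachable hreach]
              omega)
        rw [← nextVertex, ← hv] at hval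
        obtain ⟨hvn, hvadj, hvd⟩ := hval
        rw [State.setReg_reg, if_neg (by norm_num), hn'] at hvn
        set w : Fin n := ⟨v, hvn⟩ with hw
        have hvw : v = (w : ℕ) := rfl
        rw [hvw, hG', bit_ne_zero] at hvadj
        have hwr : G.Reachable w t := hvadj.symm.reachable.trans hreach
        rw [hvw, hD', hD', capDist_of_reachable hwr, capDist_of_reachable hreach] at hvd
        refine ⟨Function.update p (m + 1) w, by simp [hp0], ?_, ?_⟩
        · intro l hl hlL
          rw [hstore]
          by_cases hlm : l = m + 1
          · subst hlm
            simp only [if_true, Function.update_self]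
            exact ⟨hvw, hwr, by omega⟩
          · rw [if_neg hlm, Function.update_of_ne hlm]
            exact hp l (by omega) hlL
        · intro l hl hlL
          rw [Function.update_of_ne (by omega : l ≠ m + 1)]
          by_cases hlm : l = m
          · subst hlm
            rw [Function.update_self]
            exact hvadj
          · rw [Function.update_of_ne (by omega)]
            exact hadj l (by omega) hlL
      · refine ⟨p, hp0, fun l hl hlL => ?_, fun l hl hlL => hadj l (by omega) hlL⟩
        rw [hstore, if_neg (by omega)]
        exact hp l (by omega) hlL)
    (by
      rintro st ⟨hn', ht', hrest⟩
      exact ⟨by simp [hn'], by simp [ht'], hrest⟩)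
  have hLn : L < n := by simpa using dist_lt_card hst
  rw [hn₁] at hp hadj
  refine ⟨p, ⟨hp0, ?_, fun l hl => hadj l (by omega) hl, rfl⟩, fun l hl => (hp l (by omega) hl).1⟩
  obtain ⟨-, hr, hd⟩ := hp L hLn.le le_rfl
  exact hr.dist_eq_zero_iff.1 (by omega)

/-! ### Trying the purchases for a pair -/

/-- The memory content while the purchases for the pair `(s, t)` are tried: `H` is the current
graph, and `p` is the shortest path. -/
structure IsPairState (st : State) (k : ℕ) (G H : SimpleGraph (Fin n))
    (cl : Fin n → Option (Fin n)) (p : ℕ → Fin n) (s t : Fin n) : Prop where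
  reg_n : st.reg 0 = n
  reg_k : st.reg 1 = k
  reg_s : st.reg 3 = s
  reg_t : st.reg 4 = t
  adj : st.HasAdj 3 H
  distG : st.HasDist k 4 G
  distH : st.HasDist k 5 H
  clusters : st.HasClusters cl
  path : ∀ l ≤ G.dist s t, st.arr 8 0 l = p l

lemma IsPairState.of_eq {st st' : State} {k : ℕ} {G H : SimpleGraph (Fin n)}
    {cl : Fin n → Option (Fin n)} {p : ℕ → Fin n} {s t : Fin n} (h : IsPairState st k G H cl p s t)
    (h0 : st'.reg 0 = st.reg 0) (h1 : st'.reg 1 = st.reg 1) (h3 : st'.reg 3 = st.reg 3)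
    (h4 : st'.reg 4 = st.reg 4) (ha3 : st'.arr 3 = st.arr 3) (ha4 : st'.arr 4 = st.arr 4)
    (ha5 : st'.arr 5 = st.arr 5) (ha10 : st'.arr 10 = st.arr 10) (ha8 : st'.arr 8 = st.arr 8) :
    IsPairState st' k G H cl p s t :=
  ⟨h0.trans h.reg_n, h1.trans h.reg_k, h3.trans h.reg_s, h4.trans h.reg_t, h.adj.of_arr ha3,
    h.distG.of_arr ha4, h.distH.of_arr ha5, fun u => by rw [ha10, h.clusters],
    fun l hl => by rw [ha8, h.path l hl]⟩

/-- A command that leaves alone the registers and arrays of a pair state. -/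
def keepsPair (c : Cmd) : Bool :=
  c.keepsReg 0 && c.keepsReg 1 && c.keepsReg 3 && c.keepsReg 4 && c.keepsArr 3 && c.keepsArr 4 &&
    c.keepsArr 5 && c.keepsArr 10 && c.keepsArr 8

lemma IsPairState.sem {st : State} {k : ℕ} {G H : SimpleGraph (Fin n)}
    {cl : Fin n → Option (Fin n)} {p : ℕ → Fin n} {s t : Fin n} (h : IsPairState st k G H cl p s t)
    {c : Cmd} (hc : keepsPair c) : IsPairState (c.sem st) k G H cl p s t := by
  simp only [keepsPair, Bool.and_eq_true] at hc
  obtain ⟨⟨⟨⟨⟨⟨⟨⟨h0, h1⟩, h3⟩, h4⟩, a3⟩, a4⟩, a5⟩, a10⟩, a8⟩ := hc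
  exact h.of_eq (Cmd.sem_reg _ h0) (Cmd.sem_reg _ h1) (Cmd.sem_reg _ h3) (Cmd.sem_reg _ h4)
    (Cmd.sem_arr _ a3) (Cmd.sem_arr _ a4) (Cmd.sem_arr _ a5) (Cmd.sem_arr _ a10)
    (Cmd.sem_arr _ a8)

lemma IsPairState.setReg {st : State} {k : ℕ} {G H : SimpleGraph (Fin n)}
    {cl : Fin n → Option (Fin n)} {p : ℕ → Fin n} {s t : Fin n} (h : IsPairState st k G H cl p s t)
    {x : ℕ} (hx : 4 < x) (v : ℕ) : IsPairState (st.setReg x v) k G H cl p s t := by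
  refine h.of_eq ?_ ?_ ?_ ?_ rfl rfl rfl rfl rfl <;>
  · rw [State.setReg_reg, if_neg (by omega)]

/-- The distance in `G` between the vertices in the registers `3` and `4`. -/
def pathLength : Term := .cell 4 (.reg 3) (.reg 4)

/-- The edge of the path with the number in register `9` lies before the position in register `5`
or after the position in register `6`. -/
def inPurchase : Term :=
  .and (.or (.lt (.reg 9) (.reg 5)) (.le (.reg 6) (.reg 9))) (.lt (.reg 9) pathLength)

/-- The vertex of the path before the edge with the number in register `9`. -/
def pathSource : Term := .cell 8 (.const 0) (.reg 9)

/-- The vertex of the path after the edge with the number in register `9`. -/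
def pathTarget : Term := .cell 8 (.const 0) (.add (.reg 9) (.const 1))

/-- The adjacency matrix of the graph after the purchase. -/
def buyTerm : Term :=
  .or (.cell 3 (.reg 7) (.reg 8)) (.sum 9 (.and inPurchase
    (.or (.and (.eq pathSource (.reg 7)) (.eq pathTarget (.reg 8)))
      (.and (.eq pathSource (.reg 8)) (.eq pathTarget (.reg 7))))))

/-- The cost of the purchase. -/
def costTerm : Term := .sum 9 (.and inPurchase (.not (.cell 3 pathSource pathTarget)))

/-- The vertex in register `x` is a centre. -/
def centreTerm (x : ℕ) : Term :=
  .sum 9 (.eq (.cell 10 (.const 0) (.reg 9)) (.add (.reg x) (.const 1)))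

/-- The potential of the graph whose distance matrix is array `d`. -/
def potentialTerm (d : ℕ) : Term :=
  .sum 7 (.sum 8 (.ite (.and (centreTerm 7) (centreTerm 8))
    (.min (.cell d (.reg 7) (.reg 8))
      (.add (.cell 4 (.reg 7) (.reg 8)) (.add fourK (.const 1)))) (.const 0)))

/-- The square of register `x` times register `y`. -/
def sqMul (x y : ℕ) : Term :=
  .sum 11 (.ite (.lt (.reg 11) (.reg x))
    (.sum 12 (.ite (.lt (.reg 12) (.reg x)) (.reg y) (.const 0))) (.const 0))

section Eval

variable {st : State} {k : ℕ} {G H : SimpleGraph (Fin n)} {cl : Fin n → Option (Fin n)}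
  {p : ℕ → Fin n} {s t : Fin n}

lemma eval_pathLength (h : IsPairState st k G H cl p s t) (hst : G.Reachable s t) :
    pathLength.eval st = G.dist s t := by
  rw [pathLength, Term.eval_cell, Term.eval_reg, Term.eval_reg, h.reg_s, h.reg_t, h.distG,
    capDist_of_reachable hst]

lemma holds_inPurchase (h : IsPairState st k G H cl p s t) (hst : G.Reachable s t) {a b l : ℕ}
    (ha : st.reg 5 = a) (hb : st.reg 6 = b) (hl : st.reg 9 = l) :
    inPurchase.Holds st ↔ (l < a ∨ b ≤ l) ∧ l < G.dist s t := by
  rw [inPurchase, Term.holds_and, Term.holds_or, Term.holds_lt, Term.holds_le, Term.holds_lt,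
    eval_pathLength h hst]
  simp only [Term.eval_reg, ha, hb, hl]

lemma eval_pathSource (h : IsPairState st k G H cl p s t) {l : ℕ} (hl : st.reg 9 = l)
    (hL : l < G.dist s t) : pathSource.eval st = p l := by
  simp only [pathSource, Term.eval_cell, Term.eval_const, Term.eval_reg, hl]
  exact h.path l hL.le

lemma eval_pathTarget (h : IsPairState st k G H cl p s t) {l : ℕ} (hl : st.reg 9 = l)
    (hL : l < G.dist s t) : pathTarget.eval st = p (l + 1) := by
  simp only [pathTarget, Term.eval_cell, Term.eval_const, Term.eval_reg, Term.eval_add, hl]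
  exact h.path (l + 1) hL

lemma buy_adj_iff (hp : IsShortestPath G p (G.dist s t) s t) {a b : ℕ} {u v : Fin n} :
    (buy H p (G.dist s t) a b).Adj u v ↔ H.Adj u v ∨ ∃ l < n,
      ((l < a ∨ b ≤ l) ∧ l < G.dist s t) ∧
      (p l = u ∧ p (l + 1) = v ∨ p l = v ∧ p (l + 1) = u) := by
  have hLn : G.dist s t < n := by simpa using dist_lt_card hp.reachable
  rw [buy, SimpleGraph.sup_adj, SimpleGraph.fromEdgeSet_adj]
  refine or_congr_right ⟨?_, ?_⟩
  · rintro ⟨⟨l, hl, hab, he⟩, -⟩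
    refine ⟨l, by omega, ⟨hab, hl⟩, ?_⟩
    rw [Sym2.eq_iff] at he
    rcases he with ⟨h1, h2⟩ | ⟨h1, h2⟩
    · exact .inl ⟨h1.symm, h2.symm⟩
    · exact .inr ⟨h2.symm, h1.symm⟩
  · rintro ⟨l, -, ⟨hab, hl⟩, he⟩
    have hne := (hp.adj l hl).ne
    rcases he with ⟨rfl, rfl⟩ | ⟨rfl, rfl⟩
    · exact ⟨⟨l, hl, hab, rfl⟩, hne⟩
    · exact ⟨⟨l, hl, hab, Sym2.eq_swap⟩, hne.symm⟩

lemma fill_buyTerm (h : IsPairState st k G H cl p s t) (hp : IsShortestPath G p (G.dist s t) s t)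
    {a b : ℕ} (ha : st.reg 5 = a) (hb : st.reg 6 = b) :
    ((Cmd.fill 6 buyTerm).sem st).HasAdj 6 (buy H p (G.dist s t) a b) := by
  intro i j
  rw [Cmd.sem_fill_apply rfl h.reg_n, buyTerm, Term.eval_or]
  congr 1
  rw [Term.holds_cell, Term.holds_sum, buy_adj_iff hp]
  simp only [Term.eval_reg, State.setReg_reg, State.setReg_arr]
  norm_num [h.reg_n, h.adj i j, bit_eq_zero]
  refine or_congr_right (exists_congr fun l => and_congr_right fun _ => ?_)
  have h' : IsPairState (((st.setReg 7 i).setReg 8 j).setReg 9 l) k G H cl p s t :=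
    ((h.setReg (by norm_num) _).setReg (by norm_num) _).setReg (by norm_num) _
  rw [holds_inPurchase h' hp.reachable (a := a) (b := b) (l := l) (by simp [ha]) (by simp [hb])
    (by simp)]
  refine and_congr_right fun hl => ?_
  rw [eval_pathSource h' (l := l) (by simp) hl.2, eval_pathTarget h' (l := l) (by simp) hl.2]
  norm_num [Fin.val_inj]

lemma eval_costTerm (h : IsPairState st k G H cl p s t) (hst : G.Reachable s t) {a b : ℕ}
    (ha : st.reg 5 = a) (hb : st.reg 6 = b) : costTerm.eval st = cost H p (G.dist s t) a b := by
  classical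
  have hLn : G.dist s t < n := by simpa using dist_lt_card hst
  have h₁ : ∀ l, (Term.and inPurchase (.not (.cell 3 pathSource pathTarget))).eval (st.setReg 9 l) =
      if ((l < a ∨ b ≤ l) ∧ l < G.dist s t) ∧ ¬ H.Adj (p l) (p (l + 1)) then 1 else 0 := by
    intro l
    have h' : IsPairState (st.setReg 9 l) k G H cl p s t := h.setReg (by norm_num) _
    rw [Term.eval_and, holds_inPurchase h' hst (a := a) (b := b) (l := l) (by simp [ha])
      (by simp [hb]) (by simp), Term.holds_not, Term.holds_cell, bit]
    by_cases hl : (l < a ∨ b ≤ l) ∧ l < G.dist s t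
    · rw [eval_pathSource h' (l := l) (by simp) hl.2, eval_pathTarget h' (l := l) (by simp) hl.2,
        h'.adj, bit_ne_zero]
      congr
    · simp only [hl, false_and, if_false]
  rw [costTerm, Term.eval_sum, h.reg_n, Finset.sum_congr rfl fun l _ => h₁ l,
    ← Finset.card_filter, cost]
  congr 1
  ext l
  simp only [Finset.mem_filter, Finset.mem_range]
  constructor
  · rintro ⟨-, ⟨h1, h2⟩, h3⟩
    exact ⟨h2, h1, h3⟩
  · rintro ⟨h2, h1, h3⟩
    exact ⟨by omega, ⟨h1, h2⟩, h3⟩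

lemma holds_centreTerm (hn : st.reg 0 = n) (hcl : st.HasClusters cl) {x : ℕ} (hx : x ≠ 9)
    {c : Fin n} (hc : st.reg x = c) : (centreTerm x).Holds st ↔ c ∈ centres cl := by
  rw [centreTerm, Term.holds_sum]
  simp only [Term.holds_eq, Term.eval_cell, Term.eval_const, Term.eval_reg, Term.eval_add,
    State.setReg_reg, State.setReg_arr, hn, if_neg hx, hc, if_true,
    exists_lt_iff_exists_fin (n := n), hcl _, clusterCode_eq_succ]
  simp [centres]

lemma eval_potentialTerm (hn : st.reg 0 = n) (hk : st.reg 1 = k) (hcl : st.HasClusters cl)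
    (hG : st.HasDist k 4 G) {d : ℕ} {F : SimpleGraph (Fin n)} (hF : st.HasDist k d F) :
    (potentialTerm d).eval st = potential G (centres cl) k F := by
  classical
  have h₁ : ∀ i j : Fin n, (Term.ite (.and (centreTerm 7) (centreTerm 8))
      (.min (.cell d (.reg 7) (.reg 8))
      (.add (.cell 4 (.reg 7) (.reg 8)) (.add fourK (.const 1)))) (.const 0)).eval
        ((st.setReg 7 i).setReg 8 j) =
      if i ∈ centres cl ∧ j ∈ centres cl then
        min (capDist k F i j) (capDist k G i j + 4 * k + 1) else 0 := by
    intro i j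
    have hci := holds_centreTerm (st := (st.setReg 7 i).setReg 8 j) (cl := cl) (c := i)
      (by simp [hn]) (fun u => hcl u) (x := 7) (by norm_num) (by simp)
    have hcj := holds_centreTerm (st := (st.setReg 7 i).setReg 8 j) (cl := cl) (c := j)
      (by simp [hn]) (fun u => hcl u) (x := 8) (by norm_num) (by simp)
    simp only [Term.eval_ite, Term.holds_and, hci, hcj, Term.eval_min, Term.eval_cell,
      Term.eval_reg, Term.eval_add, Term.eval_const, eval_fourK, State.setReg_reg,
      State.setReg_arr]
    norm_num [hF i j, hG i j, hk, add_assoc]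
  rw [potentialTerm, Term.eval_sum, hn, Finset.sum_range]
  have h₂ : ∀ i : Fin n, (Term.sum 8 (.ite (.and (centreTerm 7) (centreTerm 8))
      (.min (.cell d (.reg 7) (.reg 8))
      (.add (.cell 4 (.reg 7) (.reg 8)) (.add fourK (.const 1)))) (.const 0))).eval
        (st.setReg 7 i) = ∑ j : Fin n, if i ∈ centres cl ∧ j ∈ centres cl then
        min (capDist k F i j) (capDist k G i j + 4 * k + 1) else 0 := by
    intro i
    rw [Term.eval_sum, State.setReg_reg, if_neg (by norm_num), hn, Finset.sum_range]
    exact Finset.sum_congr rfl fun j _ => h₁ i j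
  rw [Finset.sum_congr rfl fun i _ => h₂ i, potential]
  simp only [ite_and, Finset.sum_ite_irrel, Finset.sum_const_zero]
  simp [Finset.sum_ite_mem]

lemma eval_sqMul {x y c : ℕ} (hx : x ≠ 11 ∧ x ≠ 12) (hy : y ≠ 11 ∧ y ≠ 12) (hc : st.reg x = c)
    (hle : c ≤ st.reg 0) : (sqMul x y).eval st = st.reg y * c ^ 2 := by
  have hcard : ∀ d, ∑ i ∈ Finset.range (st.reg 0), (if i < c then d else 0) = c * d := by
    intro d
    rw [← Finset.sum_filter, Finset.sum_const, smul_eq_mul]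
    congr 1
    rw [← Finset.card_range c]
    congr 1
    ext i
    simp only [Finset.mem_filter, Finset.mem_range, Finset.card_range]
    omega
  simp only [sqMul, Term.eval_sum, Term.eval_ite, Term.holds_lt, Term.eval_reg, Term.eval_const,
    State.setReg_reg, if_true, if_neg hx.1, if_neg hx.2, if_neg hy.1, if_neg hy.2, hc]
  norm_num [hcard]
  ring

end Eval

/-! ### Choosing the best purchase -/

/-- The purchase with the parameters in the registers `5` and `6` is prepared: its graph, the
distances in this graph, its cost and its gain are computed. -/
def prepareCmd : Cmd :=
  .seq (.fill 6 buyTerm) (.seq (distCmd 6 7) (.seq (.set 15 costTerm)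
    (.set 16 (.sub (potentialTerm 5) (potentialTerm 7)))))

/-- The prepared purchase serves the pair, and it is the first one that does so, or its ratio of
gain to square of the cost is larger than that of the best purchase so far. -/
def isBetter : Term :=
  .and (.le (.cell 7 (.reg 3) (.reg 4)) (.add pathLength fourK))
    (.or (.eq (.reg 17) (.const 0)) (.lt (sqMul 15 18) (sqMul 17 16)))

/-- The registers `17` and `18` and array `9` keep the cost, the gain and the graph of the best
purchase so far. -/
def recordCmd : Cmd := .seq (.set 17 (.reg 15)) (.seq (.set 18 (.reg 16)) (copyCmd 9 6))

/-- A purchase is compared with the best one so far. -/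
def tryCmd : Cmd := .seq prepareCmd (.ite isBetter recordCmd .skip)

/-- All the purchases for a pair are compared. Register `17` is `0` as long as none has been found
that serves the pair. -/
def purchaseCmd : Cmd := .seq (.set 17 (.const 0)) (.for_ 5 (.for_ 6 tryCmd))

/-- The drop of the potential caused by a purchase. -/
noncomputable def gain (G : SimpleGraph (Fin n)) (Z : Finset (Fin n)) (k : ℕ)
    (H : SimpleGraph (Fin n)) (p : ℕ → Fin n) (L a b : ℕ) : ℕ :=
  potential G Z k H - potential G Z k (buy H p L a b)

/-- The purchase with the parameters `a` and `b` serves the pair `(s, t)`. -/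
def Serves (G H : SimpleGraph (Fin n)) (k : ℕ) (p : ℕ → Fin n) (s t : Fin n) (a b : ℕ) : Prop :=
  capDist k (buy H p (G.dist s t) a b) s t ≤ G.dist s t + 4 * k

/-- The memory holds the best one among the purchases with parameters in `D`. -/
def IsBest (st : State) (G H : SimpleGraph (Fin n)) (Z : Finset (Fin n)) (k : ℕ) (p : ℕ → Fin n)
    (s t : Fin n) (D : Set (ℕ × ℕ)) : Prop :=
  (st.reg 17 = 0 ∧ ∀ x ∈ D, ¬ Serves G H k p s t x.1 x.2) ∨
  ∃ a₀ b₀, Serves G H k p s t a₀ b₀ ∧ st.reg 17 = cost H p (G.dist s t) a₀ b₀ ∧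
    st.reg 18 = gain G Z k H p (G.dist s t) a₀ b₀ ∧ st.HasAdj 9 (buy H p (G.dist s t) a₀ b₀) ∧
    ∀ x ∈ D, Serves G H k p s t x.1 x.2 →
      gain G Z k H p (G.dist s t) x.1 x.2 * cost H p (G.dist s t) a₀ b₀ ^ 2 ≤
        gain G Z k H p (G.dist s t) a₀ b₀ * cost H p (G.dist s t) x.1 x.2 ^ 2

lemma cost_le_length {V : Type*} (H : SimpleGraph V) (p : ℕ → V) (L a b : ℕ) :
    cost H p L a b ≤ L := by
  classical
  exact (Finset.card_filter_le _ _).trans (Finset.card_range L).le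

section Purchase

variable {st : State} {k : ℕ} {G H : SimpleGraph (Fin n)} {cl : Fin n → Option (Fin n)}
  {p : ℕ → Fin n} {s t : Fin n}

lemma IsBest.of_eq {Z : Finset (Fin n)} {D : Set (ℕ × ℕ)} {st' : State}
    (h : IsBest st G H Z k p s t D) (h17 : st'.reg 17 = st.reg 17) (h18 : st'.reg 18 = st.reg 18)
    (h9 : st'.arr 9 = st.arr 9) : IsBest st' G H Z k p s t D := by
  rcases h with ⟨h1, h2⟩ | ⟨a, b, h1, h2, h3, h4, h5⟩
  · exact .inl ⟨h17.trans h1, h2⟩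
  · exact .inr ⟨a, b, h1, h17.trans h2, h18.trans h3, h4.of_arr h9, h5⟩

lemma prepareCmd_spec (h : IsPairState st k G H cl p s t)
    (hp : IsShortestPath G p (G.dist s t) s t) {a b : ℕ} (ha : st.reg 5 = a) (hb : st.reg 6 = b) :
    IsPairState (prepareCmd.sem st) k G H cl p s t ∧
      (prepareCmd.sem st).HasAdj 6 (buy H p (G.dist s t) a b) ∧
      (prepareCmd.sem st).HasDist k 7 (buy H p (G.dist s t) a b) ∧
      (prepareCmd.sem st).reg 15 = cost H p (G.dist s t) a b ∧
      (prepareCmd.sem st).reg 16 = gain G (centres cl) k H p (G.dist s t) a b := by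
  set st₁ := (Cmd.fill 6 buyTerm).sem st with hst₁
  set st₂ := (distCmd 6 7).sem st₁ with hst₂
  have h₁ : IsPairState st₁ k G H cl p s t := h.sem rfl
  have h₂ : IsPairState st₂ k G H cl p s t := h₁.sem rfl
  have hA : st₁.HasAdj 6 (buy H p (G.dist s t) a b) := fill_buyTerm h hp ha hb
  have hD : st₂.HasDist k 7 (buy H p (G.dist s t) a b) :=
    distCmd_spec (by norm_num) (by norm_num) (by norm_num) h₁.reg_n h₁.reg_k hA
  have h5 : st₂.reg 5 = a := by rw [hst₂, Cmd.sem_reg _ rfl, hst₁, Cmd.sem_reg _ rfl, ha]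
  have h6 : st₂.reg 6 = b := by rw [hst₂, Cmd.sem_reg _ rfl, hst₁, Cmd.sem_reg _ rfl, hb]
  set st₃ := st₂.setReg 15 (costTerm.eval st₂) with hst₃
  have h₃ : IsPairState st₃ k G H cl p s t := h₂.setReg (by norm_num) _
  have hsem : prepareCmd.sem st =
      st₃.setReg 16 ((potentialTerm 5).eval st₃ - (potentialTerm 7).eval st₃) := rfl
  rw [hsem]
  refine ⟨h₃.setReg (by norm_num) _, (hA.of_arr (Cmd.sem_arr _ rfl) : st₂.HasAdj 6 _), hD, ?_, ?_⟩
  · rw [State.setReg_reg, if_neg (by norm_num), hst₃, State.setReg_reg, if_pos rfl,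
      eval_costTerm h₂ hp.reachable h5 h6]
  · rw [State.setReg_reg, if_pos rfl, gain,
      eval_potentialTerm h₃.reg_n h₃.reg_k h₃.clusters h₃.distG h₃.distH,
      eval_potentialTerm h₃.reg_n h₃.reg_k h₃.clusters h₃.distG (F := buy H p (G.dist s t) a b) hD]

lemma tryCmd_spec (h : IsPairState st k G H cl p s t) (hp : IsShortestPath G p (G.dist s t) s t)
    (hun : G.dist s t + 4 * k < capDist k H s t) {a b : ℕ} (ha : st.reg 5 = a) (hb : st.reg 6 = b)
    {D : Set (ℕ × ℕ)} (hD : IsBest st G H (centres cl) k p s t D) :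
    IsPairState (tryCmd.sem st) k G H cl p s t ∧
      IsBest (tryCmd.sem st) G H (centres cl) k p s t (insert (a, b) D) := by
  refine ⟨h.sem rfl, ?_⟩
  obtain ⟨h₁, hA, hdist, h15, h16⟩ := prepareCmd_spec h hp ha hb
  have hD₁ : IsBest (prepareCmd.sem st) G H (centres cl) k p s t D :=
    hD.of_eq (Cmd.sem_reg _ rfl) (Cmd.sem_reg _ rfl) (Cmd.sem_arr _ rfl)
  set st₁ := prepareCmd.sem st with hst₁
  have hsem : tryCmd.sem st = if isBetter.Holds st₁ then recordCmd.sem st₁ else st₁ := rfl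
  have hLn : G.dist s t < n := by simpa using dist_lt_card hp.reachable
  have hpos : ∀ {a b}, Serves G H k p s t a b → 0 < cost H p (G.dist s t) a b := by
    intro a b hs
    refine Nat.pos_of_ne_zero fun h0 => ?_
    rw [Serves, buy_eq_of_cost_eq_zero h0] at hs
    omega
  have hbetter : isBetter.Holds st₁ ↔ Serves G H k p s t a b ∧
      (st₁.reg 17 = 0 ∨ (sqMul 15 18).eval st₁ < (sqMul 17 16).eval st₁) := by
    rw [isBetter, Term.holds_and, Term.holds_or, Term.holds_le, Term.holds_lt, Term.holds_eq,
      Term.eval_add, eval_pathLength h₁ hp.reachable, eval_fourK, h₁.reg_k, Term.eval_cell,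
      Term.eval_reg, Term.eval_reg, h₁.reg_s, h₁.reg_t, hdist]
    rfl
  have h₁₅ : (sqMul 15 18).eval st₁ = st₁.reg 18 * cost H p (G.dist s t) a b ^ 2 :=
    eval_sqMul (by norm_num) (by norm_num) h15 (by
      have := cost_le_length H p (G.dist s t) a b
      rw [h₁.reg_n]
      omega)
  have hrec : (recordCmd.sem st₁).reg 17 = cost H p (G.dist s t) a b ∧
      (recordCmd.sem st₁).reg 18 = gain G (centres cl) k H p (G.dist s t) a b ∧
      (recordCmd.sem st₁).HasAdj 9 (buy H p (G.dist s t) a b) := by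
    have hs : recordCmd.sem st₁ = (copyCmd 9 6).sem
        ((st₁.setReg 17 (st₁.reg 15)).setReg 18 (st₁.reg 16)) := rfl
    rw [hs]
    refine ⟨?_, ?_, fun i j => ?_⟩
    · rw [Cmd.sem_reg _ rfl]
      simpa using h15
    · rw [Cmd.sem_reg _ rfl]
      simpa using h16
    · rw [copyCmd_apply (by norm_num) (by simpa using h₁.reg_n)]
      exact hA i j
  rcases hD₁ with ⟨h17, hnone⟩ | ⟨a₀, b₀, hs₀, h17, h18, hA₀, hdom⟩
  · by_cases hs : Serves G H k p s t a b
    · rw [hsem, if_pos (hbetter.2 ⟨hs, .inl h17⟩)]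
      refine .inr ⟨a, b, hs, hrec.1, hrec.2.1, hrec.2.2, ?_⟩
      rintro x (rfl | hx) hxs
      · exact le_rfl
      · exact absurd hxs (hnone x hx)
    · rw [hsem, if_neg fun hc => hs (hbetter.1 hc).1]
      refine .inl ⟨h17, ?_⟩
      rintro x (rfl | hx)
      · exact hs
      · exact hnone x hx
  · have h₁₇ : (sqMul 17 16).eval st₁ =
        gain G (centres cl) k H p (G.dist s t) a b * cost H p (G.dist s t) a₀ b₀ ^ 2 := by
      rw [eval_sqMul (by norm_num) (by norm_num) h17 (by
        have := cost_le_length H p (G.dist s t) a₀ b₀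
        rw [h₁.reg_n]
        omega), h16]
    have hpos₀ := hpos hs₀
    rw [h₁₅, h₁₇, h17, h18] at hbetter
    by_cases hb : isBetter.Holds st₁
    · rw [hsem, if_pos hb]
      obtain ⟨hs, hlt⟩ := hbetter.1 hb
      replace hlt := hlt.resolve_left hpos₀.ne'
      refine .inr ⟨a, b, hs, hrec.1, hrec.2.1, hrec.2.2, ?_⟩
      rintro x (rfl | hx) hxs
      · exact le_rfl
      · have h₂ := hdom x hx hxs
        -- compare with the old best purchase, and cancel the square of its cost
        refine Nat.le_of_mul_le_mul_left ?_ (pow_pos hpos₀ 2)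
        calc _ = gain G (centres cl) k H p (G.dist s t) x.1 x.2 *
              cost H p (G.dist s t) a₀ b₀ ^ 2 * cost H p (G.dist s t) a b ^ 2 := by ring
          _ ≤ gain G (centres cl) k H p (G.dist s t) a₀ b₀ * cost H p (G.dist s t) x.1 x.2 ^ 2 *
              cost H p (G.dist s t) a b ^ 2 := Nat.mul_le_mul_right _ h₂
          _ = gain G (centres cl) k H p (G.dist s t) a₀ b₀ * cost H p (G.dist s t) a b ^ 2 *
              cost H p (G.dist s t) x.1 x.2 ^ 2 := by ring
          _ ≤ gain G (centres cl) k H p (G.dist s t) a b * cost H p (G.dist s t) a₀ b₀ ^ 2 *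
              cost H p (G.dist s t) x.1 x.2 ^ 2 := Nat.mul_le_mul_right _ hlt.le
          _ = _ := by ring
    · rw [hsem, if_neg hb]
      refine .inr ⟨a₀, b₀, hs₀, h17, h18, hA₀, ?_⟩
      rintro x (rfl | hx) hxs
      · exact not_lt.1 fun hlt => hb (hbetter.2 ⟨hxs, .inr hlt⟩)
      · exact hdom x hx hxs

lemma purchaseCmd_spec (h : IsPairState st k G H cl p s t)
    (hp : IsShortestPath G p (G.dist s t) s t) (hun : G.dist s t + 4 * k < capDist k H s t) :
    ∃ H', (purchaseCmd.sem st).HasAdj 9 H' ∧ IsGreedyStep G (centres cl) k s t H H' := by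
  have hLn : G.dist s t < n := by simpa using dist_lt_card hp.reachable
  set st₁ := st.setReg 17 0 with hst₁
  have h₁ : IsPairState st₁ k G H cl p s t := h.setReg (by norm_num) _
  have key := Cmd.sem_for_induction (x := 5) (c := .for_ 6 tryCmd) (s := st₁)
    (fun m st' => IsPairState st' k G H cl p s t ∧
      IsBest st' G H (centres cl) k p s t {x | x.1 < m ∧ x.2 < n})
    ⟨h₁, .inl ⟨by simp [hst₁], by simp⟩⟩
    (by
      rintro i - st₂ ⟨h₂, hB₂⟩
      have h₂' : IsPairState (st₂.setReg 5 i) k G H cl p s t := h₂.setReg (by norm_num) _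
      have inner := Cmd.sem_for_induction (x := 6) (c := tryCmd) (s := st₂.setReg 5 i)
        (fun m st' => st'.reg 5 = i ∧ IsPairState st' k G H cl p s t ∧
          IsBest st' G H (centres cl) k p s t
            {x | x.1 < i ∧ x.2 < n ∨ x.1 = i ∧ x.2 < m})
        ⟨by simp, h₂', by simpa using hB₂.of_eq (st' := st₂.setReg 5 i) (by simp) (by simp) rfl⟩
        (by
          rintro j - st₃ ⟨h5, h₃, hB₃⟩
          have h₃' : IsPairState (st₃.setReg 6 j) k G H cl p s t := h₃.setReg (by norm_num) _
          obtain ⟨h₄, hB₄⟩ := tryCmd_spec h₃' hp hun (a := i) (b := j) (by simpa using h5)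
            (by simp) (hB₃.of_eq (by simp) (by simp) rfl)
          refine ⟨by rw [Cmd.sem_reg _ rfl]; simpa using h5, h₄, ?_⟩
          convert hB₄ using 1
          ext ⟨x, y⟩
          simp only [Set.mem_ofPred_eq, Set.mem_insert_iff, Prod.mk.injEq]
          omega)
        (by
          rintro st₃ ⟨h5, h₃, hB₃⟩
          exact ⟨by simpa using h5, h₃.setReg (by norm_num) _, hB₃.of_eq (by simp) (by simp) rfl⟩)
      refine ⟨inner.2.1, ?_⟩
      rw [h₂'.reg_n] at inner
      convert inner.2.2 using 1
      ext ⟨x, y⟩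
      simp only [Set.mem_ofPred_eq]
      omega)
    (by
      rintro st₂ ⟨h₂, hB₂⟩
      exact ⟨h₂.setReg (by norm_num) _, hB₂.of_eq (by simp) (by simp) rfl⟩)
  obtain ⟨-, hB⟩ := key
  rw [h₁.reg_n] at hB
  rcases hB with ⟨-, hnone⟩ | ⟨a, b, hs, -, -, hA, hdom⟩
  · -- buying the whole path serves the pair
    refine absurd ?_ (hnone (G.dist s t, G.dist s t) ⟨hLn, hLn⟩)
    have h₂ := capDist_segment k (H := buy H p (G.dist s t) (G.dist s t) (G.dist s t)) (p := p)
      (Nat.zero_le (G.dist s t)) fun l _ hl => buy_adj (hp.adj l hl) hl (Or.inl hl)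
    rw [hp.start, hp.finish] at h₂
    rw [Serves]
    exact h₂.trans (by rw [Nat.sub_zero]; exact Nat.le_add_right _ _)
  · refine ⟨_, hA, p, G.dist s t, a, b, hp, rfl, hs, fun a' b' ha hb hs' => ?_⟩
    exact hdom (a', b') ⟨by omega, by omega⟩ hs'

end Purchase

/-! ### The greedy run for one threshold -/

/-- A pair that is not yet served well enough is served by the best purchase. -/
def serveCmd : Cmd :=
  .ite (.and (.cell 1 (.reg 3) (.reg 4)) (.and (.lt pathLength infinity)
      (.lt (.add pathLength fourK) (.cell 5 (.reg 3) (.reg 4)))))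
    (.seq pathCmd (.seq purchaseCmd (.seq (copyCmd 3 9) (distCmd 3 5)))) .skip

/-- The clusters are formed for the threshold that exceeds register `2` by one, and then all the
pairs are served in turn. -/
def runCmd : Cmd :=
  .seq clusterCmd (.seq (distCmd 3 5) (.for_ 3 (.for_ 4 serveCmd)))

/-- The input, together with the distances in `G`. -/
structure IsInputState (st : State) (k : ℕ) (G : SimpleGraph (Fin n)) (P : Finset (Fin n × Fin n)) :
    Prop where
  reg_n : st.reg 0 = n
  reg_k : st.reg 1 = k
  adjG : st.HasAdj 0 G
  pairs : ∀ i j : Fin n, st.arr 1 i j = bit ((i, j) ∈ P)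
  distG : st.HasDist k 4 G

/-- The memory content between the treatment of two pairs: `H` is the current graph. -/
structure IsRunState (st : State) (k : ℕ) (G : SimpleGraph (Fin n)) (P : Finset (Fin n × Fin n))
    (cl : Fin n → Option (Fin n)) (H : SimpleGraph (Fin n)) : Prop
    extends IsInputState st k G P where
  clusters : st.HasClusters cl
  adj : st.HasAdj 3 H
  distH : st.HasDist k 5 H

section Run

variable {st : State} {k : ℕ} {G H : SimpleGraph (Fin n)} {P : Finset (Fin n × Fin n)}
  {cl : Fin n → Option (Fin n)}

lemma IsInputState.of_eq {st' : State} (h : IsInputState st k G P) (h0 : st'.reg 0 = st.reg 0)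
    (h1 : st'.reg 1 = st.reg 1) (ha0 : st'.arr 0 = st.arr 0) (ha1 : st'.arr 1 = st.arr 1)
    (ha4 : st'.arr 4 = st.arr 4) : IsInputState st' k G P :=
  ⟨h0.trans h.reg_n, h1.trans h.reg_k, h.adjG.of_arr ha0, fun i j => by rw [ha1, h.pairs],
    h.distG.of_arr ha4⟩

lemma IsRunState.setReg (h : IsRunState st k G P cl H) {x : ℕ} (hx : 1 < x) (v : ℕ) :
    IsRunState (st.setReg x v) k G P cl H := by
  refine ⟨h.toIsInputState.of_eq ?_ ?_ rfl rfl rfl, h.clusters, h.adj, h.distH⟩ <;>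
  · rw [State.setReg_reg, if_neg (by omega)]

lemma serveCmd_spec (h : IsRunState st k G P cl H) {s t : Fin n} (hs : st.reg 3 = s)
    (ht : st.reg 4 = t) {H₀ : SimpleGraph (Fin n)} {Q : Set (Fin n × Fin n)}
    (hrun : GreedyRun G k (centres cl) H₀ Q H) (hQ : (s, t) ∉ Q) :
    ∃ H', IsRunState (serveCmd.sem st) k G P cl H' ∧
      GreedyRun G k (centres cl) H₀ (Q ∪ {x | x ∈ P ∧ x = (s, t)}) H' := by
  classical
  set c : Term := .and (.cell 1 (.reg 3) (.reg 4)) (.and (.lt pathLength infinity)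
      (.lt (.add pathLength fourK) (.cell 5 (.reg 3) (.reg 4)))) with hc
  set body : Cmd := .seq pathCmd (.seq purchaseCmd (.seq (copyCmd 3 9) (distCmd 3 5))) with hbody
  have hsem : serveCmd.sem st = if c.Holds st then body.sem st else st := rfl
  have hiff : c.Holds st ↔ (s, t) ∈ P ∧ G.Reachable s t ∧
      capDist k G s t + 4 * k < capDist k H s t := by
    rw [hc, Term.holds_and, Term.holds_and, Term.holds_cell, Term.holds_lt, Term.holds_lt,
      Term.eval_add, eval_fourK, eval_infinity, pathLength]
    simp only [Term.eval_cell, Term.eval_reg]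
    rw [hs, ht, h.pairs, bit_ne_zero, h.distG, h.distH, h.reg_n, h.reg_k]
    refine and_congr_right fun _ => and_congr_left fun _ => ⟨fun hlt => ?_, fun hr => ?_⟩
    · by_contra hnr
      rw [capDist, if_neg hnr, Fintype.card_fin] at hlt
      exact lt_irrefl _ hlt
    · have h₁ : G.dist s t < n := by simpa using dist_lt_card hr
      rw [capDist_of_reachable hr]
      omega
  by_cases hP : (s, t) ∈ P
  · have hset : Q ∪ {x | x ∈ P ∧ x = (s, t)} = insert (s, t) Q := by
      ext x
      simp only [Set.mem_union, Set.mem_ofPred_eq, Set.mem_insert_iff]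
      constructor
      · rintro (hx | ⟨-, hx⟩)
        · exact .inr hx
        · exact .inl hx
      · rintro (rfl | hx)
        · exact .inr ⟨hP, rfl⟩
        · exact .inl hx
    rw [hset]
    by_cases hH : c.Holds st
    · rw [hsem, if_pos hH]
      obtain ⟨-, hr, hlt⟩ := hiff.1 hH
      obtain ⟨p, hp, harr⟩ := pathCmd_spec h.reg_n hs ht h.adjG h.distG hr
      have h₁ : IsPairState (pathCmd.sem st) k G H cl p s t :=
        ⟨(Cmd.sem_reg _ rfl).trans h.reg_n, (Cmd.sem_reg _ rfl).trans h.reg_k,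
          (Cmd.sem_reg _ rfl).trans hs, (Cmd.sem_reg _ rfl).trans ht,
          h.adj.of_arr (Cmd.sem_arr _ rfl), h.distG.of_arr (Cmd.sem_arr _ rfl),
          h.distH.of_arr (Cmd.sem_arr _ rfl), fun u => by
            rw [Cmd.sem_arr (c := pathCmd) _ rfl, h.clusters], harr⟩
      have hlt' : G.dist s t + 4 * k < capDist k H s t := by rwa [capDist_of_reachable hr] at hlt
      obtain ⟨H', hA, hstep⟩ := purchaseCmd_spec h₁ hp hlt'
      have h₂ : IsPairState (purchaseCmd.sem (pathCmd.sem st)) k G H cl p s t := h₁.sem rfl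
      set st₂ := purchaseCmd.sem (pathCmd.sem st) with hst₂
      have hA₃ : ((copyCmd 3 9).sem st₂).HasAdj 3 H' := fun i j => by
        rw [copyCmd_apply (by norm_num) h₂.reg_n]
        exact hA i j
      have hbs : body.sem st = (distCmd 3 5).sem ((copyCmd 3 9).sem st₂) := rfl
      refine ⟨H', ⟨h.toIsInputState.of_eq (Cmd.sem_reg _ rfl) (Cmd.sem_reg _ rfl)
        (Cmd.sem_arr _ rfl) (Cmd.sem_arr _ rfl) (Cmd.sem_arr _ rfl), fun u => ?_, ?_, ?_⟩,
        hrun.step hQ hr hlt hstep⟩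
      · rw [Cmd.sem_arr (c := body) _ rfl, h.clusters]
      · rw [hbs]
        exact hA₃.of_arr (Cmd.sem_arr _ rfl)
      · rw [hbs]
        exact distCmd_spec (by norm_num) (by norm_num) (by norm_num)
          ((Cmd.sem_reg _ rfl).trans h₂.reg_n) ((Cmd.sem_reg _ rfl).trans h₂.reg_k) hA₃
    · rw [hsem, if_neg hH]
      exact ⟨H, h, hrun.skip fun hr => not_lt.1 fun hlt => hH (hiff.2 ⟨hP, hr, hlt⟩)⟩
  · have hset : Q ∪ {x | x ∈ P ∧ x = (s, t)} = Q := by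
      refine Set.union_eq_self_of_subset_right ?_
      rintro x ⟨hx, rfl⟩
      exact absurd hx hP
    rw [hset, hsem, if_neg fun hH => hP (hiff.1 hH).1]
    exact ⟨H, h, hrun⟩

lemma runCmd_spec (h : IsInputState st k G P) {m : ℕ} (hm : st.reg 2 = m) :
    ∃ H, IsOutcome G (P : Set (Fin n × Fin n)) k (m + 1) H ∧ (runCmd.sem st).HasAdj 3 H := by
  obtain ⟨cl, hcl, hcode, hadj⟩ := clusterCmd_spec h.reg_n hm h.adjG
  set st₁ := (distCmd 3 5).sem (clusterCmd.sem st) with hst₁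
  have h₁ : IsRunState st₁ k G P cl (clusterGraph G cl) := by
    refine ⟨h.of_eq ?_ ?_ ?_ ?_ ?_, fun u => ?_, hadj.of_arr (Cmd.sem_arr _ rfl), ?_⟩
    · rw [hst₁, Cmd.sem_reg _ rfl, Cmd.sem_reg _ rfl]
    · rw [hst₁, Cmd.sem_reg _ rfl, Cmd.sem_reg _ rfl]
    · rw [hst₁, Cmd.sem_arr _ rfl, Cmd.sem_arr _ rfl]
    · rw [hst₁, Cmd.sem_arr _ rfl, Cmd.sem_arr _ rfl]
    · rw [hst₁, Cmd.sem_arr _ rfl, Cmd.sem_arr _ rfl]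
    · rw [hst₁, Cmd.sem_arr _ rfl, hcode]
    · exact distCmd_spec (by norm_num) (by norm_num) (by norm_num)
        ((Cmd.sem_reg _ rfl).trans h.reg_n) ((Cmd.sem_reg _ rfl).trans h.reg_k) hadj
  have key := Cmd.sem_for_induction (x := 3) (c := .for_ 4 serveCmd) (s := st₁)
    (fun i st' => ∃ H, IsRunState st' k G P cl H ∧
      GreedyRun G k (centres cl) (clusterGraph G cl) {x | x ∈ P ∧ x.1.val < i} H)
    ⟨_, h₁, by simpa using GreedyRun.init⟩
    (by
      rintro i hi st₂ ⟨H, h₂, hrun⟩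
      rw [h₁.reg_n] at hi
      have h₂' : IsRunState (st₂.setReg 3 i) k G P cl H := h₂.setReg (by norm_num) _
      have inner := Cmd.sem_for_induction (x := 4) (c := serveCmd) (s := st₂.setReg 3 i)
        (fun j st' => st'.reg 3 = i ∧ ∃ H, IsRunState st' k G P cl H ∧
          GreedyRun G k (centres cl) (clusterGraph G cl)
            {x | x ∈ P ∧ (x.1.val < i ∨ x.1.val = i ∧ x.2.val < j)} H)
        ⟨by simp, H, h₂', by simpa using hrun⟩
        (by
          rintro j hj st₃ ⟨h3, H, h₃, hrun₃⟩
          rw [h₂'.reg_n] at hj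
          have h₃' : IsRunState (st₃.setReg 4 j) k G P cl H := h₃.setReg (by norm_num) _
          obtain ⟨H', h₄, hrun₄⟩ := serveCmd_spec h₃' (s := ⟨i, hi⟩) (t := ⟨j, hj⟩)
            (by simpa using h3) (by simp) hrun₃ (by simp)
          refine ⟨by rw [Cmd.sem_reg _ rfl]; simpa using h3, H', h₄, ?_⟩
          convert hrun₄ using 1
          ext ⟨x, y⟩
          simp only [Set.mem_ofPred_eq, Set.mem_union, Prod.mk.injEq, ← and_or_left, Fin.ext_iff]
          refine and_congr_right fun _ => ?_
          omega)
        (by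
          rintro st₃ ⟨h3, H, h₃, hrun₃⟩
          exact ⟨by simpa using h3, H, h₃.setReg (by norm_num) _, hrun₃⟩)
      obtain ⟨-, H', h₄, hrun₄⟩ := inner
      rw [h₂'.reg_n] at hrun₄
      refine ⟨H', h₄, ?_⟩
      convert hrun₄ using 1
      ext ⟨x, y⟩
      simp only [Set.mem_ofPred_eq]
      refine and_congr_right fun _ => ?_
      omega)
    (by
      rintro st₂ ⟨H, h₂, hrun⟩
      exact ⟨H, h₂.setReg (by norm_num) _, hrun⟩)
  obtain ⟨H, h₂, hrun⟩ := key
  refine ⟨H, ⟨cl, hcl, ?_⟩, h₂.adj⟩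
  rw [h₁.reg_n] at hrun
  convert hrun using 1
  ext x
  simp

end Run

/-! ### The smallest outcome over all thresholds -/

/-- The number of ordered pairs of adjacent vertices of the graph in array `3`. -/
def sizeTerm : Term := .sum 7 (.sum 8 (.cell 3 (.reg 7) (.reg 8)))

/-- The graph in array `3` replaces the one in array `2` if it is smaller, or if it is the
first one. Register `19` tells whether there has been one before, and register `20` keeps the size. -/
def keepCmd : Cmd :=
  .seq (.set 21 sizeTerm) (.ite (.or (.eq (.reg 19) (.const 0)) (.lt (.reg 21) (.reg 20)))
    (.seq (.set 19 (.const 1)) (.seq (.set 20 (.reg 21)) (copyCmd 2 3))) .skip)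

/-- If there are pairs at all, a smallest outcome is computed. -/
def spannerCmd : Cmd :=
  .ite (.sum 7 (.sum 8 (.cell 1 (.reg 7) (.reg 8))))
    (.seq (distCmd 0 4) (.for_ 2 (.seq runCmd keepCmd))) .skip

section Spanner

variable {st : State} {k : ℕ} {G H : SimpleGraph (Fin n)} {P : Finset (Fin n × Fin n)}

lemma eval_sizeTerm (hn : st.reg 0 = n) (hH : st.HasAdj 3 H) :
    sizeTerm.eval st = 2 * H.edgeSet.ncard := by
  classical
  rw [← SimpleGraph.coe_edgeFinset, Set.ncard_coe_finset, ← H.sum_degrees_eq_twice_card_edges,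
    sizeTerm, Term.eval_sum, hn, Finset.sum_range]
  refine Finset.sum_congr rfl fun i _ => ?_
  rw [Term.eval_sum, State.setReg_reg, if_neg (by norm_num), hn,
    ← SimpleGraph.card_neighborSet_eq_degree, ← Nat.card_eq_fintype_card, Nat.card_coe_set_eq,
    Finset.sum_range]
  refine Eq.trans (Finset.sum_congr rfl fun j _ => ?_) ((Finset.sum_range _).symm.trans
    (sum_range_bit_eq_ncard (p := fun j => st.arr 3 i j ≠ 0)) |>.trans ?_)
  · simp only [Term.eval_cell, Term.eval_reg, State.setReg_reg, State.setReg_arr]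
    norm_num [hH i j, bit_eq_zero]
  · congr 1
    ext j
    simp [hH i j, bit_eq_zero]

/-- The memory holds a smallest one of `m` outcomes, one for each threshold from `1` to `m`. -/
def IsSmallest (st : State) (G : SimpleGraph (Fin n)) (P : Finset (Fin n × Fin n)) (k m : ℕ) :
    Prop :=
  (st.reg 19 = 0 ∧ m = 0) ∨ ∃ H, st.reg 19 = 1 ∧ st.HasAdj 2 H ∧ st.reg 20 = 2 * H.edgeSet.ncard ∧
    (∃ h, IsOutcome G (P : Set (Fin n × Fin n)) k h H) ∧
    ∀ h, 1 ≤ h → h ≤ m → ∃ H', IsOutcome G (P : Set (Fin n × Fin n)) k h H' ∧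
      H.edgeSet.ncard ≤ H'.edgeSet.ncard

lemma keepCmd_spec (hn : st.reg 0 = n) {m : ℕ} (hS : IsSmallest st G P k m)
    (hH : st.HasAdj 3 H) (hout : IsOutcome G (P : Set (Fin n × Fin n)) k (m + 1) H) :
    IsSmallest (keepCmd.sem st) G P k (m + 1) := by
  set st₁ := st.setReg 21 (2 * H.edgeSet.ncard) with hst₁
  have hsem : keepCmd.sem st =
      if (Term.or (.eq (.reg 19) (.const 0)) (.lt (.reg 21) (.reg 20))).Holds st₁ then
        (copyCmd 2 3).sem ((st₁.setReg 19 1).setReg 20 (st₁.reg 21)) else st₁ := by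
    rw [hst₁, ← eval_sizeTerm hn hH]
    rfl
  have hiff : (Term.or (.eq (.reg 19) (.const 0)) (.lt (.reg 21) (.reg 20))).Holds st₁ ↔
      st.reg 19 = 0 ∨ 2 * H.edgeSet.ncard < st.reg 20 := by
    simp [hst₁]
  have hnew : (∀ h, 1 ≤ h → h ≤ m → ∃ H', IsOutcome G (P : Set (Fin n × Fin n)) k h H' ∧
      H.edgeSet.ncard ≤ H'.edgeSet.ncard) →
      IsSmallest ((copyCmd 2 3).sem ((st₁.setReg 19 1).setReg 20 (st₁.reg 21))) G P k (m + 1) := by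
    intro hall
    refine .inr ⟨H, ?_, fun i j => ?_, ?_, ⟨_, hout⟩, fun h h1 hm => ?_⟩
    · rw [Cmd.sem_reg _ rfl]
      simp
    · rw [copyCmd_apply (by norm_num) (by simpa [hst₁] using hn)]
      exact hH i j
    · rw [Cmd.sem_reg _ rfl]
      simp [hst₁]
    · rcases Nat.of_le_succ hm with hm | rfl
      · exact hall h h1 hm
      · exact ⟨H, hout, le_rfl⟩
  rcases hS with ⟨h19, rfl⟩ | ⟨H₂, h19, hA, h20, hex, hall⟩
  · rw [hsem, if_pos (hiff.2 (.inl h19))]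
    exact hnew fun h h1 h2 => by omega
  · by_cases hlt : H.edgeSet.ncard < H₂.edgeSet.ncard
    · rw [hsem, if_pos (hiff.2 (.inr (by omega)))]
      refine hnew fun h h1 h2 => ?_
      obtain ⟨H', ho, hle⟩ := hall h h1 h2
      exact ⟨H', ho, hlt.le.trans hle⟩
    · rw [hsem, if_neg (by rw [hiff]; omega)]
      refine .inr ⟨H₂, by simpa [hst₁] using h19, hA, by simpa [hst₁] using h20, hex,
        fun h h1 hm => ?_⟩
      rcases Nat.of_le_succ hm with hm | rfl
      · exact hall h h1 hm
      · exact ⟨H, hout, not_lt.1 hlt⟩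

lemma spannerCmd_spec (hn : st.reg 0 = n) (hk : st.reg 1 = k) (h19 : st.reg 19 = 0)
    (hG : st.HasAdj 0 G) (hP : ∀ i j : Fin n, st.arr 1 i j = bit ((i, j) ∈ P))
    (h2 : ∀ i j, st.arr 2 i j = 0) :
    ∃ H, (spannerCmd.sem st).HasAdj 2 H ∧ (P = ∅ → H = ⊥) ∧
      (P.Nonempty → (∃ h, IsOutcome G (P : Set (Fin n × Fin n)) k h H) ∧
        ∀ h, 1 ≤ h → h ≤ n → ∃ H', IsOutcome G (P : Set (Fin n × Fin n)) k h H' ∧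
          H.edgeSet.ncard ≤ H'.edgeSet.ncard) := by
  have hsem : spannerCmd.sem st =
      if (Term.sum 7 (.sum 8 (.cell 1 (.reg 7) (.reg 8)))).Holds st then
        (Cmd.for_ 2 (.seq runCmd keepCmd)).sem ((distCmd 0 4).sem st) else st := rfl
  have hiff : (Term.sum 7 (.sum 8 (.cell 1 (.reg 7) (.reg 8)))).Holds st ↔ P.Nonempty := by
    simp only [Term.holds_sum, Term.holds_cell, Term.eval_reg, State.setReg_reg, State.setReg_arr]
    norm_num [hn, exists_lt_iff_exists_fin (n := n), hP, bit_eq_zero]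
    exact ⟨fun ⟨i, j, h⟩ => ⟨_, h⟩, fun ⟨x, h⟩ => ⟨x.1, x.2, h⟩⟩
  by_cases hne : P.Nonempty
  · rw [hsem, if_pos (hiff.2 hne)]
    set st₁ := (distCmd 0 4).sem st with hst₁
    have h₁ : IsInputState st₁ k G P :=
      ⟨(Cmd.sem_reg _ rfl).trans hn, (Cmd.sem_reg _ rfl).trans hk, hG.of_arr (Cmd.sem_arr _ rfl),
        fun i j => by rw [hst₁, Cmd.sem_arr _ rfl, hP],
        distCmd_spec (by norm_num) (by norm_num) (by norm_num) hn hk hG⟩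
    have key := Cmd.sem_for_induction (x := 2) (c := .seq runCmd keepCmd) (s := st₁)
      (fun m st' => IsInputState st' k G P ∧ IsSmallest st' G P k m)
      ⟨h₁, .inl ⟨(Cmd.sem_reg _ rfl).trans h19, rfl⟩⟩
      (by
        rintro m - st₂ ⟨h₂, hS⟩
        have h₂' : IsInputState (st₂.setReg 2 m) k G P :=
          h₂.of_eq (by simp) (by simp) rfl rfl rfl
        obtain ⟨H, hout, hH⟩ := runCmd_spec h₂' (m := m) (by simp)
        have hS' : IsSmallest (runCmd.sem (st₂.setReg 2 m)) G P k m := by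
          have e19 : (runCmd.sem (st₂.setReg 2 m)).reg 19 = st₂.reg 19 := by
            rw [Cmd.sem_reg _ rfl]; simp
          have e20 : (runCmd.sem (st₂.setReg 2 m)).reg 20 = st₂.reg 20 := by
            rw [Cmd.sem_reg _ rfl]; simp
          rcases hS with ⟨a, b⟩ | ⟨H₂, a, b, c, d⟩
          · exact .inl ⟨e19.trans a, b⟩
          · exact .inr ⟨H₂, e19.trans a, b.of_arr (Cmd.sem_arr _ rfl), e20.trans c, d⟩
        refine ⟨h₂'.of_eq (Cmd.sem_reg _ rfl) (Cmd.sem_reg _ rfl) (Cmd.sem_arr _ rfl)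
          (Cmd.sem_arr _ rfl) (Cmd.sem_arr _ rfl), ?_⟩
        exact keepCmd_spec ((Cmd.sem_reg _ rfl).trans h₂'.reg_n) hS' hH hout)
      (by
        rintro st₂ ⟨h₂, hS⟩
        refine ⟨h₂.of_eq (by simp) (by simp) rfl rfl rfl, ?_⟩
        rcases hS with ⟨a, b⟩ | ⟨H₂, a, b, c, d⟩
        · exact .inl ⟨by simpa using a, b⟩
        · exact .inr ⟨H₂, by simpa using a, b, by simpa using c, d⟩)
    obtain ⟨-, hS⟩ := key
    rw [h₁.reg_n] at hS
    rcases hS with ⟨-, h0⟩ | ⟨H, -, hA, -, hex, hall⟩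
    · obtain ⟨x, -⟩ := hne
      exact absurd h0 x.1.pos.ne'
    · exact ⟨H, hA, fun h => absurd h hne.ne_empty, fun _ => ⟨hex, hall⟩⟩
  · rw [hsem, if_neg fun h => hne (hiff.1 h)]
    refine ⟨⊥, fun i j => ?_, fun _ => rfl, fun h => absurd h hne⟩
    rw [h2, eq_comm, bit_eq_zero]
    simp

end Spanner

/-! ### The parameter of the logarithmic case -/

/-- If register `1` holds `0`, then it receives the integer part of the logarithm to base `3` of
the content of register `0`. -/
def logCmd : Cmd :=
  .seq (.set 14 (.const 1)) (.for_ 13 (.seq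
    (.set 14 (.add (.reg 14) (.add (.reg 14) (.reg 14))))
    (.ite (.le (.reg 14) (.reg 0)) (.set 1 (.add (.reg 1) (.const 1))) .skip)))

lemma logCmd_spec {st : State} (h1 : st.reg 1 = 0) :
    (logCmd.sem st).reg 1 = Nat.log 3 (st.reg 0) := by
  set st₁ := st.setReg 14 1 with hst₁
  obtain ⟨-, -, h⟩ := Cmd.sem_for_induction (x := 13) (c := .seq
      (.set 14 (.add (.reg 14) (.add (.reg 14) (.reg 14))))
      (.ite (.le (.reg 14) (.reg 0)) (.set 1 (.add (.reg 1) (.const 1))) .skip)) (s := st₁)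
    (fun m st' => st'.reg 0 = st.reg 0 ∧ st'.reg 14 = 3 ^ m ∧
      st'.reg 1 = min m (Nat.log 3 (st.reg 0)))
    ⟨by simp [hst₁], by simp [hst₁], by simp [hst₁, h1]⟩
    (by
      rintro m hm st' ⟨h0, h14, h1'⟩
      have hm' : m < st.reg 0 := by simpa [hst₁] using hm
      set st₂ := (st'.setReg 13 m).setReg 14 (3 ^ (m + 1)) with hst₂
      have hs : (Cmd.seq (.set 14 (.add (.reg 14) (.add (.reg 14) (.reg 14))))
          (.ite (.le (.reg 14) (.reg 0)) (.set 1 (.add (.reg 1) (.const 1))) .skip)).sem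
            (st'.setReg 13 m) =
          if (Term.le (.reg 14) (.reg 0)).Holds st₂ then st₂.setReg 1 (st₂.reg 1 + 1) else st₂ := by
        have h3 : (3 : ℕ) ^ (m + 1) = 3 ^ m + (3 ^ m + 3 ^ m) := by ring
        rw [hst₂, h3, ← h14]
        rfl
      have hiff : (Term.le (.reg 14) (.reg 0)).Holds st₂ ↔ m + 1 ≤ Nat.log 3 (st.reg 0) := by
        rw [Term.holds_le, Nat.le_log_iff_pow_le (by norm_num) (by omega)]
        simp [hst₂, h0]
      rw [hs]
      split_ifs with hc
      · have := hiff.1 hc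
        refine ⟨by simp [hst₂, h0], by simp [hst₂], ?_⟩
        simp only [State.setReg_reg, if_true, hst₂]
        norm_num [h1']
        omega
      · have := mt hiff.2 hc
        refine ⟨by simp [hst₂, h0], by simp [hst₂], ?_⟩
        simp only [State.setReg_reg, hst₂]
        norm_num [h1']
        omega)
    (by
      rintro st' ⟨h0, h14, h1'⟩
      exact ⟨by simpa using h0, by simpa using h14, by simpa using h1'⟩)
  refine h.trans (min_eq_right ?_)
  simpa [hst₁] using Nat.log_le_self 3 (st.reg 0)

/-! ### The algorithms -/

open Polynomial in
/-- A command over the registers below `22` yields a polynomial time algorithm. -/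
lemma exists_prog {c : Cmd} (hc : c.ok 22) : ∃ (prog : Prog) (T : ℕ[X]),
    ∀ {n : ℕ} (G : SimpleGraph (Fin n)) (P : Finset (Fin n × Fin n)) (k : ℕ)
      {H : SimpleGraph (Fin n)}, (c.sem (inputState G P k)).HasAdj 2 H →
      OutputsWithin prog (inputState G P k) H (T.eval n) := by
  obtain ⟨T, hT⟩ := c.exec_compile 22 (by norm_num) hc
  refine ⟨c.compile 22, T, fun {n} G P k H hH => ?_⟩
  obtain ⟨s', t, h₁, h₂, h₃⟩ := hT (inputState G P k)
  exact ⟨s', t, h₁, h₂, fun i j => by rw [h₃.2]; exact hH i j⟩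

section Input

variable {G H : SimpleGraph (Fin n)} {P : Finset (Fin n × Fin n)} {k : ℕ}

lemma inputState_hasAdj : (inputState G P k).HasAdj 0 G := fun i j => by
  simp [inputState]

lemma inputState_pairs (i j : Fin n) : (inputState G P k).arr 1 i j = bit ((i, j) ∈ P) := by
  simp [inputState]

lemma isPairwiseSpanner_empty (α β : ℝ) : IsPairwiseSpanner G ∅ α β ⊥ :=
  ⟨bot_le, fun _ _ h => absurd h (Finset.notMem_empty _)⟩

lemma IsPairwiseSpanner.mono {α β β' : ℝ} (h : IsPairwiseSpanner G P α β H) (hβ : β ≤ β') :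
    IsPairwiseSpanner G P α β' H :=
  ⟨h.1, fun s t hst hr => ⟨(h.2 s t hst hr).1, (h.2 s t hst hr).2.trans (by gcongr)⟩⟩

end Input

lemma mul_threshold (n k q : ℕ) : (n : ℝ) * threshold n k q =
    (n : ℝ) ^ (1 + 1 / (2 * (k : ℝ) + 1)) *
      (√((4 * (k : ℝ) + 5) * (q : ℝ))) ^ ((k : ℝ) / (2 * (k : ℝ) + 1)) := by
  rw [threshold, Real.rpow_add' (Nat.cast_nonneg n) (by positivity), Real.rpow_one, mul_assoc]

/-- The size bound of the logarithmic case for the small graphs, for which the parameter is `0`. -/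
lemma ncard_le_of_lt_three (hn : n < 3) (H : SimpleGraph (Fin n)) {q : ℕ} (hq : 1 ≤ q) :
    (H.edgeSet.ncard : ℝ) ≤ 87 * 27 * (n * ((q : ℝ) * Real.log n) ^ ((1 : ℝ) / 4)) := by
  have hlog : 0 ≤ Real.log n := Real.log_natCast_nonneg n
  rcases Nat.lt_or_ge n 2 with h | h
  · have : Subsingleton (Fin n) := Fin.subsingleton_iff_le_one.2 (by omega)
    have hH : H = ⊥ := Subsingleton.elim _ _
    rw [hH, SimpleGraph.edgeSet_bot, Set.ncard_empty, Nat.cast_zero]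
    positivity
  · obtain rfl : n = 2 := by omega
    have h₁ : (H.edgeSet.ncard : ℝ) ≤ 4 := by
      have := ncard_edgeSet_le H
      rw [Fintype.card_fin] at this
      exact_mod_cast this
    have hq' : (1 : ℝ) ≤ q := by exact_mod_cast hq
    have h₂ : (1 / 2 : ℝ) ≤ q * Real.log (2 : ℕ) := by
      have := Real.log_two_gt_d9
      push_cast
      nlinarith
    have h₃ : (1 / 2 : ℝ) ≤ ((q : ℝ) * Real.log (2 : ℕ)) ^ ((1 : ℝ) / 4) :=
      calc (1 / 2 : ℝ) ≤ (1 / 2 : ℝ) ^ ((1 : ℝ) / 4) :=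
            Real.self_le_rpow_of_le_one (by norm_num) (by norm_num) (by norm_num)
        _ ≤ _ := Real.rpow_le_rpow (by norm_num) h₂ (by norm_num)
    push_cast at h₃ ⊢
    linarith

end PairwiseSpanner

theorem theorem2 :
    -- one algorithm, on input `(G, P, k)`; neither the time bound nor the constant depends on `k`
    (∃ (prog : PairwiseSpanner.Prog) (T : Polynomial ℕ) (C : ℝ),
      ∀ (k : ℕ), 1 ≤ k →
      ∀ (n : ℕ) (G : SimpleGraph (Fin n)) (P : Finset (Fin n × Fin n)),
      ∃ H : SimpleGraph (Fin n),
        PairwiseSpanner.OutputsWithin prog (PairwiseSpanner.inputState G P k) H (T.eval n) ∧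
        PairwiseSpanner.IsPairwiseSpanner G P 1 (4 * (k : ℝ)) H ∧
        (H.edgeSet.ncard : ℝ) ≤
          C * ((n : ℝ) ^ (1 + 1 / (2 * (k : ℝ) + 1)) *
            (√((4 * (k : ℝ) + 5) * (P.card : ℝ))) ^ ((k : ℝ) / (2 * (k : ℝ) + 1)))) ∧
    -- the case of logarithmic stretch; the input is `(G, P)`, and the register of `k` is `0`
    (∃ (prog : PairwiseSpanner.Prog) (T : Polynomial ℕ) (C : ℝ),
      ∀ (n : ℕ) (G : SimpleGraph (Fin n)) (P : Finset (Fin n × Fin n)),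
      ∃ H : SimpleGraph (Fin n),
        PairwiseSpanner.OutputsWithin prog (PairwiseSpanner.inputState G P 0) H (T.eval n) ∧
        PairwiseSpanner.IsPairwiseSpanner G P 1 (4 * Real.log (n : ℝ)) H ∧
        (H.edgeSet.ncard : ℝ) ≤
          C * ((n : ℝ) * ((P.card : ℝ) * Real.log (n : ℝ)) ^ ((1 : ℝ) / 4))) := by
  open PairwiseSpanner in
  constructor
  · obtain ⟨prog, T, hprog⟩ := exists_prog (c := spannerCmd) (by decide)
    refine ⟨prog, T, 87, fun k hk n G P => ?_⟩
    obtain ⟨H, hH, hbot, hout⟩ := spannerCmd_spec (st := inputState G P k) (k := k) (G := G)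
      (P := P) rfl rfl rfl inputState_hasAdj inputState_pairs fun _ _ => rfl
    refine ⟨H, hprog G P k hH, ?_⟩
    rcases P.eq_empty_or_nonempty with rfl | hP
    · rw [hbot rfl, SimpleGraph.edgeSet_bot, Set.ncard_empty, Nat.cast_zero]
      exact ⟨isPairwiseSpanner_empty _ _, by positivity⟩
    · obtain ⟨⟨h, hh⟩, hall⟩ := hout hP
      refine ⟨hh.isPairwiseSpanner, ?_⟩
      rw [← mul_threshold]
      simpa using ncard_le_of_forall_outcome hk hP (by simpa using hall)
  · obtain ⟨prog, T, hprog⟩ := exists_prog (c := .seq logCmd spannerCmd) (by decide)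
    refine ⟨prog, T, 87 * 27, fun n G P => ?_⟩
    set st := logCmd.sem (inputState G P 0) with hst
    have hk : st.reg 1 = Nat.log 3 n := logCmd_spec rfl
    obtain ⟨H, hH, hbot, hout⟩ := spannerCmd_spec (st := st) (k := Nat.log 3 n) (G := G) (P := P)
      (Cmd.sem_reg _ rfl) hk (Cmd.sem_reg _ rfl) (inputState_hasAdj.of_arr (Cmd.sem_arr _ rfl))
      (fun i j => by rw [hst, Cmd.sem_arr _ rfl, inputState_pairs])
      fun _ _ => by rw [hst, Cmd.sem_arr _ rfl]; rfl
    refine ⟨H, hprog G P 0 hH, ?_⟩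
    have hlog : 0 ≤ Real.log n := Real.log_natCast_nonneg n
    rcases P.eq_empty_or_nonempty with rfl | hP
    · rw [hbot rfl, SimpleGraph.edgeSet_bot, Set.ncard_empty, Nat.cast_zero]
      exact ⟨isPairwiseSpanner_empty _ _, by positivity⟩
    · obtain ⟨⟨h, hh⟩, hall⟩ := hout hP
      refine ⟨hh.isPairwiseSpanner.mono
        (mul_le_mul_of_nonneg_left (natLog_three_le_log n) (by norm_num)), ?_⟩
      have hq : 1 ≤ P.card := Finset.card_pos.2 hP
      rcases Nat.lt_or_ge n 3 with hn | hn
      · exact ncard_le_of_lt_three hn H hq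
      · have h₁ := ncard_le_of_forall_outcome (Nat.log_pos (by norm_num) hn) hP
          (by simpa using hall)
        rw [Fintype.card_fin] at h₁
        calc (H.edgeSet.ncard : ℝ) ≤ 87 * (n * threshold n (Nat.log 3 n) P.card) := h₁
          _ ≤ 87 * (27 * (n * ((P.card : ℝ) * Real.log n) ^ ((1 : ℝ) / 4))) := by
              have := mul_threshold_log_le hn hq
              linarith
          _ = _ := by ring
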